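/- **Setting.** Let $T\subset\mathbb R^3$ be a closed nondegenerate tetrahedron with vertices $a_1,\dots,a_4$ and barycentric coordinate functions $\lambda_i$; let $p\in\mathbb N_0$ and $0<\epsilon<\tfrac12$. Let $\mathcal P_m$ denote polynomials of total degree $\le m$ ($\{0\}$ if $m<0$), $\boldsymbol{\mathcal P}_m$ polynomial vector fields, $\mathcal P_m(F)$ restrictions to a facet $F$, and $\mathring{\mathcal P}_m(F)$ those vanishing on $\partial F$. $C^\infty(\overline T)$ denotes restrictions to $T$ of smooth functions on $\mathbb R^3$. For a face $f$, $n_f$ is the exterior unit normal, $n_{e,f}$ the exterior in-plane unit normal of an edge $e\subset\partial f$; $t_e$ is the unit tangent of an edge $e$ (directed arbitrarily). $\mathrm{div}_f$ is the surface divergence and $\mathbf{curl}_f q=(\nabla_f q)\times n_f$. **Spaces.** $W^1_p(T)=\{P+Q\times x:\ P,Q\in\boldsymbol{\mathcal P}_p\}$, $W^2_p(T)=\{P+q\,x:\ P\in\boldsymbol{\mathcal P}_p,\ q\in\mathcal P_p\}$; $W^1_p(e)=W^1_p(T)\cdot t_e$, $W^1_p(f)=W^1_p(T)\times n_f$, $W^2_p(f)=W^2_p(T)\cdot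 n_f$ are the trace spaces. $\mathring W^1_p(e)$, $\mathring W^2_p(f)$: elements with zero integral; $\mathring W^1_p(f)$: $u\cdot n_{e,f}=0$ on all $e\subset\partial f$; $\mathring W^1_p(T)$: $u\times n_f=0$ on all faces; $\mathring W^2_p(T)$: $u\cdot n_f=0$ on all faces. **Projections.** For $0<s<1$, $H^s_0(F)$ is the closure of $C_c^\infty$ of the relative interior of $F$ in the Sobolev–Slobodeckij norm, and $H^{-s}(F)$ is its dual with the dual inner product (for tangential fields: componentwise). $P^1_e$ is the $H^{-1+\epsilon}(e)$-orthogonal projection onto $\mathring W^1_p(e)$; $P^1_f$, $P^2_f$ are the $H^{-1/2+\epsilon}(f)$-orthogonal projections onto $\{v\in\mathring W^1_p(f):\mathrm{div}_f v=0\}$ and $\mathring W^2_p(f)$; $P^1_T,P^2_T,P^3_T$ are the $L^2(T)$-orthogonal projections onto $\{v\in\mathring W^1_p(T):\mathrm{curl}\,v=0\}$, $\{v\in\mathring W^2_p(T):\mathrm{div}\,v=0\}$ and $\{v\in\mathcal P_p(T):\int_T v=0\}$. **Extensions.** Let $E^0_F:\mathring{\mathcal P}_{p+1}(F)\to\mathcal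 P_{p+1}(T)$ ($F$ an edge or a face) be any linear extension operators such that $E^0_Fu$ vanishes on all other facets of the same dimension as $F$. Let $E^1_f$ be the linear operator which maps $w\in\mathring W^1_p(f)$ to the field $v\in W^1_p(T)$ with $v\times n_f=w$ on $f$ and with vanishing other degrees of freedom: $\int_e q\,v\cdot t_e=0$ for all edges $e$, $q\in\mathcal P_p(e)$; $\int_{f'} q\cdot(v\times n_{f'})=0$ for all faces $f'\ne f$ and tangential $q\in\boldsymbol{\mathcal P}_{p-1}(f')$; $\int_T q\cdot v=0$ for all $q\in\boldsymbol{\mathcal P}_{p-2}$. **Liftings.** For $\tau\in\{t_e,-t_e\}$, $L^1_{e,\tau}u\in\mathring{\mathcal P}_{p+1}(e)$ has $\tau$-derivative $u\in\mathring W^1_p(e)$; write $L^1_e=L^1_{e,t_e}$. $L^1_f u\in\mathring{\mathcal P}_{p+1}(f)$ has $\mathbf{curl}_f L^1_fu=u$ and $L^1_Tu\in\mathring{\mathcal P}_{p+1}(T)$ has $\nabla L^1_Tu=u$ (for $u$ in the range of $P^1_f$, resp. $P^1_T$). With $$R_a u(x)=\int_0^1 t\,u(a+t(x-a))\,dt\times(x-a),\quad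 R^{2D}_a u(x)=\int_0^1 t\,u(a+t(x-a))\,dt\,(x-a),\quad D_au(x)=\int_0^1 t^2u(a+t(x-a))\,dt\,(x-a)$$ pick for each face $f$ a vertex $a$ of $f$, with opposite edge $\tilde e\subset\partial f$ and $\tau=n_f\times n_{\tilde e,f}$, and set $L^2_fu=R^{2D}_au-\mathbf{curl}_f\big(E^0_{\tilde e}L^1_{\tilde e,\tau}(R^{2D}_au\cdot n_{\tilde e,f})\big)|_f$. Pick vertices $a,a'$ of $T$, with opposite faces $\tilde f,\tilde f'$, and set $L^2_Tu=R_au-\nabla E^0_{\tilde f}L^1_{\tilde f}\big((R_au\times n_{\tilde f})|_{\tilde f}\big)$ and $L^3_Tu=D_{a'}u-\mathrm{curl}\,E^1_{\tilde f'}L^2_{\tilde f'}\big((D_{a'}u\cdot n_{\tilde f'})|_{\tilde f'}\big)$. **Interpolants.** Let $b_e=\lambda_i\nabla\lambda_j-\lambda_j\nabla\lambda_i$ for the edge $e$ directed from $a_i$ to $a_j$, and $b_f=\pm2(\lambda_j\nabla\lambda_k\times\nabla\lambda_l+\lambda_k\nabla\lambda_l\times\nabla\lambda_j+\lambda_l\nabla\lambda_j\times\nabla\lambda_k)$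 for the face $f$ with vertices $a_j,a_k,a_l$, the sign being such that $\int_f b_f\cdot n_f\,dS=1$. For $u\in C^\infty(\overline T)^3$ put $$\begin{aligned} u^{(0)}&=u-w^{(0)},& w^{(0)}&=\textstyle\sum_e\big(\int_e u\cdot t_e\,dl\big)b_e,\\ u^{(1)}&=u^{(0)}-w^{(1)},& w^{(1)}&=\textstyle\sum_e\nabla E^0_eL^1_eP^1_e\big(u^{(0)}\cdot t_e|_e\big),\\ u^{(2)}&=u^{(1)}-w^{(2)},& w^{(2)}&=\textstyle\sum_f E^1_fL^2_fP^2_f\,\mathrm{div}_f\big(u^{(1)}\times n_f|_f\big),\\ u^{(3)}&=u^{(2)}-w^{(3)},& w^{(3)}&=\textstyle\sum_f\nabla E^0_fL^1_fP^1_f\big(u^{(2)}\times n_f|_f\big),\\ u^{(4)}&=u^{(3)}-w^{(4)},& w^{(4)}&=L^2_TP^2_T\,\mathrm{curl}\,u^{(3)}, \end{aligned}$$ $$\Pi^1_{T,p}u=\nabla L^1_TP^1_Tu^{(4)}+w^{(4)}+w^{(3)}+w^{(2)}+w^{(1)}+w^{(0)},$$ and $$\begin{aligned} v^{(0)}&=u-z^{(0)},&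 z^{(0)}&=\textstyle\sum_f\big(\int_f u\cdot n_f\,dS\big)b_f,\\ v^{(1)}&=v^{(0)}-z^{(1)},& z^{(1)}&=\textstyle\sum_f\mathrm{curl}\,E^1_fL^2_fP^2_f\big(v^{(0)}\cdot n_f|_f\big),\\ v^{(2)}&=v^{(1)}-z^{(2)},& z^{(2)}&=L^3_TP^3_T\,\mathrm{div}\,v^{(1)}, \end{aligned}$$ $$\Pi^2_{T,p}u=\mathrm{curl}\,L^2_TP^2_Tv^{(2)}+z^{(0)}+z^{(1)}+z^{(2)}.$$ **Lemma.** For all such choices, $\Pi^2_{T,p}$ is linear on $C^\infty(\overline T)^3$ and is a projection onto $W^2_p(T)\subset C^\infty(\overline T)^3$, that is, $\Pi^2_{T,p}u\in W^2_p(T)$ for all $u\in C^\infty(\overline T)^3$ and $\Pi^2_{T,p}u=u$ for all $u\in W^2_p(T)$. Moreover $$\Pi^2_{T,p}(\mathrm{curl}\,u)=\mathrm{curl}(\Pi^1_{T,p}u)\qquad\text{for all }u\in C^\infty(\overline T)^3 .$$ -/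

import Mathlib

open MeasureTheory
open scoped ContDiff

namespace PBI

/-- Three-dimensional Euclidean space. -/
abbrev E3 : Type := EuclideanSpace ℝ (Fin 3)

/-- The cross product of two vectors of Euclidean space. -/
noncomputable def cross (v w : E3) : E3 :=
  !₂[v 1 * w 2 - v 2 * w 1, v 2 * w 0 - v 0 * w 2, v 0 * w 1 - v 1 * w 0]

theorem cross_add (v v' w : E3) : cross (v + v') w = cross v w + cross v' w := by
  ext k; fin_cases k <;> simp [cross] <;> ring

theorem cross_smul (c : ℝ) (v w : E3) : cross (c • v) w = c • cross v w := by
  ext k; fin_cases k <;> simp [cross] <;> ring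

/-! ### Functions on subsets of space: restriction and differentiation -/

/-- Extension by zero of a function given on a subset `A` of space. -/
noncomputable def ext0 {V : Type*} [Zero V] {A : Set E3} (u : A → V) : E3 → V :=
  Function.extend Subtype.val u 0

theorem ext0_of_mem {V : Type*} [Zero V] {A : Set E3} (u : A → V) {x : E3} (hx : x ∈ A) :
    ext0 u x = u ⟨x, hx⟩ :=
  Subtype.val_injective.extend_apply u (0 : E3 → V) ⟨x, hx⟩

theorem ext0_of_not_mem {V : Type*} [Zero V] {A : Set E3} (u : A → V) {x : E3} (hx : x ∉ A) :
    ext0 u x = 0 := by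
  refine Function.extend_apply' u (0 : E3 → V) x ?_
  rintro ⟨a, rfl⟩
  exact hx a.2

section Functions

variable {V : Type*} [NormedAddCommGroup V] [NormedSpace ℝ V]

/-- Restriction of functions from all of space to `A`. -/
def restrict (A : Set E3) : (E3 → V) →ₗ[ℝ] (A → V) :=
  LinearMap.funLeft ℝ V Subtype.val

/-- Restriction of functions given on `A` to `B`. It is used for `B ⊆ A` only. -/
noncomputable def res {A : Set E3} (B : Set E3) : (A → V) →ₗ[ℝ] (B → V) where
  toFun u x := ext0 u x
  map_add' u v := by
    funext x
    by_cases hx : (x : E3) ∈ A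
    · simp [ext0_of_mem _ hx]
    · simp [ext0_of_not_mem _ hx]
  map_smul' c u := by
    funext x
    by_cases hx : (x : E3) ∈ A
    · simp [ext0_of_mem _ hx]
    · simp [ext0_of_not_mem _ hx]

/-- The derivative of a function given on `A`, relative to `A`. For a facet `A` of a tetrahedron
and a differentiable function, its values at directions tangential to `A` are uniquely determined;
it is only evaluated at such directions below. -/
noncomputable def deriv {A : Set E3} (u : A → V) (x : A) : E3 →L[ℝ] V :=
  fderivWithin ℝ (ext0 u) A x

/-- The space `C^∞(A̅)`: restrictions to `A` of functions which are smooth on all of space. -/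
def smooth (V : Type*) [NormedAddCommGroup V] [NormedSpace ℝ V] (A : Set E3) :
    Submodule ℝ (A → V) :=
  Submodule.map (restrict A)
    { carrier := {u : E3 → V | ContDiff ℝ ∞ u}
      add_mem' := fun {u v} (hu : ContDiff ℝ ∞ u) (hv : ContDiff ℝ ∞ v) => hu.add hv
      zero_mem' := (contDiff_const : ContDiff ℝ ∞ fun _ : E3 => (0 : V))
      smul_mem' := fun c u (hu : ContDiff ℝ ∞ u) => hu.const_smul c }

end Functions

/-- The `k`-th Cartesian unit vector. -/
noncomputable def unitVec (k : Fin 3) : E3 := EuclideanSpace.single k 1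

/-- Gradient of a scalar function. -/
noncomputable def grad {A : Set E3} (u : A → ℝ) : A → E3 := fun x =>
  !₂[deriv u x (unitVec 0), deriv u x (unitVec 1), deriv u x (unitVec 2)]

/-- Curl of a vector field. -/
noncomputable def curl {A : Set E3} (u : A → E3) : A → E3 := fun x =>
  !₂[deriv u x (unitVec 1) 2 - deriv u x (unitVec 2) 1,
     deriv u x (unitVec 2) 0 - deriv u x (unitVec 0) 2,
     deriv u x (unitVec 0) 1 - deriv u x (unitVec 1) 0]

/-- Divergence of a vector field. -/
noncomputable def div {A : Set E3} (u : A → E3) : A → ℝ := fun x =>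
  deriv u x (unitVec 0) 0 + deriv u x (unitVec 1) 1 + deriv u x (unitVec 2) 2

/-! ### Polynomials -/

/-- A polynomial as a function on space. -/
noncomputable def evalPoly : MvPolynomial (Fin 3) ℝ →ₗ[ℝ] (E3 → ℝ) :=
  LinearMap.pi fun x => (MvPolynomial.aeval fun k => x k).toLinearMap

/-- Polynomial functions of total degree at most `m` on space; this is `{0}` if `m < 0`. -/
noncomputable def Pol (m : ℤ) : Submodule ℝ (E3 → ℝ) :=
  Submodule.map evalPoly (MvPolynomial.restrictSupport ℝ {d : Fin 3 →₀ ℕ | (d.degree : ℤ) ≤ m})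

/-- The `k`-th component of a vector field. -/
def component (k : Fin 3) : (E3 → E3) →ₗ[ℝ] (E3 → ℝ) where
  toFun u x := u x k
  map_add' _ _ := rfl
  map_smul' _ _ := rfl

/-- Polynomial vector fields of degree at most `m` on space. -/
noncomputable def VPol (m : ℤ) : Submodule ℝ (E3 → E3) :=
  ⨅ k : Fin 3, (Pol m).comap (component k)

/-- The map taking a field `q` to the field `q(x) × x`. -/
noncomputable def crossId : (E3 → E3) →ₗ[ℝ] (E3 → E3) where
  toFun q x := cross (q x) x
  map_add' q r := by funext x; exact cross_add _ _ _
  map_smul' c q := by funext x; exact cross_smul _ _ _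

/-- The map taking a function `q` to the field `q(x) x`. -/
noncomputable def mulId : (E3 → ℝ) →ₗ[ℝ] (E3 → E3) where
  toFun q x := q x • x
  map_add' q r := by funext x; exact add_smul _ _ _
  map_smul' c q := by funext x; exact mul_smul _ _ _

/-- `P_m(F)`: restrictions to `F` of polynomials of degree at most `m`. For a facet `F` these are
the polynomials of degree at most `m` in a local coordinate system of `F`. -/
noncomputable def PolOn (F : Set E3) (m : ℤ) : Submodule ℝ (F → ℝ) :=
  (Pol m).map (restrict F)

/-- Polynomial vector fields of degree at most `m` on `F`, with values in space. -/
noncomputable def VPolOn (F : Set E3) (m : ℤ) : Submodule ℝ (F → E3) :=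
  (VPol m).map (restrict F)

/-! ### Orthogonal projections and Sobolev spaces of negative order -/

open scoped Classical in
/-- The `B`-orthogonal projection of `u` onto the space `X` of functions: the element `w` of `X`
with `B (u - w) v = 0` for all `v` in `X`. -/
noncomputable def orthProj {α V : Type*} [AddCommGroup V]
    (B : (α → V) → (α → V) → ℝ) (X : Set (α → V)) (u : α → V) : α → V :=
  if h : ∃ w ∈ X, ∀ v ∈ X, B (u - w) v = 0 then h.choose else 0

section Sobolev

variable {F : Set E3} {V : Type*} [NormedAddCommGroup V] [InnerProductSpace ℝ V]

/-- The `L²(F)` inner product, `F` a `d`-dimensional set with its `d`-dimensional surface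
measure. -/
noncomputable def innerL2 (d : ℕ) (u v : F → V) : ℝ :=
  ∫ x : F, inner ℝ (u x) (v x) ∂μHE[d]

variable (F V) in
/-- Pairs of `L²` functions on `F` and on `F × F`. A function `φ` in `H^s(F)`, `0 < s < 1`, is
identified with the pair of `φ` and its difference quotient
`(φ(x) - φ(y)) / |x - y| ^ (d / 2 + s)`; the norm of the pair is then the Sobolev–Slobodeckij norm
of `φ`. -/
abbrev PairL2 (d : ℕ) : Type _ :=
  WithLp 2 (Lp V 2 (μHE[d] : Measure F) ×
    Lp V 2 ((μHE[d] : Measure F).prod (μHE[d] : Measure F)))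

/-- Test functions on `F`: smooth functions whose support is contained in the (relative)
interior `U` of `F`. -/
def IsTest (U : Set F) (φ : F → V) : Prop :=
  φ ∈ smooth V F ∧ tsupport φ ⊆ U

/-- `g` is the pair of the function `φ` and its difference quotient of order `s`. -/
def Represents (d : ℕ) (s : ℝ) (φ : F → V) (g : PairL2 F V d) : Prop :=
  (⇑g.fst =ᵐ[(μHE[d] : Measure F)] φ) ∧
  (⇑g.snd =ᵐ[(μHE[d] : Measure F).prod (μHE[d] : Measure F)]
    fun z => (‖(z.1 : E3) - (z.2 : E3)‖ ^ ((d : ℝ) / 2 + s))⁻¹ • (φ z.1 - φ z.2))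

variable (V) in
/-- The Hilbert space `H_0^s(F)`, `0 < s < 1`: the closure of the test functions in the
Sobolev–Slobodeckij norm. Here `U` is the relative interior of `F`. -/
noncomputable def H0 (U : Set F) (d : ℕ) (s : ℝ) : Submodule ℝ (PairL2 F V d) :=
  (Submodule.span ℝ {g | ∃ φ : F → V, IsTest U φ ∧ Represents d s φ g}).topologicalClosure

noncomputable instance (U : Set F) (d : ℕ) (s : ℝ) [CompleteSpace V] :
    CompleteSpace (H0 V U d s) :=
  Submodule.topologicalClosure.completeSpace _

open scoped Classical in
/-- The element `φ ↦ ∫_F u · φ` of the dual space `H^{-s}(F)` of `H_0^s(F)`, for `u` in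
`L²(F)`. -/
noncomputable def toHNeg (U : Set F) (d : ℕ) (s : ℝ) (u : F → V) : StrongDual ℝ (H0 V U d s) :=
  if h : MemLp u 2 (μHE[d] : Measure F) then
    (innerSL ℝ (h.toLp u)).comp
      ((WithLp.fstL 2 ℝ (Lp V 2 (μHE[d] : Measure F))
        (Lp V 2 ((μHE[d] : Measure F).prod (μHE[d] : Measure F)))).comp (H0 V U d s).subtypeL)
  else 0

/-- The inner product of `H^{-s}(F)`, the dual space of `H_0^s(F)` with the dual norm, for
functions in `L²(F)`. -/
noncomputable def innerNeg [CompleteSpace V] (U : Set F) (d : ℕ) (s : ℝ) (u v : F → V) : ℝ :=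
  inner ℝ ((InnerProductSpace.toDual ℝ (H0 V U d s)).symm (toHNeg U d s u))
    ((InnerProductSpace.toDual ℝ (H0 V U d s)).symm (toHNeg U d s v))

end Sobolev

/-! ### The tetrahedron and its facets

A tetrahedron is given by its four vertices, an affine basis of space. The barycentric coordinate
functions are then `T.coord i`. The face with index `i` is the one opposite to the vertex `i`. -/

/-- A (nondegenerate) tetrahedron. -/
abbrev Tet : Type := AffineBasis (Fin 4) ℝ E3

/-- Edges, as pairs of vertices; an edge is directed from its first to its second vertex. -/
abbrev Edge : Type := {e : Fin 4 × Fin 4 // e.1 < e.2}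

/-- The set of the two vertices of an edge. -/
def Edge.verts (e : Edge) : Finset (Fin 4) := {e.1.1, e.1.2}

section Geometry

variable (T : Tet)

/-- The closed facet whose set of vertices is `s`. -/
def facet (s : Finset (Fin 4)) : Set E3 :=
  {x ∈ convexHull ℝ (Set.range T) | ∀ l ∉ s, T.coord l x = 0}

/-- The closed tetrahedron. -/
abbrev body : Set E3 := facet T Finset.univ

/-- The relative interior of a facet, as a subset of the facet. -/
def facetInt (s : Finset (Fin 4)) : Set (facet T s) := {x | ∀ l ∈ s, 0 < T.coord l x.1}

/-- The edge `e`. -/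
abbrev edge (e : Edge) : Set E3 := facet T e.verts

/-- The face opposite to the vertex `i`. -/
abbrev face (i : Fin 4) : Set E3 := facet T {i}ᶜ

/-- Barycentric coordinate function on the tetrahedron. -/
noncomputable def bary (i : Fin 4) : body T → ℝ := fun x => T.coord i x.1

/-- The (constant) gradient of a barycentric coordinate function. -/
noncomputable def gradBary (i : Fin 4) : E3 := gradient (fun x => T.coord i x) 0

/-- The exterior unit normal vector of the face `i`. -/
noncomputable def normal (i : Fin 4) : E3 := -(‖gradBary T i‖⁻¹ • gradBary T i)

/-- Within the plane of the face `i`, the unit normal vector, exterior to the face, of that edge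
of the face which is opposite to the vertex `l ≠ i`. -/
noncomputable def inplaneNormal (i l : Fin 4) : E3 :=
  let g := gradBary T l - inner ℝ (gradBary T l) (normal T i) • normal T i
  (-‖g‖⁻¹) • g

/-- The unit tangent vector of an edge. -/
noncomputable def tangent (e : Edge) : E3 := ‖T e.1.2 - T e.1.1‖⁻¹ • (T e.1.2 - T e.1.1)

/-- The first vector of an orthonormal frame of the plane of the face `i`. -/
noncomputable def frame₁ (i : Fin 4) : E3 :=
  ‖T (i.succAbove 1) - T (i.succAbove 0)‖⁻¹ • (T (i.succAbove 1) - T (i.succAbove 0))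

/-- The second vector of the orthonormal frame of the plane of the face `i`; its cross product
with the first one, `frame₁ × frame₂`, is the exterior normal vector. -/
noncomputable def frame₂ (i : Fin 4) : E3 := cross (normal T i) (frame₁ T i)

/-! ### Traces and differential operators on facets -/

/-- The tangential trace `(u · t)|_e` on an edge. -/
noncomputable def traceEdge (e : Edge) : (body T → E3) →ₗ[ℝ] (edge T e → ℝ) where
  toFun u x := inner ℝ (res (edge T e) u x) (tangent T e)
  map_add' u v := by funext x; simp [inner_add_left]
  map_smul' c u := by funext x; simp [inner_smul_left]

/-- The tangential trace `(u × n)|_f` on a face. -/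
noncomputable def traceTan (i : Fin 4) : (body T → E3) →ₗ[ℝ] (face T i → E3) where
  toFun u x := cross (res (face T i) u x) (normal T i)
  map_add' u v := by funext x; simp [cross_add]
  map_smul' c u := by funext x; simp [cross_smul]

/-- The normal trace `(u · n)|_f` on a face. -/
noncomputable def traceNor (i : Fin 4) : (body T → E3) →ₗ[ℝ] (face T i → ℝ) where
  toFun u x := inner ℝ (res (face T i) u x) (normal T i)
  map_add' u v := by funext x; simp [inner_add_left]
  map_smul' c u := by funext x; simp [inner_smul_left]

/-- The surface rotation on the face `i`: surface gradient `× n`. -/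
noncomputable def bcurl (i : Fin 4) (q : face T i → ℝ) : face T i → E3 := fun x =>
  cross (deriv q x (frame₁ T i) • frame₁ T i + deriv q x (frame₂ T i) • frame₂ T i) (normal T i)

/-- The surface divergence on the face `i`. -/
noncomputable def bdiv (i : Fin 4) (v : face T i → E3) : face T i → ℝ := fun x =>
  inner ℝ (deriv v x (frame₁ T i)) (frame₁ T i) + inner ℝ (deriv v x (frame₂ T i)) (frame₂ T i)

/-! ### Local polynomial spaces -/

variable (p : ℕ)

/-- The local edge element space `W^1_p(T)`: fields `P(x) + Q(x) × x` with `P`, `Q` of degree at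
most `p`. -/
noncomputable def W1 : Submodule ℝ (body T → E3) :=
  (VPol p ⊔ (VPol p).map crossId).map (restrict (body T))

/-- The local face element space `W^2_p(T)`: fields `P(x) + q(x) x` with `P`, `q` of degree at
most `p`. -/
noncomputable def W2 : Submodule ℝ (body T → E3) :=
  (VPol p ⊔ (Pol p).map mulId).map (restrict (body T))

/-- Polynomials of degree at most `m` on the facet with vertex set `s` that vanish on the
relative boundary of the facet. -/
noncomputable def Pol0 (s : Finset (Fin 4)) (m : ℤ) : Submodule ℝ (facet T s → ℝ) where
  carrier := {q | q ∈ PolOn (facet T s) m ∧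
    ∀ x : facet T s, (∃ l ∈ s, T.coord l x.1 = 0) → q x = 0}
  add_mem' := fun ha hb => ⟨add_mem ha.1 hb.1, fun x hx => by simp [ha.2 x hx, hb.2 x hx]⟩
  zero_mem' := ⟨zero_mem _, fun _ _ => rfl⟩
  smul_mem' := fun c _ ha => ⟨Submodule.smul_mem _ c ha.1, fun x hx => by simp [ha.2 x hx]⟩

/-- Functions in `W^1_p(e) = P_p(e)` with vanishing integral. -/
def W1Z_edge (e : Edge) : Set (edge T e → ℝ) :=
  {u | u ∈ (W1 T p).map (traceEdge T e) ∧ ∫ x, u x ∂μHE[1] = 0}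

/-- Fields in `W^1_p(f) = W^1_p(T) × n_f` whose in-plane normal component vanishes on each edge
of the face. -/
def W1Z_face (i : Fin 4) : Set (face T i → E3) :=
  {u | u ∈ (W1 T p).map (traceTan T i) ∧
    ∀ l, l ≠ i → ∀ x : face T i, T.coord l x.1 = 0 → inner ℝ (u x) (inplaneNormal T i l) = 0}

/-- Fields in `W^1_p(T)` with vanishing tangential trace on the boundary. -/
def W1Z : Set (body T → E3) := {u | u ∈ W1 T p ∧ ∀ i, traceTan T i u = 0}

/-- Functions in `W^2_p(f) = W^2_p(T) · n_f` with vanishing integral. -/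
def W2Z_face (i : Fin 4) : Set (face T i → ℝ) :=
  {u | u ∈ (W2 T p).map (traceNor T i) ∧ ∫ x, u x ∂μHE[2] = 0}

/-- Fields in `W^2_p(T)` with vanishing normal trace on the boundary. -/
def W2Z : Set (body T → E3) := {u | u ∈ W2 T p ∧ ∀ i, traceNor T i u = 0}

/-- The fields in `W^1_p(T)` on which all local degrees of freedom vanish except for those
associated with the face `i`: the tangential moments of order at most `p` on the edges, the moments
of the tangential traces of order at most `p - 1` on the faces other than `i`, and the moments of
order at most `p - 2` on the tetrahedron. -/
def Y1_face (i : Fin 4) : Set (body T → E3) :=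
  {v | v ∈ W1 T p ∧
    (∀ e : Edge, ∀ q ∈ PolOn (edge T e) p, ∫ x, q x * traceEdge T e v x ∂μHE[1] = 0) ∧
    (∀ j, j ≠ i → ∀ q ∈ VPolOn (face T j) ((p : ℤ) - 1),
      (∀ x, inner ℝ (q x) (normal T j) = 0) →
      ∫ x, inner ℝ (q x) (traceTan T j v x) ∂μHE[2] = 0) ∧
    (∀ q ∈ VPolOn (body T) ((p : ℤ) - 2), ∫ x, inner ℝ (q x) (v x) ∂μHE[3] = 0)}

/-! ### Projections -/

variable (ε : ℝ)

/-- `P^1_{e,p}`: the `H^{-1+ε}(e)`-orthogonal projection onto the functions in `W^1_p(e)` with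
vanishing integral. -/
noncomputable def P1_edge (e : Edge) : (edge T e → ℝ) → (edge T e → ℝ) :=
  orthProj (innerNeg (facetInt T e.verts) 1 (1 - ε)) (W1Z_edge T p e)

/-- `P^1_{f,p}`: the `H^{-1/2+ε}(f)`-orthogonal projection onto the divergence free fields in
`W1Z_face`. -/
noncomputable def P1_face (i : Fin 4) : (face T i → E3) → (face T i → E3) :=
  orthProj (innerNeg (facetInt T {i}ᶜ) 2 (1 / 2 - ε)) {v | v ∈ W1Z_face T p i ∧ bdiv T i v = 0}

/-- `P^2_{f,p}`: the `H^{-1/2+ε}(f)`-orthogonal projection onto `W2Z_face`. -/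
noncomputable def P2_face (i : Fin 4) : (face T i → ℝ) → (face T i → ℝ) :=
  orthProj (innerNeg (facetInt T {i}ᶜ) 2 (1 / 2 - ε)) (W2Z_face T p i)

/-- `P^1_{T,p}`: the `L²(T)`-orthogonal projection onto the curl free fields in `W1Z`. -/
noncomputable def P1_T : (body T → E3) → (body T → E3) :=
  orthProj (innerL2 3) {v | v ∈ W1Z T p ∧ curl v = 0}

/-- `P^2_{T,p}`: the `L²(T)`-orthogonal projection onto the divergence free fields in `W2Z`. -/
noncomputable def P2_T : (body T → E3) → (body T → E3) :=
  orthProj (innerL2 3) {v | v ∈ W2Z T p ∧ div v = 0}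

/-- `P^3_{T,p}`: the `L²(T)`-orthogonal projection onto the polynomials of degree at most `p` with
vanishing integral. -/
noncomputable def P3_T : (body T → ℝ) → (body T → ℝ) :=
  orthProj (innerL2 3) {v | v ∈ PolOn (body T) p ∧ ∫ x, v x ∂μHE[3] = 0}

/-! ### Extensions and liftings -/

/-- Polynomial extension operators from edges and faces to the tetrahedron. The operators are only
applied to, and only constrained on, the spaces `Pol0` and `W1Z_face`; their values on other
functions play no role. -/
structure Extensions where
  /-- the extensions `E^0_{e,p}` from edges -/
  E0_edge : ∀ e : Edge, (edge T e → ℝ) →ₗ[ℝ] (body T → ℝ)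
  /-- the extensions `E^0_{f,p}` from faces -/
  E0_face : ∀ i : Fin 4, (face T i → ℝ) →ₗ[ℝ] (body T → ℝ)
  /-- the extensions `E^1_{f,p}` from faces -/
  E1_face : ∀ i : Fin 4, (face T i → E3) →ₗ[ℝ] (body T → E3)
  E0_edge_mem : ∀ e : Edge, ∀ q ∈ Pol0 T e.verts ((p : ℤ) + 1), E0_edge e q ∈ PolOn (body T) ((p : ℤ) + 1)
  E0_edge_res : ∀ e : Edge, ∀ q ∈ Pol0 T e.verts ((p : ℤ) + 1), res (edge T e) (E0_edge e q) = q
  E0_edge_zero : ∀ e : Edge, ∀ q ∈ Pol0 T e.verts ((p : ℤ) + 1), ∀ e', e' ≠ e →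
    res (edge T e') (E0_edge e q) = 0
  E0_face_mem : ∀ i : Fin 4, ∀ q ∈ Pol0 T {i}ᶜ ((p : ℤ) + 1), E0_face i q ∈ PolOn (body T) ((p : ℤ) + 1)
  E0_face_res : ∀ i : Fin 4, ∀ q ∈ Pol0 T {i}ᶜ ((p : ℤ) + 1), res (face T i) (E0_face i q) = q
  E0_face_zero : ∀ i : Fin 4, ∀ q ∈ Pol0 T {i}ᶜ ((p : ℤ) + 1), ∀ j, j ≠ i →
    res (face T j) (E0_face i q) = 0
  E1_face_mem : ∀ i : Fin 4, ∀ w ∈ W1Z_face T p i, E1_face i w ∈ Y1_face T p i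
  E1_face_trace : ∀ i : Fin 4, ∀ w ∈ W1Z_face T p i, traceTan T i (E1_face i w) = w

open scoped Classical in
/-- `L^1_{e,p}`: the polynomial of degree at most `p + 1` vanishing at the endpoints of the edge
whose derivative in the direction of the unit tangent vector `τ` is `u`. -/
noncomputable def L1_edge (e : Edge) (τ : E3) (u : edge T e → ℝ) : edge T e → ℝ :=
  if h : ∃ q ∈ Pol0 T e.verts ((p : ℤ) + 1), ∀ x, deriv q x τ = u x then h.choose else 0

open scoped Classical in
/-- `L^1_{f,p}`: the polynomial of degree at most `p + 1` vanishing on the boundary of the face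
whose surface rotation is `u`. -/
noncomputable def L1_face (i : Fin 4) (u : face T i → E3) : face T i → ℝ :=
  if h : ∃ q ∈ Pol0 T {i}ᶜ ((p : ℤ) + 1), bcurl T i q = u then h.choose else 0

open scoped Classical in
/-- `L^1_{T,p}`: the polynomial of degree at most `p + 1` vanishing on the boundary of the
tetrahedron whose gradient is `u`. -/
noncomputable def L1_T (u : body T → E3) : body T → ℝ :=
  if h : ∃ q ∈ Pol0 T Finset.univ ((p : ℤ) + 1), grad q = u then h.choose else 0

/-- The Poincaré lifting `R_a`. -/
noncomputable def R (a : E3) (u : body T → E3) : body T → E3 := fun x =>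
  cross (∫ t in (0 : ℝ)..1, t • ext0 u (a + t • (x.1 - a))) (x.1 - a)

/-- The Poincaré lifting `R_a^{2D}` on the face `i`. -/
noncomputable def R2D (i : Fin 4) (a : E3) (u : face T i → ℝ) : face T i → E3 := fun x =>
  (∫ t in (0 : ℝ)..1, t * ext0 u (a + t • (x.1 - a))) • (x.1 - a)

/-- The Poincaré lifting `D_a`. -/
noncomputable def D (a : E3) (u : body T → ℝ) : body T → E3 := fun x =>
  (∫ t in (0 : ℝ)..1, t ^ 2 * ext0 u (a + t • (x.1 - a))) • (x.1 - a)

/-- The base points used by the liftings: for each face `i` a vertex `apexF i` of that face and the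
edge `baseE i` of the face opposite to this vertex; and vertices of the tetrahedron. -/
structure BasePoints where
  apexF : Fin 4 → Fin 4
  baseE : Fin 4 → Edge
  apexF_ne : ∀ i, apexF i ≠ i
  baseE_eq : ∀ i, (baseE i).verts = {i, apexF i}ᶜ
  /-- the vertex used by `L^2_{T,p}` -/
  apex2 : Fin 4
  /-- the vertex used by `L^3_{T,p}` -/
  apex3 : Fin 4

variable (E : Extensions T p) (b : BasePoints)

/-- `L^2_{f,p}`. The edge opposite to the base point carries the direction `n_f × n_{e,f}`. -/
noncomputable def L2_face (i : Fin 4) (u : face T i → ℝ) : face T i → E3 :=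
  let w := R2D T i (T (b.apexF i)) u
  let n := inplaneNormal T i (b.apexF i)
  let g : edge T (b.baseE i) → ℝ := fun x => inner ℝ (res (edge T (b.baseE i)) w x) n
  w - bcurl T i (res (face T i)
    (E.E0_edge (b.baseE i) (L1_edge T p (b.baseE i) (cross (normal T i) n) g)))

/-- `L^2_{T,p}`. -/
noncomputable def L2_T (u : body T → E3) : body T → E3 :=
  R T (T b.apex2) u -
    grad (E.E0_face b.apex2 (L1_face T p b.apex2 (traceTan T b.apex2 (R T (T b.apex2) u))))

/-- `L^3_{T,p}`. -/
noncomputable def L3_T (u : body T → ℝ) : body T → E3 :=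
  D T (T b.apex3) u -
    curl (E.E1_face b.apex3
      (L2_face T p E b b.apex3 (traceNor T b.apex3 (D T (T b.apex3) u))))

/-! ### The interpolation operators -/

/-- The Whitney 1-form basis function of an edge. -/
noncomputable def whitney1 (e : Edge) : body T → E3 := fun x =>
  bary T e.1.1 x • gradBary T e.1.2 - bary T e.1.2 x • gradBary T e.1.1

/-- The Whitney 2-form basis function of the face `i`, oriented by the exterior normal vector
and normalized to unit flux. -/
noncomputable def whitney2 (i : Fin 4) : body T → E3 := fun x =>
  let j := i.succAbove 0
  let k := i.succAbove 1
  let l := i.succAbove 2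
  (2 * Real.sign (inner ℝ (cross (T k - T j) (T l - T j)) (normal T i))) •
    (bary T j x • cross (gradBary T k) (gradBary T l) +
      bary T k x • cross (gradBary T l) (gradBary T j) +
      bary T l x • cross (gradBary T j) (gradBary T k))

/-- The projection based interpolation operator `Π^1_{T,p}` onto `W^1_p(T)`. -/
noncomputable def Pi1 (u : body T → E3) : body T → E3 :=
  let w0 : body T → E3 := ∑ e : Edge, (∫ x, traceEdge T e u x ∂μHE[1]) • whitney1 T e
  let u0 := u - w0
  let w1 : body T → E3 := ∑ e : Edge,
    grad (E.E0_edge e (L1_edge T p e (tangent T e) (P1_edge T p ε e (traceEdge T e u0))))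
  let u1 := u0 - w1
  let w2 : body T → E3 := ∑ i : Fin 4,
    E.E1_face i (L2_face T p E b i (P2_face T p ε i (bdiv T i (traceTan T i u1))))
  let u2 := u1 - w2
  let w3 : body T → E3 := ∑ i : Fin 4,
    grad (E.E0_face i (L1_face T p i (P1_face T p ε i (traceTan T i u2))))
  let u3 := u2 - w3
  let w4 : body T → E3 := L2_T T p E b (P2_T T p (curl u3))
  let u4 := u3 - w4
  grad (L1_T T p (P1_T T p u4)) + w4 + w3 + w2 + w1 + w0

/-- The projection based interpolation operator `Π^2_{T,p}` onto `W^2_p(T)`. -/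
noncomputable def Pi2 (u : body T → E3) : body T → E3 :=
  let w0 : body T → E3 := ∑ i : Fin 4, (∫ x, traceNor T i u x ∂μHE[2]) • whitney2 T i
  let u0 := u - w0
  let w1 : body T → E3 := ∑ i : Fin 4,
    curl (E.E1_face i (L2_face T p E b i (P2_face T p ε i (traceNor T i u0))))
  let u1 := u0 - w1
  let w2 : body T → E3 := L3_T T p E b (P3_T T p (div u1))
  let u2 := u1 - w2
  curl (L2_T T p E b (P2_T T p u2)) + w0 + w1 + w2

end Geometry

end PBI

open MeasureTheory
open scoped ContDiff

namespace PBI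

/-! ### Polynomial functions -/

/-! Each stage of `Pi2` corrects one kind of data (fluxes, normal traces, divergence, the
divergence-free rest) by a lifting that leaves the data already treated alone. Three facts about the
liftings carry the theorem.

First, the field curl E^1_f L^2_f u, called `faceField`, is divergence free, lies in W^2_p(T), has
normal trace u on f and normal trace 0 on the other faces. On f this follows from n · curl v = div_f
(v × n) (`bdiv_traceTan`) and from the fact that L^2_f is a right inverse of the surface divergence
(`bdiv_L2_face`). The extension E^1_f may be applied because L^2_f u has no in-plane normal
component on ∂f (`L2_face_mem`); the correction on the base edge that achieves this exists because,
by the divergence theorem on f, the Poincaré lifting has mean-zero normal component there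
(`mean_radial_eq_zero`). On the other faces it is a unisolvence statement: the vanishing degrees of
freedom force the tangential trace to vanish (`traceTan_eq_zero`).

Second, L^3_T u has divergence u and no normal trace (`div_L3_T`, `traceNor_L3_T`). The normal trace
of the radial field D u lives on the face opposite to the base point and has mean zero there by the
divergence theorem, so a `faceField` removes it.

Third, curl L^2_T is the identity on divergence-free fields of W^2_p(T) (`curl_L2_T`), since the
gradient in L^2_T is invisible to the curl.

For u in W^2_p(T), each projection then acts on an element of its own target space, the remainder
after the stages lies in the range of `P2_T`, and the sum telescopes (`Pi2_self`). Linearity needs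
the orthogonal projections to be well defined, that is, the inner products to be definite on the
target spaces. For the negative-order product on a face this is `riesz_face_injective`: for s < 1/2
the difference quotients of smooth functions are square integrable, so every test function belongs
to H_0^s and detects the polynomial.

For the commuting property, the curl annihilates the stages of `Pi1` that are gradients. Stokes'
theorem on the faces turns edge circulations into fluxes (`whitney_commute`), `bdiv_traceTan`
identifies the data of the two face stages, the divergence stage vanishes because div curl = 0, and
the last stages agree by `curl_L2_T` (`Pi2_curl`).

Technically, every function in play is the restriction of a smooth function on space, and
derivatives along a facet are read off from that extension (`deriv_facet`). Integral theorems are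
stated for mean values over facets and reduce to the fundamental theorem of calculus on the
reference simplex (`mean_fderiv`). -/

theorem evalPoly_apply (P : MvPolynomial (Fin 3) ℝ) (x : E3) :
    evalPoly P x = MvPolynomial.aeval (fun k => x k) P := rfl

theorem mem_Pol {m : ℤ} {f : E3 → ℝ} :
    f ∈ Pol m ↔ ∃ P ∈ MvPolynomial.restrictSupport ℝ {d : Fin 3 →₀ ℕ | (d.degree : ℤ) ≤ m},
      evalPoly P = f := Submodule.mem_map

theorem Pol_mono {m n : ℤ} (h : m ≤ n) : Pol m ≤ Pol n :=
  Submodule.map_mono (MvPolynomial.restrictSupport_mono _ fun _ hd => le_trans hd h)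

theorem Pol_eq_bot {m : ℤ} (h : m < 0) : Pol m = ⊥ := by
  have : {d : Fin 3 →₀ ℕ | (d.degree : ℤ) ≤ m} = ∅ := by
    ext d
    simp only [Set.mem_ofPred_eq, Set.mem_empty_iff_false, iff_false, not_le]
    exact lt_of_lt_of_le h (Int.natCast_nonneg _)
  rw [Pol, this, MvPolynomial.restrictSupport_eq_span]
  simp

theorem Pol_mul {m n : ℤ} {f g : E3 → ℝ} (hf : f ∈ Pol m) (hg : g ∈ Pol n) :
    f * g ∈ Pol (m + n) := by
  obtain ⟨P, hP, rfl⟩ := mem_Pol.1 hf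
  obtain ⟨Q, hQ, rfl⟩ := mem_Pol.1 hg
  refine mem_Pol.2 ⟨P * Q, ?_, ?_⟩
  · have h := Submodule.mul_mem_mul hP hQ
    rw [← MvPolynomial.restrictSupport_add] at h
    refine MvPolynomial.restrictSupport_mono _ ?_ h
    rintro _ ⟨d, hd, e, he, rfl⟩
    simp only [Set.mem_ofPred_eq, map_add, Nat.cast_add] at *
    omega
  · funext x
    simp [evalPoly_apply]

theorem Pol_const (c : ℝ) : (fun _ => c) ∈ Pol 0 := by
  refine mem_Pol.2 ⟨MvPolynomial.monomial 0 c, ?_, ?_⟩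
  · rw [MvPolynomial.monomial_mem_restrictSupport]; simp
  · funext x; simp [evalPoly_apply]

theorem Pol_coord (k : Fin 3) : (fun x => x k) ∈ Pol 1 := by
  refine mem_Pol.2 ⟨MvPolynomial.X k, ?_, ?_⟩
  · rw [MvPolynomial.X, MvPolynomial.monomial_mem_restrictSupport]; simp
  · funext x; simp [evalPoly_apply]

/-- A monomial arises from the constant 1 by multiplying by one coordinate at a time, so products of
general polynomials never have to be treated. The index is only an upper bound for the degree, hence
the weakening hypothesis `hsucc`. -/
theorem Pol_induction {C : ℕ → (E3 → ℝ) → Prop} (hconst : C 0 fun _ => 1)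
    (hadd : ∀ n f g, C n f → C n g → C n (f + g)) (hsmul : ∀ n (c : ℝ) f, C n f → C n (c • f))
    (hsucc : ∀ n f, C n f → C (n + 1) f)
    (hmul : ∀ (n : ℕ) (k : Fin 3) f, f ∈ Pol n → C n f → C (n + 1) ((fun x => x k) * f)) (n : ℕ) (f : E3 → ℝ)
    (hf : f ∈ Pol n) : C n f := by
  have hle : ∀ n m f, n ≤ m → C n f → C m f := by
    intro n m f h hf
    induction h with
    | refl => exact hf
    | step _ ih => exact hsucc _ _ ih
  -- Membership in `Pol` is carried along because `hmul` asks for it at every multiplication.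
  have hpow : ∀ (k : Fin 3) (a n : ℕ) f, f ∈ Pol n → C n f →
      ((fun x => x k) ^ a * f) ∈ Pol ((n + a : ℕ) : ℤ) ∧ C (n + a) ((fun x => x k) ^ a * f) := by
    intro k a n f h1 h2
    induction a with
    | zero => simpa using ⟨h1, h2⟩
    | succ a ih =>
      rw [pow_succ', mul_assoc]
      refine ⟨?_, hmul _ _ _ ih.1 ih.2⟩
      have := Pol_mul (Pol_coord k) ih.1
      rwa [show (1 : ℤ) + ((n + a : ℕ) : ℤ) = ((n + (a + 1) : ℕ) : ℤ) by push_cast; ring] at this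
  obtain ⟨P, hP, rfl⟩ := mem_Pol.1 hf
  rw [MvPolynomial.restrictSupport_eq_span] at hP
  induction hP using Submodule.span_induction with
  | mem P hP =>
    obtain ⟨d, hd, rfl⟩ := hP
    have e : evalPoly (MvPolynomial.monomial d (1 : ℝ)) =
        (fun x => x 0) ^ d 0 * ((fun x => x 1) ^ d 1 * ((fun x => x 2) ^ d 2 * fun _ => 1)) := by
      funext x
      rw [evalPoly_apply, MvPolynomial.aeval_monomial, Finsupp.prod_fintype _ _ (by simp),
        Fin.prod_univ_three]
      simp [mul_assoc]
    show C n (evalPoly (MvPolynomial.monomial d (1 : ℝ)))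
    rw [e]
    have h2 := hpow 2 (d 2) 0 _ (Pol_const 1) hconst
    have h1 := hpow 1 (d 1) _ _ h2.1 h2.2
    have h0 := hpow 0 (d 0) _ _ h1.1 h1.2
    refine hle _ _ _ ?_ h0.2
    have hd' : ((d.degree : ℕ) : ℤ) ≤ n := hd
    rw [Finsupp.degree_eq_sum, Fin.sum_univ_three] at hd'
    omega
  | zero =>
    rw [map_zero]
    have := hle 0 n _ (Nat.zero_le _) (hsmul _ 0 _ hconst)
    rwa [zero_smul] at this
  | add P Q hP hQ h1 h2 =>
    rw [map_add]
    refine hadd _ _ _ (h1 (mem_Pol.2 ⟨P, ?_, rfl⟩)) (h2 (mem_Pol.2 ⟨Q, ?_, rfl⟩)) <;>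
    rw [MvPolynomial.restrictSupport_eq_span] <;> assumption
  | smul c P hP h =>
    rw [map_smul]
    refine hsmul _ _ _ (h (mem_Pol.2 ⟨P, ?_, rfl⟩))
    rw [MvPolynomial.restrictSupport_eq_span]; assumption

/-- To show a property of polynomial functions of degree `m`, it suffices to do so for `m ≥ 0`,
if it holds for the zero function. -/
theorem Pol_cases {C : ℤ → (E3 → ℝ) → Prop} (h0 : ∀ m, C m 0)
    (hn : ∀ (n : ℕ) f, f ∈ Pol n → C n f) {m : ℤ} {f : E3 → ℝ} (hf : f ∈ Pol m) : C m f := by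
  rcases lt_or_ge m 0 with h | h
  · rw [Pol_eq_bot h, Submodule.mem_bot] at hf
    rw [hf]; exact h0 m
  · obtain ⟨n, rfl⟩ := Int.eq_ofNat_of_zero_le h
    exact hn n f hf

theorem Pol_contDiff {m : ℤ} {f : E3 → ℝ} (hf : f ∈ Pol m) : ContDiff ℝ ∞ f := by
  refine Pol_cases (C := fun _ f => ContDiff ℝ ∞ f) (fun _ => contDiff_const) (fun n f hf => ?_) hf
  refine Pol_induction (C := fun _ f => ContDiff ℝ ∞ f) contDiff_const
    (fun _ _ _ h1 h2 => h1.add h2) (fun _ c _ h => contDiff_const.smul h)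
    (fun _ _ h => h) (fun _ k f _ h => ?_) n f hf
  exact ContDiff.mul (by fun_prop) h

theorem Pol_comp {m : ℤ} {f : E3 → ℝ} (hf : f ∈ Pol m) {A : E3 → E3}
    (hA : ∀ k, (fun x => A x k) ∈ Pol 1) : (fun x => f (A x)) ∈ Pol m := by
  refine Pol_cases (C := fun m f => (fun x => f (A x)) ∈ Pol m) (fun m => zero_mem _)
    (fun n f hf => ?_) hf
  refine Pol_induction (C := fun m f => (fun x => f (A x)) ∈ Pol m) (Pol_const 1)
    (fun _ _ _ h1 h2 => add_mem h1 h2) (fun _ c _ h => Submodule.smul_mem _ c h)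
    (fun _ _ h => Pol_mono (by simp) h) (fun n k f _ h => ?_) n f hf
  have := Pol_mul (hA k) h
  rw [add_comm] at this
  exact_mod_cast this

theorem Pol_fderiv {m : ℤ} {f : E3 → ℝ} (hf : f ∈ Pol m) (w : E3) :
    (fun x => fderiv ℝ f x w) ∈ Pol (m - 1) := by
  refine Pol_cases (C := fun m f => (fun x => fderiv ℝ f x w) ∈ Pol (m - 1))
    (fun m => ?_) (fun n f hf => ?_) hf
  · convert zero_mem (Pol (m - 1)) using 1
    funext x
    simp
  -- Smoothness is part of the induction because the sum and product rules need it. In degree 0 the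
  -- claim is membership in `Pol (-1)`, the zero space.
  have key : ContDiff ℝ ∞ f ∧ (fun x => fderiv ℝ f x w) ∈ Pol ((n : ℤ) - 1) := by
    refine Pol_induction (C := fun m f => ContDiff ℝ ∞ f ∧ (fun x => fderiv ℝ f x w) ∈ Pol (m - 1))
      ⟨contDiff_const, ?_⟩ ?_ ?_ ?_ ?_ n f hf
    · convert zero_mem (Pol _) using 1
      funext x
      simp
    · rintro n f g ⟨h1, h2⟩ ⟨h3, h4⟩
      refine ⟨h1.add h3, ?_⟩
      convert add_mem h2 h4 using 1
      funext x
      rw [fderiv_add (h1.differentiable (by simp) x) (h3.differentiable (by simp) x)]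
      rfl
    · rintro n c f ⟨h1, h2⟩
      refine ⟨contDiff_const.smul h1, ?_⟩
      convert Submodule.smul_mem _ c h2 using 1
      funext x
      rw [fderiv_const_smul (h1.differentiable (by simp) x)]
      rfl
    · rintro n f ⟨h1, h2⟩
      exact ⟨h1, Pol_mono (by simp) h2⟩
    · rintro n k f hf ⟨h1, h2⟩
      have hk : ContDiff ℝ ∞ (fun x : E3 => x k) := by fun_prop
      refine ⟨hk.mul h1, ?_⟩
      have hD : ∀ x, fderiv ℝ (fun x : E3 => x k) x w = w k := by
        intro x
        have : (fun x : E3 => x k) = (EuclideanSpace.proj k : E3 →L[ℝ] ℝ) := rfl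
        rw [this, ContinuousLinearMap.fderiv]
        rfl
      have e : (fun x => fderiv ℝ ((fun x : E3 => x k) * f) x w) =
          (fun x => x k) * (fun x => fderiv ℝ f x w) + w k • f := by
        funext x
        rw [fderiv_mul (hk.differentiable (by simp) x) (h1.differentiable (by simp) x)]
        simp only [add_apply, smul_apply, smul_eq_mul, Pi.add_apply,
          Pi.mul_apply, Pi.smul_apply, hD]
        ring
      rw [e]
      refine add_mem ?_ (Submodule.smul_mem _ _ ?_)
      · refine Pol_mono ?_ (Pol_mul (Pol_coord k) h2)
        omega
      · refine Pol_mono ?_ hf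
        omega
  exact key.2

theorem Pol_affine (c : ℝ) (L : E3 →ₗ[ℝ] ℝ) : (fun x => c + L x) ∈ Pol 1 := by
  have e : (fun x => c + L x) = (fun _ => c) + ∑ k : Fin 3, L (unitVec k) • fun x : E3 => x k := by
    funext x
    have hx : x = ∑ k : Fin 3, x k • unitVec k := by
      ext j
      fin_cases j <;> simp [unitVec, Fin.sum_univ_three]
    conv_lhs => rw [hx, map_sum]
    simp [mul_comm]
  rw [e]
  exact add_mem (Pol_mono (by simp) (Pol_const c))
    (sum_mem fun k _ => Submodule.smul_mem _ _ (Pol_coord k))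

instance Pol_finiteDimensional (m : ℤ) : FiniteDimensional ℝ (Pol m) := by
  have hf : {d : Fin 3 →₀ ℕ | (d.degree : ℤ) ≤ m}.Finite := by
    refine (Finsupp.finite_of_degree_le (σ := Fin 3) m.toNat).subset fun d hd => ?_
    simp only [Set.mem_ofPred_eq] at hd ⊢
    omega
  have : Finite {d : Fin 3 →₀ ℕ | (d.degree : ℤ) ≤ m} := hf
  have := Module.Finite.of_basis (MvPolynomial.basisRestrictSupport ℝ
    {d : Fin 3 →₀ ℕ | (d.degree : ℤ) ≤ m})
  exact inferInstanceAs (FiniteDimensional ℝ (Submodule.map evalPoly _))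

/-- Integrals of families of elements of a finite dimensional space of functions belong to this
space. -/
theorem integral_mem_of_finiteDimensional {α : Type*} (X : Submodule ℝ (α → ℝ))
    [FiniteDimensional ℝ X] (G : ℝ → α → ℝ) (hG : ∀ s, G s ∈ X)
    (hc : ∀ x, Continuous fun s => G s x) (a b : ℝ) : (fun x => ∫ s in a..b, G s x) ∈ X := by
  let B := Module.finBasis ℝ X
  let G' : ℝ → X := fun s => ⟨G s, hG s⟩
  -- Pointwise continuity in `s` is continuity into the product topology, and on a
  -- finite-dimensional subspace every coordinate functional is continuous.
  have hG' : Continuous G' := Continuous.subtype_mk (continuous_pi hc) _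
  have hcoef : ∀ i, Continuous fun s => B.repr (G' s) i := fun i =>
    (LinearMap.continuous_of_finiteDimensional (B.coord i)).comp hG'
  have e : (fun x => ∫ s in a..b, G s x) =
      ∑ i, (∫ s in a..b, B.repr (G' s) i) • ((B i : X) : α → ℝ) := by
    funext x
    have : ∀ s, G s x = ∑ i, B.repr (G' s) i * ((B i : X) : α → ℝ) x := by
      intro s
      have h := congrArg (fun y : X => (y : α → ℝ) x) (B.sum_repr (G' s))
      simp only [AddSubmonoidClass.coe_finsetSum, Submodule.coe_smul, Finset.sum_apply,
        Pi.smul_apply, smul_eq_mul] at h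
      exact h.symm
    simp_rw [this]
    have hint : ∀ i ∈ Finset.univ, IntervalIntegrable
        (fun s => B.repr (G' s) i * ((B i : X) : α → ℝ) x) volume a b :=
      fun i _ => ((hcoef i).mul continuous_const).intervalIntegrable _ _
    rw [intervalIntegral.integral_finsetSum hint]
    simp [intervalIntegral.integral_mul_const]
  rw [e]
  exact sum_mem fun i _ => Submodule.smul_mem _ _ (B i).2

/-! ### Vector algebra -/

theorem cross_add_right (v w w' : E3) : cross v (w + w') = cross v w + cross v w' := by
  ext k; fin_cases k <;> simp [cross] <;> ring

theorem cross_smul_right (c : ℝ) (v w : E3) : cross v (c • w) = c • cross v w := by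
  ext k; fin_cases k <;> simp [cross] <;> ring

theorem cross_anticomm (v w : E3) : cross v w = -cross w v := by
  ext k; fin_cases k <;> simp [cross] <;> ring

@[simp] theorem cross_self (v : E3) : cross v v = 0 := by
  ext k; fin_cases k <;> simp [cross] <;> ring

/-- The cross product as a bilinear map. -/
noncomputable def crossL : E3 →L[ℝ] E3 →L[ℝ] E3 :=
  (LinearMap.mk₂ ℝ cross cross_add cross_smul cross_add_right
    cross_smul_right).toContinuousBilinearMap

theorem crossL_apply (v w : E3) : crossL v w = cross v w := rfl

@[simp] theorem cross_zero_left (v : E3) : cross 0 v = 0 := by simp [← crossL_apply]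

theorem cross_neg_right (v w : E3) : cross v (-w) = -cross v w := by simp [← crossL_apply]

theorem cross_neg_left (v w : E3) : cross (-v) w = -cross v w := by simp [← crossL_apply]

theorem cross_sub_right (v w w' : E3) : cross v (w - w') = cross v w - cross v w' := by
  simp [← crossL_apply]

theorem inner_E3 (v w : E3) : inner ℝ v w = v 0 * w 0 + v 1 * w 1 + v 2 * w 2 := by
  simp [PiLp.inner_apply, Fin.sum_univ_three]; ring

theorem inner_cross_left (v w z : E3) : inner ℝ (cross v w) z = inner ℝ v (cross w z) := by
  simp [inner_E3, cross]; ring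

@[simp] theorem inner_cross_self_left (v w : E3) : inner ℝ (cross v w) v = 0 := by
  simp [inner_E3, cross]; ring

@[simp] theorem inner_cross_self_right (v w : E3) : inner ℝ (cross v w) w = 0 := by
  simp [inner_E3, cross]; ring

theorem cross_cross (u v w : E3) :
    cross (cross u v) w = inner ℝ u w • v - inner ℝ v w • u := by
  ext k; fin_cases k <;> simp [cross, inner_E3] <;> ring

theorem inner_cross_cross (a b c d : E3) : inner ℝ (cross a b) (cross c d) =
    inner ℝ a c * inner ℝ b d - inner ℝ a d * inner ℝ b c := by
  simp [cross, inner_E3]; ring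

theorem eq_sum_unitVec (w : E3) : w = w 0 • unitVec 0 + w 1 • unitVec 1 + w 2 • unitVec 2 := by
  ext j; fin_cases j <;> simp [unitVec]

/-- The trace of a linear map of space. -/
noncomputable def tr (A : E3 →L[ℝ] E3) : ℝ :=
  A (unitVec 0) 0 + A (unitVec 1) 1 + A (unitVec 2) 2

theorem inner_unitVec_right (w : E3) (k : Fin 3) : inner ℝ w (unitVec k) = w k := by
  fin_cases k <;> simp [inner_E3, unitVec]

/-- The hypothesis says that the tensors of `g j` and `t j` sum to the identity; they need not be
bases. It is used with the four barycentric gradients and vertices, and with the orthonormal frame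
of a face. -/
theorem tr_eq_sum {ι : Type*} [Fintype ι] (g t : ι → E3)
    (h : ∀ w, w = ∑ j, inner ℝ (g j) w • t j) (A : E3 →L[ℝ] E3) :
    tr A = ∑ j, inner ℝ (g j) (A (t j)) := by
  have hk : ∀ k, A (unitVec k) k = ∑ j, g j k * A (t j) k := by
    intro k
    conv_lhs => rw [h (unitVec k), map_sum]
    simp [inner_unitVec_right]
  rw [tr, hk, hk, hk, ← Finset.sum_add_distrib, ← Finset.sum_add_distrib]
  exact Finset.sum_congr rfl fun j _ => (inner_E3 _ _).symm

section Geometry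

variable (T : Tet)

/-! ### Gradients of barycentric coordinates -/

theorem hasFDerivAt_coord (i : Fin 4) (x : E3) :
    HasFDerivAt (fun x => T.coord i x) (T.coord i).linear.toContinuousLinearMap x := by
  rw [AffineMap.decomp (T.coord i)]
  exact (T.coord i).linear.toContinuousLinearMap.hasFDerivAt.add_const _

theorem inner_gradBary (i : Fin 4) (w : E3) :
    inner ℝ (gradBary T i) w = (T.coord i).linear w := by
  rw [gradBary, inner_gradient_left, (hasFDerivAt_coord T i 0).fderiv]
  rfl

theorem coord_sub (i : Fin 4) (x y : E3) :
    T.coord i x - T.coord i y = inner ℝ (gradBary T i) (x - y) := by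
  rw [inner_gradBary]
  exact ((T.coord i).linearMap_vsub x y).symm

theorem coord_vertex (i j : Fin 4) : T.coord i (T j) = if i = j then 1 else 0 :=
  T.coord_apply i j

theorem sum_gradBary : ∑ i, gradBary T i = 0 := by
  refine ext_inner_right ℝ fun w => ?_
  rw [sum_inner, inner_zero_left]
  have h : ∀ i, inner ℝ (gradBary T i) w = T.coord i w - T.coord i 0 := fun i => by
    rw [coord_sub, sub_zero]
  simp_rw [h, Finset.sum_sub_distrib]
  simp

/-- This is the linear part of the representation of a point by its barycentric coordinates. -/
theorem eq_sum_inner_gradBary (w : E3) : w = ∑ i, inner ℝ (gradBary T i) w • T i := by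
  have h : ∀ i, inner ℝ (gradBary T i) w = T.coord i w - T.coord i 0 := fun i => by
    rw [coord_sub, sub_zero]
  simp_rw [h, sub_smul, Finset.sum_sub_distrib]
  rw [T.linear_combination_coord_eq_self, T.linear_combination_coord_eq_self, sub_zero]

theorem sum_inner_gradBary (w : E3) : ∑ i, inner ℝ (gradBary T i) w = 0 := by
  rw [← sum_inner, sum_gradBary, inner_zero_left]

theorem inner_gradBary_sub (i j k : Fin 4) : inner ℝ (gradBary T i) (T j - T k) =
    (if i = j then 1 else 0) - (if i = k then 1 else 0) := by
  rw [← coord_sub, coord_vertex, coord_vertex]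

theorem gradBary_ne_zero (i : Fin 4) : gradBary T i ≠ 0 := by
  intro h
  obtain ⟨j, hj⟩ : ∃ j, j ≠ i := exists_ne i
  have := inner_gradBary_sub T i i j
  rw [h, inner_zero_left] at this
  simp [hj.symm] at this

theorem norm_normal (i : Fin 4) : ‖normal T i‖ = 1 := by
  rw [normal, norm_neg, norm_smul, norm_inv, norm_norm,
    inv_mul_cancel₀ (norm_ne_zero_iff.2 (gradBary_ne_zero T i))]

theorem inner_normal_self (i : Fin 4) : inner ℝ (normal T i) (normal T i) = 1 := by
  rw [real_inner_self_eq_norm_sq, norm_normal]; norm_num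

theorem gradBary_eq (i : Fin 4) : gradBary T i = (-‖gradBary T i‖) • normal T i := by
  rw [normal, smul_neg, neg_smul, neg_neg, smul_smul,
    mul_inv_cancel₀ (norm_ne_zero_iff.2 (gradBary_ne_zero T i)), one_smul]

theorem inner_gradBary_eq_zero_iff (i : Fin 4) (w : E3) :
    inner ℝ (gradBary T i) w = 0 ↔ inner ℝ (normal T i) w = 0 := by
  rw [gradBary_eq, real_inner_smul_left]
  simp [gradBary_ne_zero T i]

/-! ### Facets -/

theorem mem_facet {s : Finset (Fin 4)} {x : E3} :
    x ∈ facet T s ↔ (∀ i, 0 ≤ T.coord i x) ∧ ∀ l ∉ s, T.coord l x = 0 := by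
  rw [facet, T.convexHull_eq_nonneg_coord]; rfl

theorem facet_convex (s : Finset (Fin 4)) : Convex ℝ (facet T s) := by
  intro x hx y hy a b ha hb hab
  rw [mem_facet] at *
  have h : ∀ i, T.coord i (a • x + b • y) = a * T.coord i x + b * T.coord i y := by
    intro i
    rw [Convex.combo_affine_apply hab]; rfl
  refine ⟨fun i => ?_, fun l hl => ?_⟩
  · rw [h]; exact add_nonneg (mul_nonneg ha (hx.1 i)) (mul_nonneg hb (hy.1 i))
  · rw [h, hx.2 l hl, hy.2 l hl]; ring

theorem vertex_mem_facet {s : Finset (Fin 4)} {i : Fin 4} (hi : i ∈ s) : T i ∈ facet T s := by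
  rw [mem_facet]
  refine ⟨fun j => ?_, fun l hl => ?_⟩
  · rw [coord_vertex]; split_ifs <;> norm_num
  · rw [coord_vertex, if_neg]; rintro rfl; exact hl hi

theorem facet_mono {s t : Finset (Fin 4)} (h : s ⊆ t) : facet T s ⊆ facet T t := fun x hx => by
  rw [mem_facet] at *
  exact ⟨hx.1, fun l hl => hx.2 l fun h' => hl (h h')⟩

theorem facet_subset_body (s : Finset (Fin 4)) : facet T s ⊆ body T :=
  facet_mono T (Finset.subset_univ s)

theorem facet_isCompact (s : Finset (Fin 4)) : IsCompact (facet T s) := by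
  have h : facet T s = convexHull ℝ (Set.range T) ∩ ⋂ l ∉ s, {x | T.coord l x = 0} := by
    ext x; simp [facet]
  rw [h]
  refine ((Set.finite_range T).isCompact_convexHull (𝕜 := ℝ)).inter_right ?_
  refine isClosed_iInter fun l => isClosed_iInter fun _ => ?_
  exact isClosed_eq (AffineMap.continuous_of_finiteDimensional _) continuous_const

theorem facet_star {s : Finset (Fin 4)} {a x : E3} (ha : a ∈ facet T s) (hx : x ∈ facet T s)
    {t : ℝ} (ht : t ∈ Set.Icc (0 : ℝ) 1) : a + t • (x - a) ∈ facet T s :=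
  (facet_convex T s).add_smul_sub_mem ha hx ht

theorem inner_gradBary_sub_of_mem {s : Finset (Fin 4)} {x y : E3} (hx : x ∈ facet T s)
    (hy : y ∈ facet T s) {l : Fin 4} (hl : l ∉ s) : inner ℝ (gradBary T l) (x - y) = 0 := by
  rw [← coord_sub, ((mem_facet T).1 hx).2 l hl, ((mem_facet T).1 hy).2 l hl, sub_zero]

theorem inner_normal_sub_of_mem {i : Fin 4} {x y : E3} (hx : x ∈ face T i) (hy : y ∈ face T i) :
    inner ℝ (normal T i) (x - y) = 0 := by
  rw [← inner_gradBary_eq_zero_iff]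
  exact inner_gradBary_sub_of_mem T hx hy (by simp)

/-- The barycentric gradients sum to zero, so the expansion of `w` in the vertices may be recentred
at any point `x`. This puts all tangential directions in the span of the differences that the
tangent cone of a convex set contains. -/
theorem mem_span_sub_of_mem {s : Finset (Fin 4)} {x : E3} {w : E3}
    (hw : ∀ l ∉ s, inner ℝ (gradBary T l) w = 0) :
    w ∈ Submodule.span ℝ {z | ∃ y ∈ facet T s, z = y - x} := by
  have h : w = ∑ i, inner ℝ (gradBary T i) w • (T i - x) := by
    simp_rw [smul_sub, Finset.sum_sub_distrib, ← Finset.sum_smul]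
    rw [sum_inner_gradBary, zero_smul, sub_zero]
    exact eq_sum_inner_gradBary T w
  rw [h]
  refine sum_mem fun i _ => ?_
  by_cases hi : i ∈ s
  · exact Submodule.smul_mem _ _ (Submodule.subset_span ⟨T i, vertex_mem_facet T hi, rfl⟩)
  · rw [hw i hi, zero_smul]; exact zero_mem _

end Geometry

/-! ### Restriction to facets and derivatives along them -/

section Functions

variable {V : Type*} [NormedAddCommGroup V] [NormedSpace ℝ V]

@[simp] theorem restrict_apply (A : Set E3) (U : E3 → V) (x : A) : restrict A U x = U x := rfl

theorem ext0_restrict {A : Set E3} (U : E3 → V) {x : E3} (hx : x ∈ A) :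
    ext0 (restrict A U) x = U x := ext0_of_mem _ hx

theorem res_restrict {A B : Set E3} (h : B ⊆ A) (U : E3 → V) :
    res B (restrict A U) = restrict B U := by
  funext x; exact ext0_restrict U (h x.2)

theorem res_apply {A B : Set E3} (h : B ⊆ A) (u : A → V) (x : B) :
    res B u x = u ⟨x, h x.2⟩ := ext0_of_mem _ (h x.2)

theorem mem_smooth {A : Set E3} {u : A → V} :
    u ∈ smooth V A ↔ ∃ U : E3 → V, ContDiff ℝ ∞ U ∧ restrict A U = u := Submodule.mem_map

theorem restrict_congr {A : Set E3} {U W : E3 → V} (h : ∀ x ∈ A, U x = W x) :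
    restrict A U = restrict A W := by
  funext x; exact h x x.2

/-- A lower-dimensional facet does not have unique derivatives, but two derivatives within it agree
on its tangent cone. By convexity the cone at `x` contains `y - x` for each `y` in the facet, and
these differences span the tangential directions. Derivatives on facets are computed from smooth
extensions in this way. -/
theorem deriv_facet (T : Tet) {s : Finset (Fin 4)} {U : E3 → V} (x : facet T s)
    (hU : DifferentiableAt ℝ U x) {w : E3} (hw : ∀ l ∉ s, inner ℝ (gradBary T l) w = 0) :
    deriv (restrict (facet T s) U) x w = fderiv ℝ U x w := by
  have h1 : HasFDerivWithinAt (ext0 (restrict (facet T s) U)) (fderiv ℝ U x) (facet T s) x :=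
    hU.hasFDerivAt.hasFDerivWithinAt.congr (fun y hy => ext0_restrict U hy) (ext0_restrict U x.2)
  have h2 := h1.differentiableWithinAt.hasFDerivWithinAt
  have h3 := h2.unique_on h1
  have h4 := mem_span_sub_of_mem T (x := (x : E3)) hw
  have h5 : Set.EqOn (deriv (restrict (facet T s) U) x) (fderiv ℝ U x)
      {z | ∃ y ∈ facet T s, z = y - (x : E3)} := by
    rintro _ ⟨y, hy, rfl⟩
    exact h3 (mem_tangentConeAt_of_segment_subset ((facet_convex T s).segment_subset x.2 hy))
  exact LinearMap.eqOn_span (f := (deriv (restrict (facet T s) U) x : E3 →ₗ[ℝ] V))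
    (g := (fderiv ℝ U x : E3 →ₗ[ℝ] V)) h5 h4

end Functions

/-! ### Differential operators on space -/

/-- Gradient of a function on space. -/
noncomputable def ggrad (f : E3 → ℝ) : E3 → E3 := fun x =>
  !₂[fderiv ℝ f x (unitVec 0), fderiv ℝ f x (unitVec 1), fderiv ℝ f x (unitVec 2)]

/-- Curl of a vector field on space. -/
noncomputable def gcurl (U : E3 → E3) : E3 → E3 := fun x =>
  !₂[fderiv ℝ U x (unitVec 1) 2 - fderiv ℝ U x (unitVec 2) 1,
     fderiv ℝ U x (unitVec 2) 0 - fderiv ℝ U x (unitVec 0) 2,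
     fderiv ℝ U x (unitVec 0) 1 - fderiv ℝ U x (unitVec 1) 0]

/-- Divergence of a vector field on space. -/
noncomputable def gdiv (U : E3 → E3) : E3 → ℝ := fun x => tr (fderiv ℝ U x)

theorem inner_ggrad (f : E3 → ℝ) (x w : E3) : inner ℝ (ggrad f x) w = fderiv ℝ f x w := by
  conv_rhs => rw [eq_sum_unitVec w]
  rw [inner_E3]
  simp [ggrad]
  ring

theorem inner_gcurl_cross (U : E3 → E3) (x a b : E3) : inner ℝ (gcurl U x) (cross a b) =
    inner ℝ (fderiv ℝ U x a) b - inner ℝ (fderiv ℝ U x b) a := by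
  rw [eq_sum_unitVec a, eq_sum_unitVec b]
  simp only [map_add, map_smul]
  simp only [inner_E3, gcurl, cross, unitVec]
  simp
  ring

section Smooth

variable {U W : E3 → E3} {f : E3 → ℝ}

theorem fderiv_component (hU : Differentiable ℝ U) (x w : E3) (k : Fin 3) :
    fderiv ℝ (fun y => U y k) x w = fderiv ℝ U x w k := by
  have h := ((EuclideanSpace.proj k : E3 →L[ℝ] ℝ).hasFDerivAt.comp x (hU x).hasFDerivAt)
  have e : (fun y => U y k) = (EuclideanSpace.proj k : E3 →L[ℝ] ℝ) ∘ U := rfl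
  rw [e, h.fderiv]; rfl

theorem contDiff_fderiv_apply {V : Type*} [NormedAddCommGroup V] [NormedSpace ℝ V] {g : E3 → V}
    (hg : ContDiff ℝ ∞ g) (w : E3) : ContDiff ℝ ∞ fun x => fderiv ℝ g x w :=
  (hg.fderiv_right (m := ∞) (by simp)).clm_apply contDiff_const

theorem contDiff_fderiv_component (hU : ContDiff ℝ ∞ U) (w : E3) (k : Fin 3) :
    ContDiff ℝ ∞ fun x => fderiv ℝ U x w k :=
  (EuclideanSpace.proj k : E3 →L[ℝ] ℝ).contDiff.comp (contDiff_fderiv_apply hU w)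

theorem contDiff_vec {a b c : E3 → ℝ} (ha : ContDiff ℝ ∞ a) (hb : ContDiff ℝ ∞ b)
    (hc : ContDiff ℝ ∞ c) : ContDiff ℝ ∞ fun x => (!₂[a x, b x, c x] : E3) := by
  rw [contDiff_euclidean]
  intro i; fin_cases i <;> assumption

theorem contDiff_ggrad (hf : ContDiff ℝ ∞ f) : ContDiff ℝ ∞ (ggrad f) :=
  contDiff_vec (contDiff_fderiv_apply hf _) (contDiff_fderiv_apply hf _)
    (contDiff_fderiv_apply hf _)

theorem contDiff_gcurl (hU : ContDiff ℝ ∞ U) : ContDiff ℝ ∞ (gcurl U) :=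
  contDiff_vec ((contDiff_fderiv_component hU _ _).sub (contDiff_fderiv_component hU _ _))
    ((contDiff_fderiv_component hU _ _).sub (contDiff_fderiv_component hU _ _))
    ((contDiff_fderiv_component hU _ _).sub (contDiff_fderiv_component hU _ _))

theorem contDiff_gdiv (hU : ContDiff ℝ ∞ U) : ContDiff ℝ ∞ (gdiv U) :=
  ((contDiff_fderiv_component hU _ _).add (contDiff_fderiv_component hU _ _)).add
    (contDiff_fderiv_component hU _ _)

theorem contDiff_cross (hU : ContDiff ℝ ∞ U) (hW : ContDiff ℝ ∞ W) :
    ContDiff ℝ ∞ fun x => cross (U x) (W x) :=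
  (crossL.contDiff.comp hU).clm_apply hW

theorem gcurl_add (hU : Differentiable ℝ U) (hW : Differentiable ℝ W) :
    gcurl (U + W) = gcurl U + gcurl W := by
  funext x
  ext k
  simp only [gcurl, fderiv_add (hU x) (hW x), Pi.add_apply]
  fin_cases k <;> simp <;> ring

theorem gcurl_smul (c : ℝ) (hU : Differentiable ℝ U) : gcurl (c • U) = c • gcurl U := by
  funext x
  ext k
  simp only [gcurl, fderiv_const_smul (hU x), Pi.smul_apply]
  fin_cases k <;> simp <;> ring

theorem gdiv_add (hU : Differentiable ℝ U) (hW : Differentiable ℝ W) :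
    gdiv (U + W) = gdiv U + gdiv W := by
  funext x
  simp only [gdiv, tr, fderiv_add (hU x) (hW x), Pi.add_apply]
  simp
  ring

theorem gdiv_smul (c : ℝ) (hU : Differentiable ℝ U) : gdiv (c • U) = c • gdiv U := by
  funext x
  simp only [gdiv, tr, fderiv_const_smul (hU x), Pi.smul_apply]
  simp
  ring

theorem fderiv_cross (hU : Differentiable ℝ U) (hW : Differentiable ℝ W) (x w : E3) :
    fderiv ℝ (fun y => cross (U y) (W y)) x w =
      cross (U x) (fderiv ℝ W x w) + cross (fderiv ℝ U x w) (W x) := by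
  have h := crossL.hasFDerivAt_of_bilinear (hU x).hasFDerivAt (hW x).hasFDerivAt
  have e : (fun y => cross (U y) (W y)) = fun y => crossL (U y) (W y) := rfl
  rw [e, h.fderiv]; rfl

theorem fderiv_smul_apply {q : E3 → ℝ} (hq : Differentiable ℝ q) (hU : Differentiable ℝ U)
    (x w : E3) : fderiv ℝ (fun y => q y • U y) x w =
      q x • fderiv ℝ U x w + fderiv ℝ q x w • U x := by
  rw [((hq x).hasFDerivAt.fun_smul (hU x).hasFDerivAt).fderiv]
  rfl

theorem gdiv_cross_const (hU : Differentiable ℝ U) (n x : E3) :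
    gdiv (fun y => cross (U y) n) x = inner ℝ (gcurl U x) n := by
  simp only [gdiv, tr, fderiv_cross hU (differentiable_const n)]
  simp [inner_E3, gcurl, cross]
  ring

/-- This is the vector identity behind the Poincaré lifting. When `U` is a radial integral with
weight t, the first two terms form the left-hand side of `radial_euler` and the last one is governed
by the divergence. -/
theorem gcurl_cross_sub (hU : Differentiable ℝ U) (a x : E3) :
    gcurl (fun y => cross (U y) (y - a)) x =
      (2 : ℝ) • U x + fderiv ℝ U x (x - a) - gdiv U x • (x - a) := by
  have hd : Differentiable ℝ fun y : E3 => y - a := by fun_prop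
  have hw : ∀ w, fderiv ℝ (fun y : E3 => y - a) x w = w := fun w => by
    rw [fderiv_sub_const]; simp
  have h1 : fderiv ℝ U x (x - a) = (x - a) 0 • fderiv ℝ U x (unitVec 0) +
      (x - a) 1 • fderiv ℝ U x (unitVec 1) + (x - a) 2 • fderiv ℝ U x (unitVec 2) := by
    conv_lhs => rw [eq_sum_unitVec (x - a)]
    simp
  rw [h1]
  ext k
  simp only [gcurl, gdiv, tr, fderiv_cross hU hd, hw]
  fin_cases k <;> simp [cross, unitVec] <;> ring

theorem gdiv_smul_field {q : E3 → ℝ} (hq : Differentiable ℝ q) (hU : Differentiable ℝ U) (x : E3) :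
    gdiv (fun y => q y • U y) x = q x * gdiv U x + fderiv ℝ q x (U x) := by
  have h1 : fderiv ℝ q x (U x) = U x 0 * fderiv ℝ q x (unitVec 0) +
      U x 1 * fderiv ℝ q x (unitVec 1) + U x 2 * fderiv ℝ q x (unitVec 2) := by
    conv_lhs => rw [eq_sum_unitVec (U x)]
    simp
  simp only [gdiv, tr, fderiv_smul_apply hq hU, h1]
  simp
  ring

theorem gdiv_clm (A : E3 →L[ℝ] E3) (c x : E3) : gdiv (fun y => A y + c) x = tr A := by
  simp only [gdiv]
  rw [fderiv_add_const, ContinuousLinearMap.fderiv]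

theorem fderiv_fderiv_apply {V : Type*} [NormedAddCommGroup V] [NormedSpace ℝ V] {g : E3 → V}
    (hg : ContDiff ℝ ∞ g) (v x w : E3) :
    fderiv ℝ (fun y => fderiv ℝ g y v) x w = fderiv ℝ (fderiv ℝ g) x w v := by
  have h1 : DifferentiableAt ℝ (fderiv ℝ g) x :=
    (hg.fderiv_right (m := ∞) (by simp)).differentiable (by simp) x
  rw [(h1.hasFDerivAt.clm_apply (hasFDerivAt_const v x)).fderiv]
  simp

theorem fderiv_fderiv_symm {V : Type*} [NormedAddCommGroup V] [NormedSpace ℝ V] {g : E3 → V}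
    (hg : ContDiff ℝ ∞ g) (v x w : E3) :
    fderiv ℝ (fun y => fderiv ℝ g y v) x w = fderiv ℝ (fun y => fderiv ℝ g y w) x v := by
  rw [fderiv_fderiv_apply hg, fderiv_fderiv_apply hg]
  have h2 : minSmoothness ℝ 2 ≤ (∞ : WithTop ℕ∞) := by
    rw [minSmoothness_of_isRCLikeNormedField]; exact WithTop.coe_le_coe.2 (le_top : (2 : ℕ∞) ≤ ⊤)
  exact hg.contDiffAt.isSymmSndFDerivAt h2 w v

theorem gcurl_ggrad (hf : ContDiff ℝ ∞ f) : gcurl (ggrad f) = 0 := by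
  have hd := (contDiff_ggrad hf).differentiable (by simp)
  have h : ∀ k x w, fderiv ℝ (ggrad f) x w k = fderiv ℝ (fun y => fderiv ℝ f y (unitVec k)) x w := by
    intro k x w
    rw [← fderiv_component hd]
    congr 2
    funext y
    fin_cases k <;> rfl
  funext x
  ext k
  simp only [gcurl, h]
  fin_cases k
  · simp [fderiv_fderiv_symm hf (unitVec 1) x (unitVec 2)]
  · simp [fderiv_fderiv_symm hf (unitVec 0) x (unitVec 2)]
  · simp [fderiv_fderiv_symm hf (unitVec 0) x (unitVec 1)]

theorem gdiv_gcurl (hU : ContDiff ℝ ∞ U) : gdiv (gcurl U) = 0 := by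
  have hd := (contDiff_gcurl hU).differentiable (by simp)
  have hD : ∀ v j, Differentiable ℝ fun y => fderiv ℝ U y v j := fun v j =>
    (contDiff_fderiv_component hU v j).differentiable (by simp)
  have hD' : ∀ v, Differentiable ℝ fun y => fderiv ℝ U y v := fun v =>
    (contDiff_fderiv_apply hU v).differentiable (by simp)
  have h2 : ∀ v w j x, fderiv ℝ (fun y => fderiv ℝ U y v j) x w =
      fderiv ℝ (fun y => fderiv ℝ U y v) x w j := fun v w j x => fderiv_component (hD' v) x w j
  have e0 : (fun y => gcurl U y 0) = fun y =>
      fderiv ℝ U y (unitVec 1) 2 - fderiv ℝ U y (unitVec 2) 1 := rfl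
  have e1 : (fun y => gcurl U y 1) = fun y =>
      fderiv ℝ U y (unitVec 2) 0 - fderiv ℝ U y (unitVec 0) 2 := rfl
  have e2 : (fun y => gcurl U y 2) = fun y =>
      fderiv ℝ U y (unitVec 0) 1 - fderiv ℝ U y (unitVec 1) 0 := rfl
  funext x
  simp only [gdiv, tr]
  rw [← fderiv_component hd, ← fderiv_component hd, ← fderiv_component hd, e0, e1, e2,
    fderiv_fun_sub (hD _ _ x) (hD _ _ x), fderiv_fun_sub (hD _ _ x) (hD _ _ x),
    fderiv_fun_sub (hD _ _ x) (hD _ _ x)]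
  simp only [sub_apply, h2]
  rw [fderiv_fderiv_symm hU (unitVec 1) x (unitVec 0),
    fderiv_fderiv_symm hU (unitVec 2) x (unitVec 0), fderiv_fderiv_symm hU (unitVec 2) x (unitVec 1)]
  simp

end Smooth

/-! ### Differential operators and traces of restricted fields -/

section Geometry

variable (T : Tet)

theorem grad_restrict {f : E3 → ℝ} (hf : Differentiable ℝ f) :
    grad (restrict (body T) f) = restrict (body T) (ggrad f) := by
  funext x
  simp only [grad, restrict_apply, ggrad]
  rw [deriv_facet T x (hf x) (by simp), deriv_facet T x (hf x) (by simp),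
    deriv_facet T x (hf x) (by simp)]

theorem curl_restrict {U : E3 → E3} (hU : Differentiable ℝ U) :
    curl (restrict (body T) U) = restrict (body T) (gcurl U) := by
  funext x
  simp only [curl, restrict_apply, gcurl]
  rw [deriv_facet T x (hU x) (by simp), deriv_facet T x (hU x) (by simp),
    deriv_facet T x (hU x) (by simp)]

theorem div_restrict {U : E3 → E3} (hU : Differentiable ℝ U) :
    div (restrict (body T) U) = restrict (body T) (gdiv U) := by
  funext x
  simp only [div, restrict_apply, gdiv, tr]
  rw [deriv_facet T x (hU x) (by simp), deriv_facet T x (hU x) (by simp),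
    deriv_facet T x (hU x) (by simp)]

theorem inner_normal_frame₁ (i : Fin 4) : inner ℝ (normal T i) (frame₁ T i) = 0 := by
  rw [← inner_gradBary_eq_zero_iff, frame₁, real_inner_smul_right, inner_gradBary_sub]
  simp [(Fin.succAbove_ne i _).symm]

theorem norm_frame₁ (i : Fin 4) : ‖frame₁ T i‖ = 1 := by
  have h : T (i.succAbove 1) - T (i.succAbove 0) ≠ 0 := by
    rw [sub_ne_zero]
    exact fun h => by simpa using T.ind.injective h
  rw [frame₁, norm_smul, norm_inv, norm_norm, inv_mul_cancel₀ (norm_ne_zero_iff.2 h)]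

theorem inner_frame₁_self (i : Fin 4) : inner ℝ (frame₁ T i) (frame₁ T i) = 1 := by
  rw [real_inner_self_eq_norm_sq, norm_frame₁]; norm_num

theorem inner_frame₂_self (i : Fin 4) : inner ℝ (frame₂ T i) (frame₂ T i) = 1 := by
  rw [frame₂, inner_cross_cross, inner_normal_self, inner_frame₁_self, inner_normal_frame₁]
  norm_num

theorem inner_normal_frame₂ (i : Fin 4) : inner ℝ (normal T i) (frame₂ T i) = 0 := by
  rw [frame₂, real_inner_comm, inner_cross_self_left]

theorem inner_frame₁_frame₂ (i : Fin 4) : inner ℝ (frame₁ T i) (frame₂ T i) = 0 := by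
  rw [frame₂, real_inner_comm, inner_cross_self_right]

theorem frame_expansion (i : Fin 4) (w : E3) : w = inner ℝ (frame₁ T i) w • frame₁ T i +
    inner ℝ (frame₂ T i) w • frame₂ T i + inner ℝ (normal T i) w • normal T i := by
  have ho : Orthonormal ℝ ![frame₁ T i, frame₂ T i, normal T i] := by
    have n1 : ‖frame₂ T i‖ = 1 := by
      have := inner_frame₂_self T i
      rw [real_inner_self_eq_norm_sq] at this
      exact (pow_eq_one_iff_of_nonneg (norm_nonneg _) (by norm_num)).1 this
    have h12 := inner_frame₁_frame₂ T i
    have h21 := (real_inner_comm _ _).trans h12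
    have hn1 := inner_normal_frame₁ T i
    have h1n := (real_inner_comm _ _).trans hn1
    have hn2 := inner_normal_frame₂ T i
    have h2n := (real_inner_comm _ _).trans hn2
    refine ⟨fun k => ?_, fun j k hjk => ?_⟩
    · fin_cases k
      · exact norm_frame₁ T i
      · exact n1
      · exact norm_normal T i
    · fin_cases j <;> fin_cases k <;> first | exact absurd rfl hjk | assumption
  have hb := coe_basisOfOrthonormalOfCardEqFinrank ho (by simp)
  have hs : ⊤ ≤ Submodule.span ℝ (Set.range ![frame₁ T i, frame₂ T i, normal T i]) := by
    rw [← hb, (basisOfOrthonormalOfCardEqFinrank ho (by simp)).span_eq]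
  have := (OrthonormalBasis.mk ho hs).sum_repr' w
  simpa [Fin.sum_univ_three] using this.symm

/-- On a face, the surface divergence of a field which is tangential everywhere is its
divergence. -/
theorem bdiv_restrict {i : Fin 4} {V : E3 → E3} (hV : Differentiable ℝ V)
    (ht : ∀ x, inner ℝ (normal T i) (V x) = 0) :
    bdiv T i (restrict (face T i) V) = restrict (face T i) (gdiv V) := by
  funext x
  have hl : ∀ w, inner ℝ (normal T i) w = 0 →
      ∀ l ∉ ({i}ᶜ : Finset (Fin 4)), inner ℝ (gradBary T l) w = 0 := by
    intro w hw l hl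
    have : l = i := by simpa using hl
    rw [this, inner_gradBary_eq_zero_iff, hw]
  -- The normal component of `V` vanishes on all of space, so its derivative in the normal direction
  -- vanishes too, and the full trace reduces to the two tangential terms.
  have hn : inner ℝ (normal T i) (fderiv ℝ V x (normal T i)) = 0 := by
    have h := (innerSL ℝ (normal T i)).hasFDerivAt.comp (x : E3) (hV x).hasFDerivAt
    have e : (innerSL ℝ (normal T i)) ∘ V = fun _ => (0 : ℝ) := by funext y; exact ht y
    rw [e] at h
    have := h.unique (hasFDerivAt_const (0 : ℝ) (x : E3))
    exact congrArg (fun A : E3 →L[ℝ] ℝ => A (normal T i)) this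
  have e : ∀ w, w = ∑ j, inner ℝ (![frame₁ T i, frame₂ T i, normal T i] j) w •
      ![frame₁ T i, frame₂ T i, normal T i] j := by
    intro w
    simpa [Fin.sum_univ_three] using frame_expansion T i w
  simp only [bdiv, restrict_apply, gdiv]
  rw [deriv_facet T x (hV x) (hl _ (inner_normal_frame₁ T i)),
    deriv_facet T x (hV x) (hl _ (inner_normal_frame₂ T i)), tr_eq_sum _ _ e]
  simp [Fin.sum_univ_three, hn, real_inner_comm]

theorem bcurl_restrict {i : Fin 4} {q : E3 → ℝ} (hq : Differentiable ℝ q) :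
    bcurl T i (restrict (face T i) q) =
      restrict (face T i) fun x => cross (ggrad q x) (normal T i) := by
  funext x
  have hl : ∀ w, inner ℝ (normal T i) w = 0 →
      ∀ l ∉ ({i}ᶜ : Finset (Fin 4)), inner ℝ (gradBary T l) w = 0 := by
    intro w hw l hl
    have : l = i := by simpa using hl
    rw [this, inner_gradBary_eq_zero_iff, hw]
  simp only [bcurl, restrict_apply]
  rw [deriv_facet T x (hq x) (hl _ (inner_normal_frame₁ T i)),
    deriv_facet T x (hq x) (hl _ (inner_normal_frame₂ T i))]
  conv_rhs => rw [frame_expansion T i (ggrad q x), cross_add, cross_smul _ (normal T i)]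
  rw [cross_self, smul_zero, add_zero, real_inner_comm, inner_ggrad, real_inner_comm, inner_ggrad]

theorem traceTan_restrict (i : Fin 4) (U : E3 → E3) : traceTan T i (restrict (body T) U) =
    restrict (face T i) fun x => cross (U x) (normal T i) := by
  funext x
  show cross (res (face T i) (restrict (body T) U) x) _ = _
  rw [res_restrict (facet_subset_body T _)]; rfl

theorem traceNor_restrict (i : Fin 4) (U : E3 → E3) : traceNor T i (restrict (body T) U) =
    restrict (face T i) fun x => inner ℝ (U x) (normal T i) := by
  funext x
  show inner ℝ (res (face T i) (restrict (body T) U) x) _ = _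
  rw [res_restrict (facet_subset_body T _)]; rfl

theorem traceEdge_restrict (e : Edge) (U : E3 → E3) : traceEdge T e (restrict (body T) U) =
    restrict (edge T e) fun x => inner ℝ (U x) (tangent T e) := by
  funext x
  show inner ℝ (res (edge T e) (restrict (body T) U) x) _ = _
  rw [res_restrict (facet_subset_body T _)]; rfl

theorem inner_normal_cross (i : Fin 4) (v : E3) :
    inner ℝ (normal T i) (cross v (normal T i)) = 0 := by
  rw [real_inner_comm, inner_cross_self_right]

/-- For constant n one has div (U × n) = curl U · n, and U × n is tangential, so its surface
divergence is its full divergence. This links the face stage of `Pi1` to that of `Pi2`. -/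
theorem bdiv_traceTan (i : Fin 4) {u : body T → E3} (hu : u ∈ smooth E3 (body T)) :
    bdiv T i (traceTan T i u) = traceNor T i (curl u) := by
  obtain ⟨U, hU, rfl⟩ := mem_smooth.1 hu
  have hd := hU.differentiable (by simp)
  rw [traceTan_restrict, bdiv_restrict T _ fun x => inner_normal_cross T i _, curl_restrict T hd,
    traceNor_restrict]
  · congr 1; funext x; exact gdiv_cross_const hd _ _
  · exact (contDiff_cross hU contDiff_const).differentiable (by simp)

end Geometry

/-! ### Radial integrals -/

section Radial

variable {V : Type*} [NormedAddCommGroup V] [NormedSpace ℝ V]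

/-- The radial integral `∫₀¹ t^k G(a + t (x - a)) dt`. -/
noncomputable def radial (k : ℕ) (a : E3) (G : E3 → V) : E3 → V := fun x =>
  ∫ t in (0 : ℝ)..1, t ^ k • G (a + t • (x - a))

theorem radial_continuous_integrand {G : E3 → V} (hG : Continuous G) (k : ℕ) (a x : E3) :
    Continuous fun t : ℝ => t ^ k • G (a + t • (x - a)) := by fun_prop

/-- This is differentiation under the integral; the chain rule contributes one more factor t, hence
`k + 1`. A dominating constant exists by compactness of the unit ball around `x` times [0, 1]. -/
theorem hasFDerivAt_radial {G : E3 → V} (hG : ContDiff ℝ ∞ G) (k : ℕ) (a x : E3) :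
    HasFDerivAt (radial k a G) (radial (k + 1) a (fderiv ℝ G) x) x := by
  have hc : Continuous G := hG.continuous
  have hc' : Continuous (fderiv ℝ G) := hG.continuous_fderiv (by simp)
  have hj : Continuous fun z : E3 × ℝ => z.2 ^ (k + 1) • fderiv ℝ G (a + z.2 • (z.1 - a)) := by
    fun_prop
  obtain ⟨C, hC⟩ := ((isCompact_closedBall x 1).prod (isCompact_Icc (a := (0 : ℝ)) (b := 1))
    ).exists_bound_of_continuousOn hj.continuousOn
  refine intervalIntegral.hasFDerivAt_integral_of_dominated_of_fderiv_le
    (F' := fun x t => t ^ (k + 1) • fderiv ℝ G (a + t • (x - a))) (bound := fun _ => C)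
    (Metric.closedBall_mem_nhds x one_pos) ?_ ?_ ?_ ?_ ?_ ?_
  · exact Filter.Eventually.of_forall fun y =>
      (radial_continuous_integrand hc k a y).aestronglyMeasurable
  · exact (radial_continuous_integrand hc k a x).intervalIntegrable _ _
  · exact (radial_continuous_integrand hc' (k + 1) a x).aestronglyMeasurable
  · refine Filter.Eventually.of_forall fun t ht y hy => hC (y, t) ⟨hy, ?_⟩
    rw [Set.uIoc_of_le zero_le_one] at ht
    exact ⟨ht.1.le, ht.2⟩
  · exact intervalIntegrable_const
  · refine Filter.Eventually.of_forall fun t _ y _ => ?_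
    have h1 : HasFDerivAt (fun y : E3 => a + t • (y - a)) (t • ContinuousLinearMap.id ℝ E3) y := by
      exact (((hasFDerivAt_id y).sub_const a).const_smul t).const_add a
    have h2 := (((hG.differentiable (by simp)) (a + t • (y - a))).hasFDerivAt.comp y h1).const_smul
      (t ^ k)
    refine h2.congr_fderiv ?_
    ext w
    simp [pow_succ, smul_smul]

theorem radial_apply (k : ℕ) (a : E3) {A : E3 → E3 →L[ℝ] V} (hA : Continuous A) (x w : E3) :
    radial k a A x w = radial k a (fun y => A y w) x := by
  rw [radial, ContinuousLinearMap.intervalIntegral_apply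
    ((radial_continuous_integrand hA k a x).intervalIntegrable _ _)]
  rfl

theorem fderiv_radial {G : E3 → V} (hG : ContDiff ℝ ∞ G) (k : ℕ) (a x w : E3) :
    fderiv ℝ (radial k a G) x w = radial (k + 1) a (fun y => fderiv ℝ G y w) x := by
  rw [(hasFDerivAt_radial hG k a x).fderiv, radial_apply _ _ (hG.continuous_fderiv (by simp))]

theorem radial_add {G H : E3 → V} (hG : Continuous G) (hH : Continuous H) (k : ℕ) (a : E3) :
    radial k a (G + H) = radial k a G + radial k a H := by
  funext x
  simp only [radial, Pi.add_apply, smul_add]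
  exact intervalIntegral.integral_add
    ((radial_continuous_integrand hG k a x).intervalIntegrable _ _)
    ((radial_continuous_integrand hH k a x).intervalIntegrable _ _)

theorem radial_smul (c : ℝ) (G : E3 → V) (k : ℕ) (a : E3) :
    radial k a (c • G) = c • radial k a G := by
  funext x
  simp only [radial, Pi.smul_apply, smul_comm _ c]
  exact intervalIntegral.integral_smul _ _

/-- The differential equation satisfied by radial integrals. -/
theorem radial_euler [CompleteSpace V] {G : E3 → V} (hG : ContDiff ℝ ∞ G) (k : ℕ) (a x : E3) :
    ((k : ℝ) + 1) • radial k a G x + fderiv ℝ (radial k a G) x (x - a) = G x := by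
  rw [fderiv_radial hG]
  have hc : Continuous G := hG.continuous
  have hc' := (contDiff_fderiv_apply hG (x - a)).continuous
  -- The equation is the integral over [0, 1] of the derivative of t ^ (k + 1) G(a + t (x - a)).
  have hd : ∀ t ∈ Set.uIcc (0 : ℝ) 1, HasDerivAt (fun t : ℝ => t ^ (k + 1) • G (a + t • (x - a)))
      (((k : ℝ) + 1) • (t ^ k • G (a + t • (x - a))) +
        t ^ (k + 1) • fderiv ℝ G (a + t • (x - a)) (x - a)) t := by
    intro t _
    have h1 : HasDerivAt (fun t : ℝ => a + t • (x - a)) (x - a) t := by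
      simpa using ((hasDerivAt_id t).smul_const (x - a)).const_add a
    have h2 := ((hG.differentiable (by simp)) (a + t • (x - a))).hasFDerivAt.comp_hasDerivAt t h1
    have h3 := (hasDerivAt_pow (k + 1) t).fun_smul h2
    refine h3.congr_deriv ?_
    simp [smul_smul, add_comm]
  have hi1 : IntervalIntegrable (fun t => ((k : ℝ) + 1) • t ^ k • G (a + t • (x - a)))
      volume 0 1 :=
    (continuous_const.smul (radial_continuous_integrand hc k a x)).intervalIntegrable _ _
  have hi2 := (radial_continuous_integrand hc' (k + 1) a x).intervalIntegrable (μ := volume) 0 1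
  have h := intervalIntegral.integral_eq_sub_of_hasDerivAt hd (hi1.add hi2)
  rw [intervalIntegral.integral_add hi1 hi2] at h
  have e : ∫ t in (0 : ℝ)..1, ((k : ℝ) + 1) • t ^ k • G (a + t • (x - a)) =
    ((k : ℝ) + 1) • radial k a G x := intervalIntegral.integral_smul _ _
  rw [e] at h
  simpa [radial] using h

end Radial

theorem radial_component {U : E3 → E3} (hU : Continuous U) (k : ℕ) (a x : E3) (j : Fin 3) :
    radial k a U x j = radial k a (fun y => U y j) x := by
  have h := (EuclideanSpace.proj j : E3 →L[ℝ] ℝ).intervalIntegral_comp_comm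
    ((radial_continuous_integrand hU k a x).intervalIntegrable (μ := volume) 0 1)
  simp only [radial]
  rw [show (∫ t in (0 : ℝ)..1, t ^ k • U (a + t • (x - a))) j =
    (EuclideanSpace.proj j : E3 →L[ℝ] ℝ) (∫ t in (0 : ℝ)..1, t ^ k • U (a + t • (x - a))) from rfl,
    ← h]
  rfl

theorem radial_mem_Pol {m : ℤ} {q : E3 → ℝ} (hq : q ∈ Pol m) (k : ℕ) (a : E3) :
    radial k a q ∈ Pol m := by
  refine integral_mem_of_finiteDimensional (Pol m) (fun t x => t ^ k • q (a + t • (x - a)))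
    (fun t => Submodule.smul_mem _ (t ^ k) (Pol_comp hq fun j => ?_)) (fun x => ?_) 0 1
  · have := Pol_affine (a j - t * a j) (t • (EuclideanSpace.proj j : E3 →L[ℝ] ℝ).toLinearMap)
    convert this using 2 with x
    simp; ring
  · exact radial_continuous_integrand (Pol_contDiff hq).continuous k a x

theorem mem_VPol {m : ℤ} {P : E3 → E3} : P ∈ VPol m ↔ ∀ k, (fun x => P x k) ∈ Pol m := by
  simp only [VPol, Submodule.mem_iInf, Submodule.mem_comap]; rfl

theorem VPol_mono {m n : ℤ} (h : m ≤ n) : VPol m ≤ VPol n := fun _ hP =>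
  mem_VPol.2 fun k => Pol_mono h (mem_VPol.1 hP k)

theorem VPol_contDiff {m : ℤ} {P : E3 → E3} (hP : P ∈ VPol m) : ContDiff ℝ ∞ P := by
  rw [contDiff_euclidean]
  exact fun k => Pol_contDiff (mem_VPol.1 hP k)

theorem radial_mem_VPol {m : ℤ} {P : E3 → E3} (hP : P ∈ VPol m) (k : ℕ) (a : E3) :
    radial k a P ∈ VPol m := mem_VPol.2 fun j => by
  simp_rw [radial_component (VPol_contDiff hP).continuous]
  exact radial_mem_Pol (mem_VPol.1 hP j) k a

theorem VPol_linear_comp {m : ℤ} {P : E3 → E3} (hP : P ∈ VPol m) (A : E3 →L[ℝ] E3) :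
    (fun x => A (P x)) ∈ VPol m := by
  refine mem_VPol.2 fun j => ?_
  have e : (fun x => A (P x) j) = ∑ k, A (unitVec k) j • fun x => P x k := by
    funext x
    conv_lhs => rw [eq_sum_unitVec (P x)]
    simp [Fin.sum_univ_three, mul_comm]
  rw [e]
  exact sum_mem fun k _ => Submodule.smul_mem _ _ (mem_VPol.1 hP k)

theorem Pol_inner {m : ℤ} {P : E3 → E3} (hP : P ∈ VPol m) (v : E3) :
    (fun x => inner ℝ (P x) v) ∈ Pol m := by
  have e : (fun x => inner ℝ (P x) v) = v 0 • (fun x => P x 0) + v 1 • (fun x => P x 1) +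
      v 2 • (fun x => P x 2) := by
    funext x
    simp [inner_E3, mul_comm]
  rw [e]
  exact add_mem (add_mem (Submodule.smul_mem _ _ (mem_VPol.1 hP 0))
    (Submodule.smul_mem _ _ (mem_VPol.1 hP 1))) (Submodule.smul_mem _ _ (mem_VPol.1 hP 2))

theorem VPol_smul_const {m : ℤ} {q : E3 → ℝ} (hq : q ∈ Pol m) (v : E3) :
    (fun x => q x • v) ∈ VPol m := mem_VPol.2 fun k => by
  convert Submodule.smul_mem _ (v k) hq using 1
  funext x; simp [mul_comm]

theorem Pol_comp_coord {m : ℤ} {q : E3 → ℝ} (hq : q ∈ Pol m) {l : E3 → ℝ} (hl : l ∈ Pol 1)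
    (v : E3) : (fun x => q (x - l x • v)) ∈ Pol m :=
  Pol_comp hq fun k => by
    convert sub_mem (Pol_coord k) (Submodule.smul_mem _ (v k) hl) using 1
    funext x; simp [mul_comm]

theorem Pol_barycentric (T : Tet) (i : Fin 4) : (fun x => T.coord i x) ∈ Pol 1 := by
  convert Pol_affine (T.coord i 0) (T.coord i).linear using 2 with x
  have := congrFun (AffineMap.decomp (T.coord i)) x
  rw [this]; simp [add_comm]

/-- A polynomial vanishing at the points `x - l(x) v` is divisible by the affine function `l`. -/
theorem exists_mul_of_eq_zero {m : ℤ} {h : E3 → ℝ} (hh : h ∈ Pol m) {l : E3 → ℝ} (hl : l ∈ Pol 1)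
    (v : E3) : ∃ q ∈ Pol (m - 1), ∀ x, h (x - l x • v) = 0 → h x = l x * q x := by
  have hs := Pol_contDiff hh
  have hl' : ∀ s : ℝ, (fun x => s * l x) ∈ Pol 1 := fun s => Submodule.smul_mem _ s hl
  have hv := Pol_fderiv hh v
  have hc : ∀ x, Continuous fun s : ℝ => fderiv ℝ h (x - (s * l x) • v) v := fun x =>
    (Pol_contDiff hv).continuous.comp (by fun_prop)
  -- The quotient is the mean of the derivative in direction `v` over the segment from x - l(x) v to
  -- x; the fundamental theorem of calculus gives h(x) - h(x - l(x) v) = l(x) q(x). Polynomiality of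
  -- `q` does not depend on where `h` vanishes.
  refine ⟨fun x => ∫ s in (0 : ℝ)..1, fderiv ℝ h (x - (s * l x) • v) v,
    integral_mem_of_finiteDimensional (Pol (m - 1))
      (fun s x => fderiv ℝ h (x - (s * l x) • v) v)
      (fun s => Pol_comp_coord hv (hl' s) v) hc 0 1, fun x hx => ?_⟩
  have hd : ∀ s ∈ Set.uIcc (0 : ℝ) 1, HasDerivAt (fun s : ℝ => h (x - (s * l x) • v))
      (-(l x * fderiv ℝ h (x - (s * l x) • v) v)) s := by
    intro s _
    have h1 : HasDerivAt (fun s : ℝ => x - (s * l x) • v) (-(l x • v)) s := by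
      simpa using (((hasDerivAt_id s).mul_const (l x)).smul_const v).const_sub x
    have h2 := ((hs.differentiable (by simp)) (x - (s * l x) • v)).hasFDerivAt.comp_hasDerivAt s h1
    refine h2.congr_deriv ?_
    simp
  have h := intervalIntegral.integral_eq_sub_of_hasDerivAt hd
    (((hc x).const_mul (l x)).neg.intervalIntegrable _ _)
  rw [intervalIntegral.integral_neg, intervalIntegral.integral_const_mul] at h
  simp only [one_mul, zero_mul, zero_smul, sub_zero, hx] at h
  linarith

/-! ### The reference simplex -/

/-- The reference simplex of dimension `d`. -/
def refS (d : ℕ) : Set (Fin d → ℝ) := {y | (∀ i, 0 ≤ y i) ∧ ∑ i, y i ≤ 1}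

theorem refS_isCompact (d : ℕ) : IsCompact (refS d) := by
  have hc : IsClosed (refS d) := by
    have h1 : IsClosed {y : Fin d → ℝ | ∀ i, 0 ≤ y i} := by
      simp only [Set.ofPred_forall]
      exact isClosed_iInter fun i => isClosed_le continuous_const (continuous_apply i)
    exact h1.inter (isClosed_le (f := fun y : Fin d → ℝ => ∑ i, y i) (by fun_prop) continuous_const)
  refine (isCompact_Icc (a := (0 : Fin d → ℝ)) (b := 1)).of_isClosed_subset hc ?_
  rintro y ⟨h0, h1⟩
  refine ⟨fun i => h0 i, fun i => ?_⟩
  exact (Finset.single_le_sum (fun j _ => h0 j) (Finset.mem_univ i)).trans h1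

theorem refS_measurableSet (d : ℕ) : MeasurableSet (refS d) := (refS_isCompact d).measurableSet

theorem refS_convex (d : ℕ) : Convex ℝ (refS d) := by
  rintro x ⟨hx, hx'⟩ y ⟨hy, hy'⟩ a b ha hb hab
  refine ⟨fun i => ?_, ?_⟩
  · simp only [Pi.add_apply, Pi.smul_apply, smul_eq_mul]
    have := hx i; have := hy i; positivity
  · simp only [Pi.add_apply, Pi.smul_apply, smul_eq_mul, Finset.sum_add_distrib, ← Finset.mul_sum]
    nlinarith

theorem refS_interior_nonempty (d : ℕ) : (interior (refS d)).Nonempty := by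
  have ho : IsOpen {y : Fin d → ℝ | (∀ i, 0 < y i) ∧ ∑ i, y i < 1} := by
    have h1 : IsOpen {y : Fin d → ℝ | ∀ i, 0 < y i} := by
      simp only [Set.ofPred_forall]
      exact isOpen_iInter_of_finite fun i => isOpen_lt continuous_const (continuous_apply i)
    exact h1.inter (isOpen_lt (f := fun y : Fin d → ℝ => ∑ i, y i) (by fun_prop) continuous_const)
  refine ⟨fun _ => 1 / ((d : ℝ) + 1), interior_maximal ?_ ho ⟨fun i => by positivity, ?_⟩⟩
  · rintro y ⟨h0, h1⟩
    exact ⟨fun i => (h0 i).le, h1.le⟩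
  · simp only [Finset.sum_const, Finset.card_univ, Fintype.card_fin, nsmul_eq_mul]
    rw [mul_one_div, div_lt_one (by positivity)]
    linarith

theorem refS_subset_closure_interior (d : ℕ) : refS d ⊆ closure (interior (refS d)) := by
  rw [(refS_convex d).closure_interior_eq_closure_of_nonempty_interior (refS_interior_nonempty d)]
  exact subset_closure

theorem refS_volume_pos (d : ℕ) : 0 < volume.real (refS d) := by
  refine ENNReal.toReal_pos ?_ (refS_isCompact d).measure_lt_top.ne
  have h := isOpen_interior.measure_pos (volume : Measure (Fin d → ℝ)) (refS_interior_nonempty d)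
  exact (h.trans_le (measure_mono interior_subset)).ne'

/-- The function vanishes almost everywhere, hence on the interior by continuity, hence on the
closed simplex because the interior is dense in it. -/
theorem eqOn_zero_of_setIntegral_refS_eq_zero {d : ℕ} {h : (Fin d → ℝ) → ℝ} (hc : Continuous h)
    (h0 : ∀ y ∈ refS d, 0 ≤ h y) (hi : ∫ y in refS d, h y = 0) : ∀ y ∈ refS d, h y = 0 := by
  have hint : IntegrableOn h (refS d) := hc.continuousOn.integrableOn_compact (refS_isCompact d)
  have hae : h =ᵐ[volume.restrict (refS d)] 0 := by
    rw [← setIntegral_eq_zero_iff_of_nonneg_ae _ hint]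
    · exact hi
    · exact (ae_restrict_iff' (refS_measurableSet d)).2 (Filter.Eventually.of_forall h0)
  have hae' : h =ᵐ[volume.restrict (interior (refS d))] 0 :=
    ae_restrict_of_ae_restrict_of_subset interior_subset hae
  have h1 : Set.EqOn h 0 (interior (refS d)) :=
    Measure.eqOn_open_of_ae_eq hae' isOpen_interior hc.continuousOn continuousOn_const
  have h2 := h1.closure hc continuous_const
  exact fun y hy => h2 (refS_subset_closure_interior d hy)

theorem cons_mem_refS {d : ℕ} {t : ℝ} {z : Fin d → ℝ} :
    (Fin.cons t z : Fin (d + 1) → ℝ) ∈ refS (d + 1) ↔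
      z ∈ refS d ∧ t ∈ Set.Icc 0 (1 - ∑ i, z i) := by
  simp only [refS, Set.mem_ofPred_eq, Fin.forall_fin_succ, Fin.cons_zero, Fin.cons_succ,
    Fin.sum_univ_succ, Set.mem_Icc]
  constructor
  · rintro ⟨⟨h1, h2⟩, h3⟩
    exact ⟨⟨h2, by linarith⟩, h1, by linarith⟩
  · rintro ⟨⟨h1, h2⟩, h3, h4⟩
    exact ⟨⟨h3, h1⟩, by linarith⟩

/-- This is Fubini in the first coordinate: the fibre of the simplex over `z` is the interval from 0
to 1 - ∑ z i. -/
theorem setIntegral_refS_succ {d : ℕ} {h : (Fin (d + 1) → ℝ) → ℝ} (hc : Continuous h) :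
    ∫ y in refS (d + 1), h y =
      ∫ z in refS d, ∫ t in (0 : ℝ)..(1 - ∑ i, z i), h (Fin.cons t z) := by
  have hint : Integrable ((refS (d + 1)).indicator h) :=
    (hc.continuousOn.integrableOn_compact (refS_isCompact _)).integrable_indicator
      (refS_measurableSet _)
  have hmp := (volume_preserving_piFinSuccAbove (fun _ : Fin (d + 1) => ℝ) 0).symm
  have he : ∀ p : ℝ × (Fin d → ℝ), (MeasurableEquiv.piFinSuccAbove (fun _ : Fin (d + 1) => ℝ) 0).symm
      p = (Fin.cons p.1 p.2 : Fin (d + 1) → ℝ) := fun p => by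
    show (Fin.insertNth 0 p.1 p.2 : Fin (d + 1) → ℝ) = _
    rw [Fin.insertNth_zero']
  rw [← integral_indicator (refS_measurableSet _), ← hmp.integral_comp'
    (g := (refS (d + 1)).indicator h)]
  have hint' : Integrable (fun p : ℝ × (Fin d → ℝ) =>
      (refS (d + 1)).indicator h (Fin.cons p.1 p.2)) (volume.prod volume) := by
    have := (hmp.integrable_comp_emb (MeasurableEquiv.measurableEmbedding _)).2 hint
    simp only [Function.comp_def, he] at this
    exact this
  simp only [he]
  rw [← integral_indicator (refS_measurableSet _), Measure.volume_eq_prod,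
    integral_prod_symm _ hint']
  congr 1
  funext z
  by_cases hz : z ∈ refS d
  · rw [Set.indicator_of_mem hz, intervalIntegral.integral_of_le (by linarith [hz.2]),
      ← integral_Icc_eq_integral_Ioc, ← integral_indicator measurableSet_Icc]
    congr 1
    funext t
    by_cases ht : t ∈ Set.Icc 0 (1 - ∑ i, z i)
    · rw [Set.indicator_of_mem ht, Set.indicator_of_mem (cons_mem_refS.2 ⟨hz, ht⟩)]
    · rw [Set.indicator_of_notMem ht, Set.indicator_of_notMem fun h' => ht (cons_mem_refS.1 h').2]
  · rw [Set.indicator_of_notMem hz]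
    have : ∀ t : ℝ, (refS (d + 1)).indicator h (Fin.cons t z) = 0 := fun t =>
      Set.indicator_of_notMem (fun h' => hz (cons_mem_refS.1 h').1) _
    simp [this]

theorem volume_refS_zero : volume.real (refS 0) = 1 := by
  have : refS 0 = Set.univ := by ext y; simp [refS]
  rw [this]; simp [Measure.real, volume_pi]

theorem setIntegral_refS_one {h : (Fin 1 → ℝ) → ℝ} (hc : Continuous h) :
    ∫ y in refS 1, h y = ∫ t in (0 : ℝ)..1, h fun _ => t := by
  rw [setIntegral_refS_succ hc]
  have e : ∀ z : Fin 0 → ℝ, (∫ t in (0 : ℝ)..(1 - ∑ i, z i), h (Fin.cons t z)) =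
      ∫ t in (0 : ℝ)..1, h fun _ => t := by
    intro z
    simp only [Finset.univ_eq_empty, Finset.sum_empty, sub_zero]
    congr 1
    funext t
    congr 1
    funext i
    have hi : i = 0 := Fin.fin_one_eq_zero i
    rw [hi, Fin.cons_zero]
  simp only [e, setIntegral_const, volume_refS_zero, one_smul]

theorem volume_refS_one : volume.real (refS 1) = 1 := by
  have := setIntegral_refS_one (h := fun _ => 1) continuous_const
  simpa using this

theorem volume_refS_two : volume.real (refS 2) = 1 / 2 := by
  have h := setIntegral_refS_succ (d := 1) (h := fun _ => 1) continuous_const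
  have h2 := setIntegral_refS_one (h := fun z => 1 - ∑ i, z i) (by fun_prop)
  simp only [intervalIntegral.integral_const, smul_eq_mul, mul_one, sub_zero] at h
  rw [h2] at h
  simp only [Finset.univ_unique, Finset.sum_singleton, setIntegral_const, smul_eq_mul,
    mul_one] at h
  rw [h, intervalIntegral.integral_sub (by simp) (by simp)]
  norm_num

/-! ### Parametrization of simplices -/

/-- The affine parametrization of the simplex with vertices `v`. -/
noncomputable def param {d : ℕ} (v : Fin (d + 1) → E3) (y : Fin d → ℝ) : E3 :=
  v 0 + ∑ i, y i • (v i.succ - v 0)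

theorem param_continuous {d : ℕ} (v : Fin (d + 1) → E3) : Continuous (param v) := by
  unfold param; fun_prop

theorem param_cons_zero {d : ℕ} (a b : E3) (v : Fin d → E3) (z : Fin d → ℝ) :
    param (Fin.cons a (Fin.cons b v : Fin (d + 1) → E3)) (Fin.cons 0 z) =
      param (Fin.cons a v) z := by
  simp [param, Fin.sum_univ_succ]

theorem param_cons_one_sub {d : ℕ} (a b : E3) (v : Fin d → E3) (z : Fin d → ℝ) :
    param (Fin.cons a (Fin.cons b v : Fin (d + 1) → E3)) (Fin.cons (1 - ∑ i, z i) z) =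
      param (Fin.cons b v) z := by
  simp only [param, Fin.sum_univ_succ, Fin.cons_zero, Fin.cons_succ, smul_sub,
    Finset.sum_sub_distrib, ← Finset.sum_smul, sub_smul, one_smul]
  module

/-- The first coordinate moves the point in direction `b - a`, so the fundamental theorem of
calculus applies on every fibre. Its two ends parametrize the facets opposite to `a` and to `b`. -/
theorem setIntegral_refS_fderiv {d : ℕ} {G : E3 → ℝ} (hG : ContDiff ℝ ∞ G) (a b : E3)
    (v : Fin d → E3) :
    ∫ y in refS (d + 1), fderiv ℝ G (param (Fin.cons a (Fin.cons b v : Fin (d + 1) → E3)) y) (b - a)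
      = (∫ z in refS d, G (param (Fin.cons b v) z)) - ∫ z in refS d, G (param (Fin.cons a v) z) := by
  have hc : Continuous fun y => fderiv ℝ G (param (Fin.cons a (Fin.cons b v : Fin (d + 1) → E3)) y)
      (b - a) := (contDiff_fderiv_apply hG (b - a)).continuous.comp (param_continuous _)
  have hi : ∀ w : Fin (d + 1) → E3, IntegrableOn (fun z => G (param w z)) (refS d) := fun w =>
    (hG.continuous.comp (param_continuous w)).continuousOn.integrableOn_compact (refS_isCompact d)
  rw [setIntegral_refS_succ hc, ← integral_sub (hi _) (hi _)]
  refine setIntegral_congr_fun (refS_measurableSet d) fun z _ => ?_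
  rw [← param_cons_zero a b v z, ← param_cons_one_sub a b v z]
  refine intervalIntegral.integral_eq_sub_of_hasDerivAt
    (f := fun t => G (param (Fin.cons a (Fin.cons b v : Fin (d + 1) → E3)) (Fin.cons t z)))
    (fun t _ => ?_) (Continuous.intervalIntegrable ?_ _ _)
  · have h1 : HasDerivAt (fun t : ℝ => param (Fin.cons a (Fin.cons b v : Fin (d + 1) → E3))
        (Fin.cons t z)) (b - a) t := by
      have e : (fun t : ℝ => param (Fin.cons a (Fin.cons b v : Fin (d + 1) → E3)) (Fin.cons t z)) =
          fun t => (a + t • (b - a)) + ∑ i, z i • (v i - a) := by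
        funext t
        simp [param, Fin.sum_univ_succ, add_assoc]
      rw [e]
      simpa using (((hasDerivAt_id t).smul_const (b - a)).const_add a).add_const
        (∑ i, z i • (v i - a))
    exact ((hG.differentiable (by simp)) _).hasFDerivAt.comp_hasDerivAt t h1
  · exact hc.comp (by fun_prop)

/-- The linear part of the parametrization of a simplex. -/
noncomputable def paramLin {d : ℕ} (v : Fin (d + 1) → E3) : EuclideanSpace ℝ (Fin d) →ₗ[ℝ] E3 where
  toFun y := ∑ i, y i • (v i.succ - v 0)
  map_add' x y := by simp [add_smul, Finset.sum_add_distrib]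
  map_smul' c y := by simp [mul_smul, Finset.smul_sum]

theorem hausdorffMeasure_image_param {d : ℕ} (v : Fin (d + 1) → E3) (A : Set (Fin d → ℝ)) :
    μHE[d] (param v '' A) = ENNReal.ofReal (paramLin v).normDet * volume A := by
  have e : param v '' A = (fun x => v 0 + x) '' (paramLin v '' (WithLp.toLp 2 '' A)) := by
    rw [Set.image_image, Set.image_image]; rfl
  have h := (paramLin v).euclideanHausdorffMeasure_image_eq_normDet_mul_volume (WithLp.toLp 2 '' A)
  rw [finrank_euclideanSpace_fin] at h
  rw [e, (isometry_add_left (v 0)).euclideanHausdorffMeasure_image, h]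
  congr 1
  have h2 := (EuclideanSpace.volume_preserving_symm_measurableEquiv_toLp (Fin d)).measure_preimage_equiv A
  rw [← h2]
  congr 1
  ext y
  constructor
  · rintro ⟨z, hz, rfl⟩; exact hz
  · intro hy; exact ⟨_, hy, rfl⟩

section Geometry

variable (T : Tet)

theorem coord_param {d : ℕ} (σ : Fin (d + 1) → Fin 4) (y : Fin d → ℝ) (j : Fin 4) :
    T.coord j (param (T ∘ σ) y) = (1 - ∑ i, y i) * (if j = σ 0 then 1 else 0) +
      ∑ i, y i * (if j = σ i.succ then 1 else 0) := by
  have h := coord_sub T j (param (T ∘ σ) y) (T (σ 0))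
  rw [coord_vertex, sub_eq_iff_eq_add] at h
  rw [h, param]
  simp only [Function.comp_apply, add_sub_cancel_left, inner_sum, real_inner_smul_right,
    inner_gradBary_sub, mul_sub, Finset.sum_sub_distrib, ← Finset.sum_mul]
  ring

theorem param_injective {d : ℕ} {σ : Fin (d + 1) → Fin 4} (hσ : Function.Injective σ) :
    Function.Injective (param (T ∘ σ)) := by
  intro y z h
  funext k
  have hy := coord_param T σ y (σ k.succ)
  have hz := coord_param T σ z (σ k.succ)
  rw [h, hz] at hy
  simpa [hσ.eq_iff, Fin.succ_ne_zero] using hy.symm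

theorem param_image {d : ℕ} {σ : Fin (d + 1) → Fin 4} (hσ : Function.Injective σ) :
    param (T ∘ σ) '' refS d = facet T (Finset.univ.image σ) := by
  ext x
  constructor
  · rintro ⟨y, ⟨h0, h1⟩, rfl⟩
    rw [mem_facet]
    refine ⟨fun j => ?_, fun l hl => ?_⟩
    · rw [coord_param]
      refine add_nonneg (mul_nonneg (by linarith) (by split_ifs <;> norm_num))
        (Finset.sum_nonneg fun i _ => mul_nonneg (h0 i) (by split_ifs <;> norm_num))
    · have : ∀ i, l ≠ σ i := fun i h => hl (by rw [h]; simp)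
      simp [coord_param, this]
  · intro hx
    rw [mem_facet] at hx
    have hsum : ∀ f : Fin 4 → ℝ, (∀ l ∉ Finset.univ.image σ, f l = 0) →
        ∑ l, f l = ∑ i, f (σ i) := by
      intro f hf
      rw [← Finset.sum_image (s := Finset.univ) (g := σ) (f := f) (fun a _ b _ h => hσ h)]
      exact (Finset.sum_subset (Finset.subset_univ _) fun l _ hl => hf l hl).symm
    have hs1 := hsum (fun l => T.coord l x) hx.2
    rw [T.sum_coord_apply_eq_one, Fin.sum_univ_succ] at hs1
    refine ⟨fun i => T.coord (σ i.succ) x, ⟨fun i => hx.1 _, ?_⟩, ?_⟩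
    · have := hx.1 (σ 0); linarith
    · have hinj : ∀ x y : E3, (∀ j, T.coord j x = T.coord j y) → x = y := by
        intro x y h
        rw [← T.linear_combination_coord_eq_self x, ← T.linear_combination_coord_eq_self y]
        simp [h]
      refine hinj _ _ fun j => ?_
      rw [coord_param]
      by_cases hj : j ∈ Finset.univ.image σ
      · obtain ⟨k, -, rfl⟩ := Finset.mem_image.1 hj
        refine Fin.cases ?_ (fun k => ?_) k
        · simp [hσ.eq_iff, (Fin.succ_ne_zero _).symm]; linarith
        · simp [hσ.eq_iff, Fin.succ_ne_zero]
      · have : ∀ i, j ≠ σ i := fun i h => hj (by rw [h]; simp)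
        simp [this, hx.2 j hj]

theorem normDet_paramLin_pos {d : ℕ} {σ : Fin (d + 1) → Fin 4} (hσ : Function.Injective σ) :
    0 < (paramLin (T ∘ σ)).normDet := by
  refine lt_of_le_of_ne (LinearMap.normDet_nonneg _) fun h => ?_
  rw [eq_comm, LinearMap.normDet_eq_zero_iff_ker_ne_bot] at h
  apply h
  rw [LinearMap.ker_eq_bot]
  intro y z hyz
  have : param (T ∘ σ) y.ofLp = param (T ∘ σ) z.ofLp := by
    show _ + paramLin (T ∘ σ) y = _ + paramLin (T ∘ σ) z
    rw [hyz]
  exact WithLp.ofLp_injective 2 (param_injective T hσ this)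

theorem hausdorffMeasure_restrict_facet {d : ℕ} {σ : Fin (d + 1) → Fin 4}
    (hσ : Function.Injective σ) :
    (μHE[d] : Measure E3).restrict (facet T (Finset.univ.image σ)) =
      ENNReal.ofReal (paramLin (T ∘ σ)).normDet •
        Measure.map (param (T ∘ σ)) (volume.restrict (refS d)) := by
  ext B hB
  rw [Measure.restrict_apply hB, ← param_image T hσ, ← Set.image_preimage_inter,
    hausdorffMeasure_image_param, Measure.smul_apply,
    Measure.map_apply (param_continuous _).measurable hB,
    Measure.restrict_apply ((param_continuous _).measurable hB)]
  rfl

theorem map_val_hausdorffMeasure (d : ℕ) (A : Set E3) :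
    Measure.map Subtype.val (μHE[d] : Measure A) = (μHE[d] : Measure E3).restrict A := by
  rw [isometry_subtype_coe.map_euclideanHausdorffMeasure, Subtype.range_coe]

theorem lintegral_facet {d : ℕ} {σ : Fin (d + 1) → Fin 4} (hσ : Function.Injective σ)
    {s : Finset (Fin 4)} (hs : Finset.univ.image σ = s) (G : E3 → ENNReal) :
    ∫⁻ x : facet T s, G x ∂μHE[d] = ENNReal.ofReal (paramLin (T ∘ σ)).normDet *
      ∫⁻ y in refS d, G (param (T ∘ σ) y) := by
  subst hs
  have hm : MeasurableEmbedding (Subtype.val : facet T (Finset.univ.image σ) → E3) :=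
    MeasurableEmbedding.subtype_coe (facet_isCompact T _).measurableSet
  have hp := (param_continuous (T ∘ σ)).measurableEmbedding (param_injective T hσ)
  rw [← hm.lintegral_map, map_val_hausdorffMeasure, hausdorffMeasure_restrict_facet T hσ,
    lintegral_smul_measure, hp.lintegral_map]
  rfl

theorem integral_facet {d : ℕ} {σ : Fin (d + 1) → Fin 4} (hσ : Function.Injective σ)
    {s : Finset (Fin 4)} (hs : Finset.univ.image σ = s) (G : E3 → ℝ) :
    ∫ x : facet T s, G x ∂μHE[d] = (paramLin (T ∘ σ)).normDet *
      ∫ y in refS d, G (param (T ∘ σ) y) := by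
  subst hs
  have hm : MeasurableEmbedding (Subtype.val : facet T (Finset.univ.image σ) → E3) :=
    MeasurableEmbedding.subtype_coe (facet_isCompact T _).measurableSet
  have hp := (param_continuous (T ∘ σ)).measurableEmbedding (param_injective T hσ)
  rw [← hm.integral_map, map_val_hausdorffMeasure, hausdorffMeasure_restrict_facet T hσ,
    integral_smul_measure, hp.integral_map, ENNReal.toReal_ofReal (LinearMap.normDet_nonneg _)]
  rfl

theorem exists_enum {d : ℕ} {s : Finset (Fin 4)} (hs : s.card = d + 1) :
    ∃ σ : Fin (d + 1) → Fin 4, Function.Injective σ ∧ Finset.univ.image σ = s :=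
  ⟨s.orderEmbOfFin hs, (s.orderEmbOfFin hs).injective, by
    rw [← Finset.coe_inj]; simp⟩

theorem isFiniteMeasure_facet {d : ℕ} {s : Finset (Fin 4)} (hs : s.card = d + 1) :
    IsFiniteMeasure (μHE[d] : Measure (facet T s)) := by
  obtain ⟨σ, hσ, h⟩ := exists_enum hs
  constructor
  have := lintegral_facet T hσ h fun _ => 1
  rw [lintegral_one, setLIntegral_one] at this
  rw [this]
  exact ENNReal.mul_lt_top ENNReal.ofReal_lt_top (refS_isCompact d).measure_lt_top

theorem eqOn_zero_of_integral_facet_eq_zero {d : ℕ} {s : Finset (Fin 4)} (hs : s.card = d + 1)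
    {G : E3 → ℝ} (hc : Continuous G) (h0 : ∀ x ∈ facet T s, 0 ≤ G x)
    (hi : ∫ x : facet T s, G x ∂μHE[d] = 0) : ∀ x ∈ facet T s, G x = 0 := by
  obtain ⟨σ, hσ, rfl⟩ := exists_enum hs
  rw [integral_facet T hσ rfl] at hi
  have hi' := (mul_eq_zero.1 hi).resolve_left (normDet_paramLin_pos T hσ).ne'
  rw [← param_image T hσ] at *
  rintro _ ⟨y, hy, rfl⟩
  exact eqOn_zero_of_setIntegral_refS_eq_zero (hc.comp (param_continuous _))
    (fun y hy => h0 _ ⟨y, hy, rfl⟩) hi' y hy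

/-- The mean value of a function on a facet. -/
noncomputable def mean (s : Finset (Fin 4)) (G : E3 → ℝ) : ℝ :=
  ((μHE[s.card - 1] : Measure (facet T s)).real Set.univ)⁻¹ *
    ∫ x : facet T s, G x ∂μHE[s.card - 1]

theorem measure_facet {d : ℕ} {σ : Fin (d + 1) → Fin 4} (hσ : Function.Injective σ)
    {s : Finset (Fin 4)} (hs : Finset.univ.image σ = s) :
    (μHE[d] : Measure (facet T s)).real Set.univ =
      (paramLin (T ∘ σ)).normDet * volume.real (refS d) := by
  have := integral_facet T hσ hs fun _ => 1
  simpa using this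

theorem card_of_image {d : ℕ} {σ : Fin (d + 1) → Fin 4} (hσ : Function.Injective σ)
    {s : Finset (Fin 4)} (hs : Finset.univ.image σ = s) : s.card = d + 1 := by
  rw [← hs, Finset.card_image_of_injective _ hσ]; simp

theorem measure_facet_pos {d : ℕ} {s : Finset (Fin 4)} (hs : s.card = d + 1) :
    0 < (μHE[d] : Measure (facet T s)).real Set.univ := by
  obtain ⟨σ, hσ, h⟩ := exists_enum hs
  rw [measure_facet T hσ h]
  exact mul_pos (normDet_paramLin_pos T hσ) (refS_volume_pos d)

theorem integral_facet_eq_mean {d : ℕ} {s : Finset (Fin 4)} (hs : s.card = d + 1) (G : E3 → ℝ) :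
    ∫ x : facet T s, G x ∂μHE[d] = (μHE[d] : Measure (facet T s)).real Set.univ * mean T s G := by
  rw [mean, hs, Nat.add_sub_cancel, mul_inv_cancel_left₀ (measure_facet_pos T hs).ne']

/-- The constant Jacobian cancels in the mean value. Integration by parts, written with means,
therefore involves only volumes of reference simplices. -/
theorem mean_eq {d : ℕ} {σ : Fin (d + 1) → Fin 4} (hσ : Function.Injective σ)
    {s : Finset (Fin 4)} (hs : Finset.univ.image σ = s) (G : E3 → ℝ) :
    mean T s G = (volume.real (refS d))⁻¹ * ∫ y in refS d, G (param (T ∘ σ) y) := by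
  rw [mean, card_of_image hσ hs, Nat.add_sub_cancel, integral_facet T hσ hs,
    measure_facet T hσ hs, mul_inv]
  have := (normDet_paramLin_pos T hσ).ne'
  field_simp

theorem mean_congr {s : Finset (Fin 4)} {G H : E3 → ℝ} (h : ∀ x ∈ facet T s, G x = H x) :
    mean T s G = mean T s H := by
  unfold mean
  congr 2
  funext x
  exact h x x.2

theorem mean_add {s : Finset (Fin 4)} (hs : s.Nonempty) {G H : E3 → ℝ} (hG : Continuous G)
    (hH : Continuous H) : mean T s (fun x => G x + H x) = mean T s G + mean T s H := by
  obtain ⟨d, hd⟩ := Nat.exists_eq_succ_of_ne_zero (Finset.card_ne_zero.2 hs)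
  obtain ⟨σ, hσ, rfl⟩ := exists_enum hd
  rw [mean_eq T hσ rfl, mean_eq T hσ rfl, mean_eq T hσ rfl, ← mul_add, integral_add]
  · exact (hG.comp (param_continuous _)).continuousOn.integrableOn_compact (refS_isCompact d)
  · exact (hH.comp (param_continuous _)).continuousOn.integrableOn_compact (refS_isCompact d)

theorem mean_const_mul {s : Finset (Fin 4)} (c : ℝ) (G : E3 → ℝ) :
    mean T s (fun x => c * G x) = c * mean T s G := by
  unfold mean
  rw [integral_const_mul]; ring

theorem mean_sum {s : Finset (Fin 4)} (hs : s.Nonempty) {ι : Type*} (t : Finset ι)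
    {G : ι → E3 → ℝ} (hG : ∀ i, Continuous (G i)) :
    mean T s (fun x => ∑ i ∈ t, G i x) = ∑ i ∈ t, mean T s (G i) := by
  classical
  induction t using Finset.induction_on with
  | empty => simpa using mean_const_mul T (s := s) 0 fun _ => 0
  | insert a t ha ih =>
    simp only [Finset.sum_insert ha]
    rw [mean_add T hs (hG a) (continuous_finsetSum _ fun i _ => hG i), ih]

/-- Integration by parts on a facet, for derivatives along its edges. -/
theorem mean_fderiv {d : ℕ} {s : Finset (Fin 4)} (hs : s.card = d + 2) {j k : Fin 4} (hj : j ∈ s)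
    (hk : k ∈ s) (hjk : j ≠ k) {G : E3 → ℝ} (hG : ContDiff ℝ ∞ G) :
    mean T s (fun x => fderiv ℝ G x (T k - T j)) =
      volume.real (refS d) / volume.real (refS (d + 1)) *
        (mean T (s.erase j) G - mean T (s.erase k) G) := by
  have hc : ((s.erase j).erase k).card = d := by
    rw [Finset.card_erase_of_mem (Finset.mem_erase.2 ⟨hjk.symm, hk⟩), Finset.card_erase_of_mem hj, hs]
    rfl
  -- The vertices are enumerated with `j` and `k` in front, so that the first coordinate of the
  -- parametrization runs along the edge from `j` to `k`.
  let τ : Fin d → Fin 4 := ((s.erase j).erase k).orderEmbOfFin hc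
  have hτ : Function.Injective τ := (((s.erase j).erase k).orderEmbOfFin hc).injective
  have hτi : ∀ i, i ∈ Set.range τ ↔ i ∈ (s.erase j).erase k := fun i => by
    rw [Finset.range_orderEmbOfFin]; rfl
  have hjτ : j ∉ Set.range τ := by rw [hτi]; simp
  have hkτ : k ∉ Set.range τ := by rw [hτi]; simp
  have hσk : Function.Injective (Fin.cons k τ : Fin (d + 1) → Fin 4) :=
    Fin.cons_injective_iff.2 ⟨hkτ, hτ⟩
  have hσj : Function.Injective (Fin.cons j τ : Fin (d + 1) → Fin 4) :=
    Fin.cons_injective_iff.2 ⟨hjτ, hτ⟩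
  have hσ : Function.Injective (Fin.cons j (Fin.cons k τ : Fin (d + 1) → Fin 4) :
      Fin (d + 2) → Fin 4) := by
    refine Fin.cons_injective_iff.2 ⟨?_, hσk⟩
    rw [Fin.range_cons]
    rintro (h | h)
    · exact hjk h
    · exact hjτ h
  have ik : Finset.univ.image (Fin.cons k τ : Fin (d + 1) → Fin 4) = s.erase j := by
    rw [← Finset.coe_inj]
    simp only [Finset.coe_image, Finset.coe_univ, Set.image_univ, Fin.range_cons]
    ext i
    rw [Set.mem_insert_iff, hτi]
    simp only [Finset.mem_erase, SetLike.mem_coe]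
    by_cases h : i = k
    · subst h; simp [hk, hjk.symm]
    · simp [h]
  have ij : Finset.univ.image (Fin.cons j τ : Fin (d + 1) → Fin 4) = s.erase k := by
    rw [← Finset.coe_inj]
    simp only [Finset.coe_image, Finset.coe_univ, Set.image_univ, Fin.range_cons]
    ext i
    rw [Set.mem_insert_iff, hτi]
    simp only [Finset.mem_erase, SetLike.mem_coe]
    by_cases h : i = j
    · subst h; simp [hj, hjk]
    · simp [h]
  have is : Finset.univ.image (Fin.cons j (Fin.cons k τ : Fin (d + 1) → Fin 4) :
      Fin (d + 2) → Fin 4) = s := by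
    have h : Set.range (Fin.cons k τ : Fin (d + 1) → Fin 4) = s.erase j := by
      rw [← ik]; simp
    rw [← Finset.coe_inj]
    simp only [Finset.coe_image, Finset.coe_univ, Set.image_univ]
    rw [Fin.range_cons, h, ← Finset.coe_insert, Finset.insert_erase hj]
  have c1 : ∀ {n : ℕ} (a : Fin 4) (w : Fin n → Fin 4),
      T ∘ (Fin.cons a w : Fin (n + 1) → Fin 4) = Fin.cons (T a) (T ∘ w) := by
    intro n a w
    funext i
    refine Fin.cases rfl (fun i => rfl) i
  rw [mean_eq T hσ is, mean_eq T hσk ik, mean_eq T hσj ij, c1, c1, c1,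
    setIntegral_refS_fderiv hG]
  have := (refS_volume_pos d).ne'
  have := (refS_volume_pos (d + 1)).ne'
  field_simp

end Geometry

section Geometry

variable (T : Tet)

/-! ### The divergence theorem and the theorem of Stokes -/

/-- The trace is evaluated with barycentric gradients and vertices. Since the gradients sum to zero,
the vertex `j` can be subtracted, which leaves derivatives along edges as needed for `mean_fderiv`.
-/
theorem gdiv_eq_sum {V : E3 → E3} (hV : Differentiable ℝ V) (j : Fin 4) (x : E3) :
    gdiv V x = ∑ l, fderiv ℝ (fun y => inner ℝ (gradBary T l) (V y)) x (T l - T j) := by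
  have h : ∀ l w, fderiv ℝ (fun y => inner ℝ (gradBary T l) (V y)) x w =
      inner ℝ (gradBary T l) (fderiv ℝ V x w) := by
    intro l w
    have h := (innerSL ℝ (gradBary T l)).hasFDerivAt.comp x (hV x).hasFDerivAt
    have e : (innerSL ℝ (gradBary T l)) ∘ V = fun y => inner ℝ (gradBary T l) (V y) := rfl
    rw [e] at h
    rw [h.fderiv]; rfl
  simp_rw [h, map_sub, inner_sub_right, Finset.sum_sub_distrib]
  rw [sum_inner_gradBary, sub_zero]
  exact tr_eq_sum _ _ (eq_sum_inner_gradBary T) _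

/-- The divergence theorem on a facet, for fields tangential to it. -/
theorem mean_gdiv {d : ℕ} {s : Finset (Fin 4)} (hs : s.card = d + 2) {V : E3 → E3}
    (hV : ContDiff ℝ ∞ V) (ht : ∀ l ∉ s, ∀ x, inner ℝ (gradBary T l) (V x) = 0) :
    mean T s (gdiv V) = -(volume.real (refS d) / volume.real (refS (d + 1)) *
      ∑ l ∈ s, mean T (s.erase l) fun x => inner ℝ (gradBary T l) (V x)) := by
  have hne : s.Nonempty := Finset.card_pos.1 (by omega)
  obtain ⟨j, hj⟩ := hne
  have hd : ∀ l, ContDiff ℝ ∞ fun x => inner ℝ (gradBary T l) (V x) := fun l =>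
    contDiff_const.inner ℝ hV
  have e : gdiv V = fun x => ∑ l ∈ s, fderiv ℝ (fun y => inner ℝ (gradBary T l) (V y)) x
      (T l - T j) := by
    funext x
    rw [gdiv_eq_sum T (hV.differentiable (by simp)) j]
    refine (Finset.sum_subset (Finset.subset_univ s) fun l _ hl => ?_).symm
    simp [ht l hl]
  have hsum : ∀ x, ∑ l ∈ s, inner ℝ (gradBary T l) (V x) = 0 := fun x => by
    rw [← sum_inner_gradBary T (V x)]
    exact Finset.sum_subset (Finset.subset_univ s) fun l _ hl => ht l hl x
  rw [e, mean_sum T ⟨j, hj⟩ s fun l => (contDiff_fderiv_apply (hd l) _).continuous]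
  have hl : ∀ l ∈ s, mean T s (fun x => fderiv ℝ (fun y => inner ℝ (gradBary T l) (V y)) x
      (T l - T j)) = volume.real (refS d) / volume.real (refS (d + 1)) *
        (mean T (s.erase j) (fun x => inner ℝ (gradBary T l) (V x)) -
          mean T (s.erase l) fun x => inner ℝ (gradBary T l) (V x)) := by
    intro l hl
    by_cases h : j = l
    · subst h
      simpa using mean_const_mul T (s := s) 0 fun _ => 0
    · exact mean_fderiv T hs hj hl h (hd l)
  have hne' : (s.erase j).Nonempty := by
    rw [← Finset.card_pos, Finset.card_erase_of_mem hj]; omega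
  -- The terms on the facet opposite to `j` combine to the mean of the sum of all barycentric
  -- components of `V`, which is zero; each `l` keeps only its own facet.
  rw [Finset.sum_congr rfl hl, ← Finset.mul_sum, Finset.sum_sub_distrib,
    ← mean_sum T hne' s fun l => (hd l).continuous]
  simp_rw [hsum]
  have h0 : mean T (s.erase j) (fun _ => 0) = 0 := by
    simpa using mean_const_mul T (s := s.erase j) 0 fun _ => 0
  rw [h0]; ring

theorem card_face (i : Fin 4) : ({i}ᶜ : Finset (Fin 4)).card = 2 + 1 := by
  rw [Finset.card_compl]; simp

theorem card_verts (e : Edge) : e.verts.card = 1 + 1 := by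
  rw [Edge.verts, Finset.card_pair (ne_of_lt e.2)]

/-- The scalar product of the curl with a cross product is a difference of derivatives of tangential
components along two edges, and `mean_fderiv` integrates each of them. The factor 2 is the ratio of
the volumes of the reference segment and the reference triangle. -/
theorem mean_inner_gcurl {j k l : Fin 4} (hjk : j ≠ k) (hjl : j ≠ l) (hkl : k ≠ l) {U : E3 → E3}
    (hU : ContDiff ℝ ∞ U) :
    mean T {j, k, l} (fun x => inner ℝ (gcurl U x) (cross (T k - T j) (T l - T j))) =
      2 * (mean T {k, l} (fun x => inner ℝ (U x) (T l - T k)) -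
        mean T {j, l} (fun x => inner ℝ (U x) (T l - T j)) +
        mean T {j, k} (fun x => inner ℝ (U x) (T k - T j))) := by
  have hd : ∀ w, ContDiff ℝ ∞ fun x => inner ℝ (U x) w := fun w => hU.inner ℝ contDiff_const
  have hf : ∀ x w z, inner ℝ (fderiv ℝ U x w) z = fderiv ℝ (fun y => inner ℝ (U y) z) x w := by
    intro x w z
    rw [fderiv_inner_apply ℝ (hU.differentiable (by simp) x) (differentiableAt_const z)]
    simp
  have hs : ({j, k, l} : Finset (Fin 4)).card = 1 + 2 := by
    rw [Finset.card_eq_three.2 ⟨j, k, l, hjk, hjl, hkl, rfl⟩]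
  have ej : ({j, k, l} : Finset (Fin 4)).erase j = {k, l} := by
    rw [Finset.erase_insert]; simp [hjk, hjl]
  have ek : ({j, k, l} : Finset (Fin 4)).erase k = {j, l} := by
    rw [Finset.insert_comm, Finset.erase_insert]; simp [hjk.symm, hkl]
  have el : ({j, k, l} : Finset (Fin 4)).erase l = {j, k} := by
    ext i; simp only [Finset.mem_erase, Finset.mem_insert, Finset.mem_singleton]
    constructor
    · rintro ⟨h1, h2 | h2 | h2⟩
      · exact Or.inl h2
      · exact Or.inr h2
      · exact absurd h2 h1
    · rintro (rfl | rfl)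
      · exact ⟨hjl, Or.inl rfl⟩
      · exact ⟨hkl, Or.inr (Or.inl rfl)⟩
  have hr : volume.real (refS 1) / volume.real (refS (1 + 1)) = 2 := by
    rw [volume_refS_one, volume_refS_two]; norm_num
  have hk := mean_fderiv T hs (j := j) (k := k) (by simp) (by simp) hjk (hd (T l - T j))
  have hl := mean_fderiv T hs (j := j) (k := l) (by simp) (by simp) hjl (hd (T k - T j))
  rw [ej, ek, hr] at hk
  rw [ej, el, hr] at hl
  have e : (fun x => inner ℝ (gcurl U x) (cross (T k - T j) (T l - T j))) = fun x =>
      fderiv ℝ (fun y => inner ℝ (U y) (T l - T j)) x (T k - T j) +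
        (-1) * fderiv ℝ (fun y => inner ℝ (U y) (T k - T j)) x (T l - T j) := by
    funext x
    rw [inner_gcurl_cross, hf, hf]; ring
  have e2 : (fun x => inner ℝ (U x) (T l - T k)) = fun x => inner ℝ (U x) (T l - T j) +
      (-1) * inner ℝ (U x) (T k - T j) := by
    funext x
    rw [show T l - T k = (T l - T j) - (T k - T j) by abel, inner_sub_right]; ring
  have c1 := (contDiff_fderiv_apply (hd (T l - T j)) (T k - T j)).continuous
  have c2 := (contDiff_fderiv_apply (hd (T k - T j)) (T l - T j)).continuous
  have c2' : Continuous fun x => (-1 : ℝ) * fderiv ℝ (fun y => inner ℝ (U y) (T k - T j)) x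
      (T l - T j) := continuous_const.mul c2
  have c3 : Continuous fun x => (-1 : ℝ) * inner ℝ (U x) (T k - T j) :=
    continuous_const.mul (hd _).continuous
  rw [e, mean_add T (by simp) c1 c2', mean_const_mul, hk, hl, e2,
    mean_add T (by simp) (hd _).continuous c3, mean_const_mul]
  ring

/-! ### Lengths, areas and fluxes -/

/-- Twice the area of the face `i`, times a unit normal vector. -/
noncomputable def areaVec (i : Fin 4) : E3 :=
  cross (T (i.succAbove 1) - T (i.succAbove 0)) (T (i.succAbove 2) - T (i.succAbove 0))

theorem measure_face (i : Fin 4) :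
    (μHE[2] : Measure (face T i)).real Set.univ = ‖areaVec T i‖ / 2 := by
  have hs : Finset.univ.image (i.succAbove : Fin 3 → Fin 4) = {i}ᶜ := Fin.image_succAbove_univ i
  rw [measure_facet T i.succAbove_right_injective hs, volume_refS_two]
  have h := LinearMap.normDet_sq_eq_det_gram (paramLin (T ∘ i.succAbove))
    (EuclideanSpace.basisFun (Fin 2) ℝ)
  have hb0 : paramLin (T ∘ i.succAbove) (EuclideanSpace.basisFun (Fin 2) ℝ 0) =
      T (i.succAbove 1) - T (i.succAbove 0) := by
    simp [paramLin, Fin.sum_univ_two]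
  have hb1 : paramLin (T ∘ i.succAbove) (EuclideanSpace.basisFun (Fin 2) ℝ 1) =
      T (i.succAbove 2) - T (i.succAbove 0) := by
    simp [paramLin, Fin.sum_univ_two]
  rw [Matrix.det_fin_two] at h
  simp only [Matrix.gram_apply, hb0, hb1] at h
  have h2 : (paramLin (T ∘ i.succAbove)).normDet ^ 2 = ‖areaVec T i‖ ^ 2 := by
    rw [← real_inner_self_eq_norm_sq, areaVec, inner_cross_cross]
    exact_mod_cast h
  rw [(sq_eq_sq₀ (LinearMap.normDet_nonneg _) (norm_nonneg _)).1 h2]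
  ring

theorem measure_edge (e : Edge) :
    (μHE[1] : Measure (edge T e)).real Set.univ = ‖T e.1.2 - T e.1.1‖ := by
  have hi : Function.Injective ![e.1.1, e.1.2] := by
    intro a b
    have := ne_of_lt e.2
    fin_cases a <;> fin_cases b <;> simp [this, this.symm]
  have hs : Finset.univ.image ![e.1.1, e.1.2] = e.verts := by
    ext i; simp [Edge.verts, eq_comm]
  rw [measure_facet T hi hs, volume_refS_one]
  have h := LinearMap.normDet_sq_eq_det_gram (paramLin (T ∘ ![e.1.1, e.1.2]))
    (EuclideanSpace.basisFun (Fin 1) ℝ)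
  have hb0 : paramLin (T ∘ ![e.1.1, e.1.2]) (EuclideanSpace.basisFun (Fin 1) ℝ 0) =
      T e.1.2 - T e.1.1 := by
    simp [paramLin]
  rw [Matrix.det_fin_one] at h
  simp only [Matrix.gram_apply, hb0] at h
  rw [real_inner_self_eq_norm_sq] at h
  have h2 : (paramLin (T ∘ ![e.1.1, e.1.2])).normDet ^ 2 = ‖T e.1.2 - T e.1.1‖ ^ 2 := by
    exact_mod_cast h
  rw [(sq_eq_sq₀ (LinearMap.normDet_nonneg _) (norm_nonneg _)).1 h2, mul_one]

/-- The edge length cancels against the normalization of the tangent vector. -/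
theorem integral_traceEdge (e : Edge) (U : E3 → E3) :
    ∫ x, traceEdge T e (restrict (body T) U) x ∂μHE[1] =
      mean T e.verts fun x => inner ℝ (U x) (T e.1.2 - T e.1.1) := by
  have hne : ‖T e.1.2 - T e.1.1‖ ≠ 0 := by
    rw [norm_ne_zero_iff, sub_ne_zero]
    exact fun h => ne_of_gt e.2 (T.ind.injective h)
  rw [traceEdge_restrict]
  have h := integral_facet_eq_mean T (card_verts e) fun x => inner ℝ (U x) (tangent T e)
  simp only [restrict_apply]
  rw [h, measure_edge, ← mean_const_mul]
  congr 1
  funext x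
  rw [tangent, real_inner_smul_right, mul_inv_cancel_left₀ hne]

/-- The sign relating the orientation of the face `i` by the order of its vertices to the
orientation by its exterior normal vector. -/
noncomputable def orient (i : Fin 4) : ℝ := Real.sign (inner ℝ (areaVec T i) (normal T i))

/-- By the Binet–Cauchy identity `inner_cross_cross` and the duality of gradients and edge vectors.
Equality of the three values makes the normal component of a Whitney 2-form constant on its own
face. -/
theorem inner_cross_gradBary_areaVec (i : Fin 4) :
    inner ℝ (cross (gradBary T (i.succAbove 1)) (gradBary T (i.succAbove 2))) (areaVec T i) = 1 ∧
    inner ℝ (cross (gradBary T (i.succAbove 2)) (gradBary T (i.succAbove 0))) (areaVec T i) = 1 ∧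
    inner ℝ (cross (gradBary T (i.succAbove 0)) (gradBary T (i.succAbove 1))) (areaVec T i) = 1 := by
  simp [areaVec, inner_cross_cross, inner_gradBary_sub]

theorem areaVec_ne_zero (i : Fin 4) : areaVec T i ≠ 0 := by
  intro h
  have := (inner_cross_gradBary_areaVec T i).1
  rw [h, inner_zero_right] at this
  exact zero_ne_one this

theorem areaVec_eq (i : Fin 4) : areaVec T i = inner ℝ (areaVec T i) (normal T i) • normal T i := by
  have h1 : cross (areaVec T i) (normal T i) = 0 := by
    have h : ∀ k : Fin 3, inner ℝ (T (i.succAbove k) - T (i.succAbove 0)) (normal T i) = 0 := by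
      intro k
      rw [real_inner_comm, ← inner_gradBary_eq_zero_iff, inner_gradBary_sub]
      simp [(Fin.succAbove_ne i _).symm]
    rw [areaVec, cross_cross, h, h]
    simp
  have h2 := cross_cross (areaVec T i) (normal T i) (normal T i)
  rw [h1, cross_zero_left, inner_normal_self, one_smul] at h2
  exact (sub_eq_zero.1 h2.symm).symm

theorem orient_mul_self (i : Fin 4) : orient T i * orient T i = 1 := by
  have h : inner ℝ (areaVec T i) (normal T i) ≠ 0 := by
    intro h
    have := areaVec_eq T i
    rw [h, zero_smul] at this
    exact areaVec_ne_zero T i this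
  rcases lt_or_gt_of_ne h with h | h
  · rw [orient, Real.sign_of_neg h]; norm_num
  · rw [orient, Real.sign_of_pos h]; norm_num

theorem norm_areaVec_smul (i : Fin 4) : ‖areaVec T i‖ • normal T i = orient T i • areaVec T i := by
  have h : ‖areaVec T i‖ = |inner ℝ (areaVec T i) (normal T i)| := by
    conv_lhs => rw [areaVec_eq, norm_smul, norm_normal, mul_one, Real.norm_eq_abs]
  have h2 : |inner ℝ (areaVec T i) (normal T i)| =
      orient T i * inner ℝ (areaVec T i) (normal T i) := by
    rw [orient]
    rcases lt_trichotomy (inner ℝ (areaVec T i) (normal T i)) 0 with h | h | h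
    · rw [Real.sign_of_neg h, abs_of_neg h]; ring
    · rw [h]; simp
    · rw [Real.sign_of_pos h, abs_of_pos h, one_mul]
  rw [h, h2, mul_smul, ← areaVec_eq]

theorem integral_traceNor (i : Fin 4) (U : E3 → E3) :
    ∫ x, traceNor T i (restrict (body T) U) x ∂μHE[2] =
      orient T i / 2 * mean T {i}ᶜ fun x => inner ℝ (U x) (areaVec T i) := by
  rw [traceNor_restrict]
  have h := integral_facet_eq_mean T (card_face i) fun x => inner ℝ (U x) (normal T i)
  simp only [restrict_apply]
  rw [h, measure_face, ← mean_const_mul, ← mean_const_mul]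
  congr 1
  funext x
  have := congrArg (fun w => inner ℝ (U x) w) (norm_areaVec_smul T i)
  simp only [real_inner_smul_right] at this
  linarith

/-! ### Whitney forms -/

/-- The Whitney 1-form basis function of an edge, on all of space. -/
noncomputable def gwhitney1 (e : Edge) : E3 → E3 := fun x =>
  T.coord e.1.1 x • gradBary T e.1.2 - T.coord e.1.2 x • gradBary T e.1.1

/-- The Whitney 2-form basis function of a face, on all of space. -/
noncomputable def gwhitney2 (i : Fin 4) : E3 → E3 := fun x =>
  (2 * orient T i) • (T.coord (i.succAbove 0) x •
      cross (gradBary T (i.succAbove 1)) (gradBary T (i.succAbove 2)) +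
    T.coord (i.succAbove 1) x • cross (gradBary T (i.succAbove 2)) (gradBary T (i.succAbove 0)) +
    T.coord (i.succAbove 2) x • cross (gradBary T (i.succAbove 0)) (gradBary T (i.succAbove 1)))

theorem whitney1_eq (e : Edge) : whitney1 T e = restrict (body T) (gwhitney1 T e) := rfl

theorem whitney2_eq (i : Fin 4) : whitney2 T i = restrict (body T) (gwhitney2 T i) := rfl

theorem gwhitney1_mem (e : Edge) : gwhitney1 T e ∈ VPol 1 :=
  sub_mem (VPol_smul_const (Pol_barycentric T _) _) (VPol_smul_const (Pol_barycentric T _) _)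

theorem gcurl_gwhitney1 (e : Edge) (x : E3) :
    gcurl (gwhitney1 T e) x = (2 : ℝ) • cross (gradBary T e.1.1) (gradBary T e.1.2) := by
  have h : ∀ w, fderiv ℝ (gwhitney1 T e) x w = inner ℝ (gradBary T e.1.1) w • gradBary T e.1.2 -
      inner ℝ (gradBary T e.1.2) w • gradBary T e.1.1 := by
    intro w
    have h1 := ((hasFDerivAt_coord T e.1.1 x).smul_const (gradBary T e.1.2)).fun_sub
      ((hasFDerivAt_coord T e.1.2 x).smul_const (gradBary T e.1.1))
    have e : gwhitney1 T e = fun x => T.coord e.1.1 x • gradBary T e.1.2 -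
      T.coord e.1.2 x • gradBary T e.1.1 := rfl
    rw [e, h1.fderiv]
    simp [inner_gradBary]
  ext k
  simp only [gcurl, h, inner_unitVec_right]
  fin_cases k <;> simp [cross] <;> ring

theorem coord_sum_face {i : Fin 4} {x : E3} (hx : x ∈ face T i) :
    T.coord (i.succAbove 0) x + T.coord (i.succAbove 1) x + T.coord (i.succAbove 2) x = 1 := by
  have h := T.sum_coord_apply_eq_one x
  rw [Fin.sum_univ_succAbove _ i, ((mem_facet T).1 hx).2 i (by simp), Fin.sum_univ_three] at h
  linarith

theorem mean_const {s : Finset (Fin 4)} (hs : s.Nonempty) (c : ℝ) : mean T s (fun _ => c) = c := by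
  obtain ⟨d, hd⟩ := Nat.exists_eq_succ_of_ne_zero (Finset.card_ne_zero.2 hs)
  obtain ⟨σ, hσ, rfl⟩ := exists_enum hd
  rw [mean_eq T hσ rfl, setIntegral_const, smul_eq_mul,
    inv_mul_cancel_left₀ (refS_volume_pos d).ne']

theorem face_nonempty (i : Fin 4) : ({i}ᶜ : Finset (Fin 4)).Nonempty :=
  Finset.card_pos.1 (by rw [card_face]; norm_num)

/-- On the own face the three coefficients agree and the barycentric coordinates sum to one. On
another face, in each term either the barycentric coordinate vanishes or the cross product contains
the gradient normal to that face. -/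
theorem flux_whitney2 (i i' : Fin 4) :
    ∫ x, traceNor T i' (whitney2 T i) x ∂μHE[2] = if i = i' then 1 else 0 := by
  rw [whitney2_eq]
  split_ifs with h
  · subst h
    rw [integral_traceNor]
    have e : mean T {i}ᶜ (fun x => inner ℝ (gwhitney2 T i x) (areaVec T i)) =
        mean T {i}ᶜ fun _ => 2 * orient T i := by
      refine mean_congr T fun x hx => ?_
      obtain ⟨h1, h2, h3⟩ := inner_cross_gradBary_areaVec T i
      rw [gwhitney2]
      simp only [real_inner_smul_left, inner_add_left, h1, h2, h3, mul_one, coord_sum_face T hx]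
    rw [e, mean_const T (face_nonempty i)]
    linear_combination orient_mul_self T i
  · rw [traceNor_restrict]
    have e : ∀ x : face T i', restrict (face T i')
        (fun x => inner ℝ (gwhitney2 T i x) (normal T i')) x = 0 := by
      intro x
      obtain ⟨k, rfl⟩ := Fin.exists_succAbove_eq (Ne.symm h)
      have hx := ((mem_facet T).1 x.2).2 (i.succAbove k) (by simp)
      show inner ℝ (gwhitney2 T i x) (normal T (i.succAbove k)) = 0
      rw [real_inner_comm, ← inner_gradBary_eq_zero_iff, real_inner_comm, gwhitney2,
        real_inner_smul_left, inner_add_left, inner_add_left]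
      simp only [real_inner_smul_left]
      fin_cases k <;> simp at hx <;> simp [hx]
    simp [e]

theorem sum_edges {M : Type*} [AddCommMonoid M] (f : Edge → M) : ∑ e, f e =
    f ⟨(0, 1), by decide⟩ + f ⟨(0, 2), by decide⟩ + f ⟨(0, 3), by decide⟩ +
      f ⟨(1, 2), by decide⟩ + f ⟨(1, 3), by decide⟩ + f ⟨(2, 3), by decide⟩ := by
  have h : (Finset.univ : Finset Edge) = {⟨(0, 1), by decide⟩, ⟨(0, 2), by decide⟩,
    ⟨(0, 3), by decide⟩, ⟨(1, 2), by decide⟩, ⟨(1, 3), by decide⟩, ⟨(2, 3), by decide⟩} := by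
    decide
  rw [h]
  rw [Finset.sum_insert (by decide), Finset.sum_insert (by decide), Finset.sum_insert (by decide),
    Finset.sum_insert (by decide), Finset.sum_insert (by decide), Finset.sum_singleton]
  simp only [add_assoc]

/-- The Whitney interpolants commute with the curl. -/
theorem whitney_commute {U : E3 → E3} (hU : ContDiff ℝ ∞ U) (x : E3) :
    ∑ i : Fin 4, (∫ y, traceNor T i (restrict (body T) (gcurl U)) y ∂μHE[2]) • gwhitney2 T i x =
      ∑ e : Edge, (∫ y, traceEdge T e (restrict (body T) U) y ∂μHE[1]) •
        gcurl (gwhitney1 T e) x := by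
  -- The map `succAbove` is increasing, so `c a b` occurs below only with a < b, in agreement with
  -- the direction of the edges.
  set c : Fin 4 → Fin 4 → ℝ := fun a b => mean T {a, b} fun x => inner ℝ (U x) (T b - T a) with hc
  have he : ∀ e : Edge, ∫ y, traceEdge T e (restrict (body T) U) y ∂μHE[1] = c e.1.1 e.1.2 :=
    fun e => integral_traceEdge T e U
  have hf : ∀ i : Fin 4, (∫ y, traceNor T i (restrict (body T) (gcurl U)) y ∂μHE[2]) •
      gwhitney2 T i x = (2 * (c (i.succAbove 1) (i.succAbove 2) - c (i.succAbove 0) (i.succAbove 2) +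
        c (i.succAbove 0) (i.succAbove 1))) • (T.coord (i.succAbove 0) x •
      cross (gradBary T (i.succAbove 1)) (gradBary T (i.succAbove 2)) +
    T.coord (i.succAbove 1) x • cross (gradBary T (i.succAbove 2)) (gradBary T (i.succAbove 0)) +
    T.coord (i.succAbove 2) x • cross (gradBary T (i.succAbove 0)) (gradBary T (i.succAbove 1))) := by
    intro i
    have hs : ({i}ᶜ : Finset (Fin 4)) = {i.succAbove 0, i.succAbove 1, i.succAbove 2} := by
      revert i; decide
    rw [integral_traceNor, hs, areaVec, mean_inner_gcurl T (by simp) (by simp) (by simp) hU,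
      gwhitney2, smul_smul]
    congr 1
    simp only [hc]
    linear_combination (2 * (c (i.succAbove 1) (i.succAbove 2) - c (i.succAbove 0) (i.succAbove 2) +
        c (i.succAbove 0) (i.succAbove 1))) * orient_mul_self T i
  simp only [hf, he, gcurl_gwhitney1]
  rw [Fin.sum_univ_four, sum_edges]
  have s0 : (0 : Fin 4).succAbove 0 = 1 ∧ (0 : Fin 4).succAbove 1 = 2 ∧
    (0 : Fin 4).succAbove 2 = 3 := by decide
  have s1 : (1 : Fin 4).succAbove 0 = 0 ∧ (1 : Fin 4).succAbove 1 = 2 ∧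
    (1 : Fin 4).succAbove 2 = 3 := by decide
  have s2 : (2 : Fin 4).succAbove 0 = 0 ∧ (2 : Fin 4).succAbove 1 = 1 ∧
    (2 : Fin 4).succAbove 2 = 3 := by decide
  have s3 : (3 : Fin 4).succAbove 0 = 0 ∧ (3 : Fin 4).succAbove 1 = 1 ∧
    (3 : Fin 4).succAbove 2 = 2 := by decide
  simp only [s0.1, s0.2.1, s0.2.2, s1.1, s1.2.1, s1.2.2, s2.1, s2.2.1, s2.2.2, s3.1, s3.2.1,
    s3.2.2]
  -- With the gradient and the coordinate of index 0 eliminated, both sides are combinations of the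
  -- same three cross products.
  have hg : gradBary T 0 = -(gradBary T 1 + gradBary T 2 + gradBary T 3) := by
    have h := sum_gradBary T
    rw [Fin.sum_univ_four] at h
    rw [eq_neg_iff_add_eq_zero, ← h]; abel
  have hl : T.coord 0 x = 1 - T.coord 1 x - T.coord 2 x - T.coord 3 x := by
    have h := T.sum_coord_apply_eq_one x
    rw [Fin.sum_univ_four] at h
    linarith
  rw [hg, hl]
  simp only [cross_add, cross_add_right, cross_neg_left, cross_neg_right, cross_self]
  rw [cross_anticomm (gradBary T 2) (gradBary T 1), cross_anticomm (gradBary T 3) (gradBary T 1),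
    cross_anticomm (gradBary T 3) (gradBary T 2)]
  module

end Geometry

/-! ### Orthogonal projections onto finite dimensional spaces -/

section OrthProj

variable {α V H : Type*} [AddCommGroup V] [Module ℝ V] [NormedAddCommGroup H]
  [InnerProductSpace ℝ H]

/-- The default value 0 lies in `X` too, so neither `B` nor `u` needs any property. -/
theorem orthProj_mem (B : (α → V) → (α → V) → ℝ) (X : Submodule ℝ (α → V)) (u : α → V) :
    orthProj B X u ∈ X := by
  unfold orthProj
  split_ifs with h
  · exact h.choose_spec.1
  · exact zero_mem X

variable {B : (α → V) → (α → V) → ℝ} {X Y : Submodule ℝ (α → V)} [FiniteDimensional ℝ X]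

/-- The form `B` is pulled back from a Hilbert space, where the image of `X` is finite dimensional.
A preimage of the orthogonal projection of `Λ u` onto this image is a solution, so the default value
is not taken. -/
theorem orthProj_spec (hXY : X ≤ Y) (Λ : Y →ₗ[ℝ] H)
    (hB : ∀ u v : Y, B u v = inner ℝ (Λ u) (Λ v)) {u : α → V} (hu : u ∈ Y) {v : α → V}
    (hv : v ∈ X) : B (u - orthProj B X u) v = 0 := by
  have h : ∃ w ∈ (X : Set (α → V)), ∀ v ∈ (X : Set (α → V)), B (u - w) v = 0 := by
    let K : Submodule ℝ H := Submodule.map (Λ ∘ₗ Submodule.inclusion hXY) ⊤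
    obtain ⟨w, -, hw⟩ := K.starProjection_apply_mem (Λ ⟨u, hu⟩)
    refine ⟨w, w.2, fun v hv => ?_⟩
    have h1 := K.sub_starProjection_mem_orthogonal (Λ ⟨u, hu⟩)
    rw [← hw, Submodule.mem_orthogonal'] at h1
    have h2 := h1 (Λ ⟨v, hXY hv⟩) ⟨⟨v, hv⟩, trivial, rfl⟩
    have h3 := hB (⟨u, hu⟩ - ⟨w, hXY w.2⟩) ⟨v, hXY hv⟩
    rw [map_sub] at h3
    exact h3.trans h2
  unfold orthProj
  rw [dif_pos h]
  exact h.choose_spec.2 v hv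

/-- Two solutions differ by an element of `X` whose image is orthogonal to itself; injectivity of
`Λ` on `X` makes the difference zero. Linearity and reproduction of `X` follow from this uniqueness.
-/
theorem orthProj_eq (hXY : X ≤ Y) (Λ : Y →ₗ[ℝ] H)
    (hB : ∀ u v : Y, B u v = inner ℝ (Λ u) (Λ v))
    (hinj : ∀ x : Y, (x : α → V) ∈ X → Λ x = 0 → x = 0) {u w : α → V} (hu : u ∈ Y) (hw : w ∈ X)
    (h : ∀ v ∈ X, B (u - w) v = 0) : orthProj B X u = w := by
  have hP := orthProj_mem B X u
  have hd : orthProj B X u - w ∈ X := sub_mem hP hw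
  have h1 := orthProj_spec hXY Λ hB hu hd
  have h2 := h _ hd
  have e1 := hB (⟨u, hu⟩ - ⟨_, hXY hP⟩) ⟨_, hXY hd⟩
  have e2 := hB (⟨u, hu⟩ - ⟨w, hXY hw⟩) ⟨_, hXY hd⟩
  have e3 : (⟨_, hXY hd⟩ : Y) = (⟨u, hu⟩ - ⟨w, hXY hw⟩) - (⟨u, hu⟩ - ⟨_, hXY hP⟩) := by
    ext1; simp
  have h3 : inner ℝ (Λ ⟨_, hXY hd⟩) (Λ ⟨_, hXY hd⟩) = 0 := by
    have e4 := congrArg (fun z => inner ℝ (Λ z) (Λ ⟨_, hXY hd⟩)) e3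
    simp only [map_sub (f := Λ) (⟨u, hu⟩ - ⟨w, hXY hw⟩), inner_sub_left] at e4
    rw [← e1, ← e2] at e4
    exact e4.trans (sub_eq_zero.2 (h2.trans h1.symm))
  have h4 := hinj _ hd (inner_self_eq_zero.1 h3)
  exact sub_eq_zero.1 (congrArg Subtype.val h4)

theorem orthProj_linear (hXY : X ≤ Y) (Λ : Y →ₗ[ℝ] H)
    (hB : ∀ u v : Y, B u v = inner ℝ (Λ u) (Λ v))
    (hinj : ∀ x : Y, (x : α → V) ∈ X → Λ x = 0 → x = 0) {u v : α → V} (hu : u ∈ Y) (hv : v ∈ Y)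
    (c : ℝ) : orthProj B X (c • u + v) = c • orthProj B X u + orthProj B X v := by
  have hPu := orthProj_mem B X u
  have hPv := orthProj_mem B X v
  refine orthProj_eq hXY Λ hB hinj (add_mem (Y.smul_mem c hu) hv)
    (add_mem (X.smul_mem c hPu) hPv) fun x hx => ?_
  have h1 := orthProj_spec hXY Λ hB hu hx
  have h2 := orthProj_spec hXY Λ hB hv hx
  have e1 := hB (⟨u, hu⟩ - ⟨_, hXY hPu⟩) ⟨x, hXY hx⟩
  have e2 := hB (⟨v, hv⟩ - ⟨_, hXY hPv⟩) ⟨x, hXY hx⟩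
  have e3 := hB (c • (⟨u, hu⟩ - ⟨_, hXY hPu⟩) + (⟨v, hv⟩ - ⟨_, hXY hPv⟩)) ⟨x, hXY hx⟩
  rw [map_add, map_smul, inner_add_left, real_inner_smul_left, ← e1, ← e2] at e3
  have e4 : c • u + v - (c • orthProj B X u + orthProj B X v) =
      c • (u - orthProj B X u) + (v - orthProj B X v) := by module
  rw [e4]
  refine e3.trans ?_
  change c * B (u - orthProj B X u) x + B (v - orthProj B X v) x = 0
  rw [h1, h2]; ring

theorem orthProj_self (hXY : X ≤ Y) (Λ : Y →ₗ[ℝ] H)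
    (hB : ∀ u v : Y, B u v = inner ℝ (Λ u) (Λ v))
    (hinj : ∀ x : Y, (x : α → V) ∈ X → Λ x = 0 → x = 0) {u : α → V} (hu : u ∈ X) :
    orthProj B X u = u := by
  refine orthProj_eq hXY Λ hB hinj (hXY hu) hu fun v hv => ?_
  have := hB (0 : Y) ⟨v, hXY hv⟩
  rw [map_zero, inner_zero_left] at this
  rw [sub_self]; exact this

end OrthProj

/-! ### Square integrable functions and their Riesz representatives -/

section Sobolev

variable {F : Set E3} {V : Type*} [NormedAddCommGroup V] [InnerProductSpace ℝ V]

variable (F V) in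
/-- The square integrable functions on `F`. -/
def sqInt (d : ℕ) : Submodule ℝ (F → V) where
  carrier := {u | MemLp u 2 (μHE[d] : Measure F)}
  add_mem' h1 h2 := h1.add h2
  zero_mem' := MemLp.zero'
  smul_mem' c _ h := h.const_smul c

variable (F V) in
/-- The class of a square integrable function. -/
noncomputable def sqIntToLp (d : ℕ) : sqInt F V d →ₗ[ℝ] Lp V 2 (μHE[d] : Measure F) where
  toFun u := MemLp.toLp u.1 u.2
  map_add' _ _ := rfl
  map_smul' _ _ := rfl

theorem innerL2_eq (d : ℕ) (u v : sqInt F V d) :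
    innerL2 d u.1 v.1 = inner ℝ (sqIntToLp F V d u) (sqIntToLp F V d v) := by
  rw [L2.inner_def, innerL2]
  refine integral_congr_ae ?_
  filter_upwards [MemLp.coeFn_toLp u.2, MemLp.coeFn_toLp v.2] with x hx hy
  show _ = inner ℝ ((MemLp.toLp u.1 u.2) x) ((MemLp.toLp v.1 v.2) x)
  rw [hx, hy]

theorem toHNeg_apply {U : Set F} {d : ℕ} {s : ℝ} (u : sqInt F V d) (g : H0 V U d s) :
    toHNeg U d s u.1 g = inner ℝ (sqIntToLp F V d u) g.1.fst := by
  have h : MemLp u.1 2 (μHE[d] : Measure F) := u.2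
  rw [toHNeg, dif_pos h]
  rfl

/-- The Riesz representatives of a linear family of functionals. -/
noncomputable def rieszOf {M K : Type*} [AddCommGroup M] [Module ℝ M] [NormedAddCommGroup K]
    [InnerProductSpace ℝ K] [CompleteSpace K] (f : M →ₗ[ℝ] StrongDual ℝ K) : M →ₗ[ℝ] K where
  toFun u := (InnerProductSpace.toDual ℝ K).symm (f u)
  map_add' u v := by rw [map_add, map_add]
  map_smul' c u := by rw [map_smul, map_smulₛₗ]; rfl

variable (V) in
/-- The embedding of `L²(F)` into `H^{-s}(F)` as a linear map. -/
noncomputable def toHNegL (U : Set F) (d : ℕ) (s : ℝ) :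
    sqInt F V d →ₗ[ℝ] StrongDual ℝ (H0 V U d s) where
  toFun u := toHNeg U d s u.1
  map_add' u v := ContinuousLinearMap.ext fun g => by
    have h1 := toHNeg_apply (U := U) (s := s) (u + v) g
    rw [map_add, inner_add_left] at h1
    exact h1.trans (congrArg₂ _ (toHNeg_apply u g).symm (toHNeg_apply v g).symm)
  map_smul' c u := ContinuousLinearMap.ext fun g => by
    have h1 := toHNeg_apply (U := U) (s := s) (c • u) g
    rw [map_smul, real_inner_smul_left] at h1
    exact h1.trans (congrArg (c * ·) (toHNeg_apply u g).symm)

/-- The element of `H_0^s` representing the functional given by a square integrable function. -/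
noncomputable def riesz [CompleteSpace V] (U : Set F) (d : ℕ) (s : ℝ) :
    sqInt F V d →ₗ[ℝ] H0 V U d s := rieszOf (toHNegL V U d s)

theorem innerNeg_eq [CompleteSpace V] (U : Set F) (d : ℕ) (s : ℝ) (u v : sqInt F V d) :
    innerNeg U d s u.1 v.1 = inner ℝ (riesz U d s u) (riesz U d s v) := rfl

/-- A function whose functional on `H_0^s` vanishes is orthogonal to the test functions. -/
theorem integral_test_eq_zero {U : Set F} {d : ℕ} {s : ℝ} {u : sqInt F ℝ d}
    (hu : riesz U d s u = 0) {φ : F → ℝ} (hφ : IsTest U φ) {g : PairL2 F ℝ d}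
    (hg : Represents d s φ g) : ∫ x, u.1 x * φ x ∂μHE[d] = 0 := by
  have hmem : g ∈ H0 ℝ U d s :=
    Submodule.le_topologicalClosure _ (Submodule.subset_span ⟨φ, hφ, hg⟩)
  have h1 : toHNeg U d s u.1 ⟨g, hmem⟩ = 0 := by
    rw [← InnerProductSpace.toDual_symm_apply]
    change inner ℝ (riesz U d s u) _ = _
    rw [hu, inner_zero_left]
  rw [toHNeg_apply, L2.inner_def] at h1
  rw [← h1]
  refine integral_congr_ae ?_
  filter_upwards [MemLp.coeFn_toLp u.2, hg.1] with x hx hy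
  show _ = inner ℝ ((MemLp.toLp u.1 u.2) x) (g.fst x)
  rw [hx, hy]
  simp [mul_comm]

theorem exists_represents {d : ℕ} {s : ℝ} {φ : F → V} (h1 : MemLp φ 2 (μHE[d] : Measure F))
    (h2 : MemLp (fun z : F × F => (‖(z.1 : E3) - (z.2 : E3)‖ ^ ((d : ℝ) / 2 + s))⁻¹ •
      (φ z.1 - φ z.2)) 2 ((μHE[d] : Measure F).prod (μHE[d] : Measure F))) :
    ∃ g : PairL2 F V d, Represents d s φ g :=
  ⟨WithLp.toLp 2 (h1.toLp, h2.toLp), h1.coeFn_toLp, h2.coeFn_toLp⟩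

end Sobolev

/-! ### A weakly singular kernel -/

/-- This one-dimensional integral is all that remains of the singular kernel on a face. -/
theorem lintegral_abs_rpow_lt_top {r : ℝ} (hr : -1 < r) :
    ∫⁻ t in Set.Icc (-1 : ℝ) 1, ENNReal.ofReal |t| ^ r < ⊤ := by
  have h1 : ∫⁻ t in Set.Icc (0 : ℝ) 1, ENNReal.ofReal |t| ^ r < ⊤ := by
    have h := (intervalIntegral.intervalIntegrable_rpow' (a := 0) (b := 1) hr)
    rw [intervalIntegrable_iff_integrableOn_Ioc_of_le zero_le_one] at h
    rw [setLIntegral_congr (Ioc_ae_eq_Icc (a := (0 : ℝ)) (b := 1)).symm]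
    refine lt_of_le_of_lt (le_of_eq ?_) h.2
    refine setLIntegral_congr_fun measurableSet_Ioc fun t ht => ?_
    simp only
    rw [abs_of_pos ht.1, ENNReal.ofReal_rpow_of_pos ht.1, Real.enorm_of_nonneg]
    exact Real.rpow_nonneg ht.1.le _
  have h2 : ∫⁻ t in Set.Icc (-1 : ℝ) 0, ENNReal.ofReal |t| ^ r =
      ∫⁻ t in Set.Icc (0 : ℝ) 1, ENNReal.ofReal |t| ^ r := by
    rw [← lintegral_indicator measurableSet_Icc, ← lintegral_indicator measurableSet_Icc,
      ← lintegral_neg_eq_self]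
    congr 1
    funext t
    by_cases ht : t ∈ Set.Icc (0 : ℝ) 1
    · rw [Set.indicator_of_mem ht, Set.indicator_of_mem, abs_neg]
      exact ⟨by linarith [ht.2], by linarith [ht.1]⟩
    · rw [Set.indicator_of_notMem ht, Set.indicator_of_notMem]
      intro h; exact ht ⟨by linarith [h.2], by linarith [h.1]⟩
  have h3 : Set.Icc (-1 : ℝ) 1 ⊆ Set.Icc (-1) 0 ∪ Set.Icc 0 1 := by
    rw [Set.Icc_union_Icc_eq_Icc (by norm_num) (by norm_num)]
  refine lt_of_le_of_lt (lintegral_mono_set h3) (lt_of_le_of_lt (lintegral_union_le _ _ _) ?_)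
  rw [h2]
  exact ENNReal.add_lt_top.2 ⟨h1, h1⟩

theorem lintegral_abs_sub_rpow_le {r : ℝ} {c : ℝ} (hc : c ∈ Set.Icc (0 : ℝ) 1) :
    ∫⁻ t in Set.Icc (0 : ℝ) 1, ENNReal.ofReal |c - t| ^ r ≤
      ∫⁻ t in Set.Icc (-1 : ℝ) 1, ENNReal.ofReal |t| ^ r := by
  rw [← lintegral_indicator measurableSet_Icc, ← lintegral_indicator measurableSet_Icc,
    ← lintegral_sub_left_eq_self (fun t => (Set.Icc (-1 : ℝ) 1).indicator _ t) c]
  refine lintegral_mono fun t => ?_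
  by_cases ht : t ∈ Set.Icc (0 : ℝ) 1
  · simp only
    rw [Set.indicator_of_mem ht, Set.indicator_of_mem]
    exact ⟨by linarith [ht.2, hc.1], by linarith [ht.1, hc.2]⟩
  · rw [Set.indicator_of_notMem ht]
    exact zero_le

/-- The simplex is enlarged to the unit cube, where the other coordinates integrate to one. -/
theorem setLIntegral_refS_le {d : ℕ} (i : Fin d) {h : ℝ → ENNReal} (hh : Measurable h) :
    ∫⁻ y in refS d, h (y i) ≤ ∫⁻ t in Set.Icc (0 : ℝ) 1, h t := by
  have hsub : refS d ⊆ Set.univ.pi fun _ => Set.Icc (0 : ℝ) 1 := by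
    rintro y ⟨h0, h1⟩ k -
    exact ⟨h0 k, (Finset.single_le_sum (fun j _ => h0 j) (Finset.mem_univ k)).trans h1⟩
  refine (lintegral_mono_set hsub).trans (le_of_eq ?_)
  rw [volume_pi, Measure.restrict_pi_pi]
  have : IsProbabilityMeasure ((volume : Measure ℝ).restrict (Set.Icc 0 1)) := ⟨by simp⟩
  have hmp := measurePreserving_eval (fun _ : Fin d => (volume : Measure ℝ).restrict (Set.Icc 0 1)) i
  exact hmp.lintegral_comp hh

/-! ### Smooth functions on facets -/

section Functions

variable {V : Type*} [NormedAddCommGroup V] [NormedSpace ℝ V]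

theorem smooth_continuous {A : Set E3} {u : A → V} (hu : u ∈ smooth V A) : Continuous u := by
  obtain ⟨U, hU, rfl⟩ := mem_smooth.1 hu
  exact hU.continuous.comp continuous_subtype_val

theorem restrict_mem_smooth (A : Set E3) {U : E3 → V} (hU : ContDiff ℝ ∞ U) :
    restrict A U ∈ smooth V A := mem_smooth.2 ⟨U, hU, rfl⟩

theorem smooth_memLp (T : Tet) {d : ℕ} {s : Finset (Fin 4)} (hs : s.card = d + 1)
    {u : facet T s → V} (hu : u ∈ smooth V (facet T s)) (q : ENNReal) :
    MemLp u q (μHE[d] : Measure (facet T s)) := by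
  have := isFiniteMeasure_facet T hs
  have : CompactSpace (facet T s) := isCompact_iff_compactSpace.1 (facet_isCompact T s)
  have hc := smooth_continuous hu
  obtain ⟨C, hC⟩ := isCompact_univ.exists_bound_of_continuousOn hc.continuousOn
  refine MemLp.of_bound hc.aestronglyMeasurable_of_compactSpace C ?_
  exact Filter.Eventually.of_forall fun x => hC x trivial

theorem smooth_integrable (T : Tet) {d : ℕ} {s : Finset (Fin 4)} (hs : s.card = d + 1)
    {u : facet T s → V} (hu : u ∈ smooth V (facet T s)) :
    Integrable u (μHE[d] : Measure (facet T s)) := memLp_one_iff_integrable.1 (smooth_memLp T hs hu 1)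

end Functions

section Geometry

variable (T : Tet)

theorem div_mem_smooth {u : body T → E3} (hu : u ∈ smooth E3 (body T)) :
    div u ∈ smooth ℝ (body T) := by
  obtain ⟨U, hU, rfl⟩ := mem_smooth.1 hu
  rw [div_restrict T (hU.differentiable (by simp))]
  exact restrict_mem_smooth _ (contDiff_gdiv hU)

theorem grad_mem_smooth {u : body T → ℝ} (hu : u ∈ smooth ℝ (body T)) :
    grad u ∈ smooth E3 (body T) := by
  obtain ⟨U, hU, rfl⟩ := mem_smooth.1 hu
  rw [grad_restrict T (hU.differentiable (by simp))]
  exact restrict_mem_smooth _ (contDiff_ggrad hU)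

theorem traceNor_mem_smooth (i : Fin 4) {u : body T → E3} (hu : u ∈ smooth E3 (body T)) :
    traceNor T i u ∈ smooth ℝ (face T i) := by
  obtain ⟨U, hU, rfl⟩ := mem_smooth.1 hu
  rw [traceNor_restrict]
  exact restrict_mem_smooth _ (hU.inner ℝ contDiff_const)

theorem curl_linear (c : ℝ) {u v : body T → E3} (hu : u ∈ smooth E3 (body T))
    (hv : v ∈ smooth E3 (body T)) : curl (c • u + v) = c • curl u + curl v := by
  obtain ⟨U, hU, rfl⟩ := mem_smooth.1 hu
  obtain ⟨W, hW, rfl⟩ := mem_smooth.1 hv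
  have hU' := hU.differentiable (by simp)
  have hW' := hW.differentiable (by simp)
  rw [← map_smul, ← map_add, curl_restrict T ((hU'.const_smul c).add hW'), gcurl_add
    (hU'.const_smul c) hW', gcurl_smul c hU', curl_restrict T hU', curl_restrict T hW', map_add,
    map_smul]

theorem div_linear (c : ℝ) {u v : body T → E3} (hu : u ∈ smooth E3 (body T))
    (hv : v ∈ smooth E3 (body T)) : div (c • u + v) = c • div u + div v := by
  obtain ⟨U, hU, rfl⟩ := mem_smooth.1 hu
  obtain ⟨W, hW, rfl⟩ := mem_smooth.1 hv
  have hU' := hU.differentiable (by simp)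
  have hW' := hW.differentiable (by simp)
  rw [← map_smul, ← map_add, div_restrict T ((hU'.const_smul c).add hW'), gdiv_add
    (hU'.const_smul c) hW', gdiv_smul c hU', div_restrict T hU', div_restrict T hW', map_add,
    map_smul]

theorem curl_add {u v : body T → E3} (hu : u ∈ smooth E3 (body T))
    (hv : v ∈ smooth E3 (body T)) : curl (u + v) = curl u + curl v := by
  simpa using curl_linear T 1 hu hv

theorem curl_sub {u v : body T → E3} (hu : u ∈ smooth E3 (body T))
    (hv : v ∈ smooth E3 (body T)) : curl (u - v) = curl u - curl v := by
  have := curl_linear T (-1) hv hu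
  rw [show (-1 : ℝ) • v + u = u - v by module] at this
  rw [this]; module

theorem div_sub {u v : body T → E3} (hu : u ∈ smooth E3 (body T))
    (hv : v ∈ smooth E3 (body T)) : div (u - v) = div u - div v := by
  have := div_linear T (-1) hv hu
  rw [show (-1 : ℝ) • v + u = u - v by module] at this
  rw [this]; module

theorem curl_zero : curl (0 : body T → E3) = 0 := by
  have := curl_linear T (-1) (zero_mem (smooth E3 (body T))) (zero_mem _)
  simpa using this

theorem curl_sum {ι : Type*} (t : Finset ι) {u : ι → body T → E3}
    (hu : ∀ i ∈ t, u i ∈ smooth E3 (body T)) : curl (∑ i ∈ t, u i) = ∑ i ∈ t, curl (u i) := by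
  classical
  induction t using Finset.induction_on with
  | empty => simpa using curl_zero T
  | insert a t ha ih =>
    rw [Finset.sum_insert ha, Finset.sum_insert ha, curl_add T (hu a (Finset.mem_insert_self a t))
      (sum_mem fun i hi => hu i (Finset.mem_insert_of_mem hi)),
      ih fun i hi => hu i (Finset.mem_insert_of_mem hi)]

theorem curl_grad {q : body T → ℝ} (hq : q ∈ smooth ℝ (body T)) : curl (grad q) = 0 := by
  obtain ⟨Q, hQ, rfl⟩ := mem_smooth.1 hq
  rw [grad_restrict T (hQ.differentiable (by simp)),
    curl_restrict T ((contDiff_ggrad hQ).differentiable (by simp)), gcurl_ggrad hQ, map_zero]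

theorem div_curl {u : body T → E3} (hu : u ∈ smooth E3 (body T)) : div (curl u) = 0 := by
  obtain ⟨U, hU, rfl⟩ := mem_smooth.1 hu
  rw [curl_restrict T (hU.differentiable (by simp)),
    div_restrict T ((contDiff_gcurl hU).differentiable (by simp)), gdiv_gcurl hU, map_zero]

/-! ### Definiteness of the inner products -/

theorem card_body : (Finset.univ : Finset (Fin 4)).card = 3 + 1 := by simp

/-- A smooth field is determined on the closed tetrahedron by its class, since a continuous
nonnegative function with zero integral vanishes there. -/
theorem sqIntToLp_injective {V : Type*} [NormedAddCommGroup V] [InnerProductSpace ℝ V]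
    (u : sqInt (body T) V 3) (hu : (u : body T → V) ∈ smooth V (body T))
    (h : sqIntToLp (body T) V 3 u = 0) : u = 0 := by
  obtain ⟨U, hU, hU'⟩ := mem_smooth.1 hu
  have h1 := innerL2_eq 3 u u
  rw [h, inner_zero_left, innerL2, ← hU'] at h1
  have h2 := eqOn_zero_of_integral_facet_eq_zero T card_body (G := fun x => inner ℝ (U x) (U x))
    (hU.continuous.inner hU.continuous) (fun x _ => real_inner_self_nonneg) h1
  ext1
  rw [← hU']
  funext x
  exact inner_self_eq_zero.1 (h2 x x.2)

theorem coord_mem_Icc {s : Finset (Fin 4)} {x : E3} (hx : x ∈ facet T s) (i : Fin 4) :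
    T.coord i x ∈ Set.Icc (0 : ℝ) 1 := by
  have h := ((mem_facet T).1 hx).1
  refine ⟨h i, ?_⟩
  rw [← T.sum_coord_apply_eq_one x]
  exact Finset.single_le_sum (fun j _ => h j) (Finset.mem_univ i)

/-- The kernel measures distance by one barycentric coordinate, which in the parametrization is the
single coordinate `k`. The bound is uniform in `x`. -/
theorem lintegral_kernel_le {d : ℕ} {σ : Fin (d + 1) → Fin 4} (hσ : Function.Injective σ)
    (k : Fin d) (r : ℝ) {s : Finset (Fin 4)} (hs : Finset.univ.image σ = s) {x : E3}
    (hx : x ∈ facet T s) :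
    ∫⁻ y : facet T s, ENNReal.ofReal |T.coord (σ k.succ) x - T.coord (σ k.succ) y| ^ r ∂μHE[d] ≤
      ENNReal.ofReal (paramLin (T ∘ σ)).normDet *
        ∫⁻ t in Set.Icc (-1 : ℝ) 1, ENNReal.ofReal |t| ^ r := by
  rw [lintegral_facet T hσ hs
    fun y => ENNReal.ofReal |T.coord (σ k.succ) x - T.coord (σ k.succ) y| ^ r]
  gcongr
  refine le_trans (le_of_eq ?_) ((setLIntegral_refS_le k
    (h := fun t => ENNReal.ofReal |T.coord (σ k.succ) x - t| ^ r) (by fun_prop)).trans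
      (lintegral_abs_sub_rpow_le (coord_mem_Icc T hx _)))
  congr 1
  funext y
  simp [coord_param, hσ.eq_iff, Fin.succ_ne_zero]

theorem exists_lipschitz {Φ : E3 → ℝ} (hΦ : ContDiff ℝ ∞ Φ) (s : Finset (Fin 4)) :
    ∃ L, 0 ≤ L ∧ ∀ x ∈ facet T s, ∀ y ∈ facet T s, |Φ x - Φ y| ≤ L * ‖x - y‖ := by
  obtain ⟨L, hL⟩ := (facet_isCompact T s).exists_bound_of_continuousOn
    (hΦ.continuous_fderiv (by simp)).continuousOn
  refine ⟨max L 0, le_max_right _ _, fun x hx y hy => ?_⟩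
  exact (facet_convex T s).norm_image_sub_le_of_norm_fderiv_le
    (fun z _ => hΦ.differentiable (by simp) z) (fun z hz => (hL z hz).trans (le_max_left _ _)) hy hx

/-- A Lipschitz numerator cancels one power of the distance `N`, which leaves L N ^ (-s). As N ≥ δ /
A, where δ is the difference of one barycentric coordinate, the square is at most a constant times δ
^ (-2s). The exponent 1 + s is d / 2 + s in dimension d = 2. -/
theorem quotient_le {r s L A N δ q : ℝ} (hr : r = 1 + s) (hs : 0 < s)
    (hA : 0 ≤ A) (hN : 0 ≤ N) (hδ : 0 ≤ δ) (hδN : δ ≤ A * N) (hq : |q| ≤ L * N) :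
    ‖(N ^ r)⁻¹ • q‖ₑ ^ (2 : ℝ) ≤
      ENNReal.ofReal (L ^ 2 * A ^ (2 * s) + 1) * ENNReal.ofReal δ ^ (-(2 * s)) := by
  have hK : 0 < L ^ 2 * A ^ (2 * s) + 1 := by positivity
  -- For δ = 0 the right-hand side is infinite because the constant is positive; this is the purpose
  -- of the summand 1.
  rcases hδ.eq_or_lt with h0 | h0
  · rw [← h0, ENNReal.ofReal_zero, ENNReal.zero_rpow_of_neg (by linarith),
      ENNReal.mul_top (ENNReal.ofReal_pos.2 hK).ne']
    exact le_top
  have hAN : 0 < A * N := h0.trans_le hδN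
  have hA' : 0 < A := lt_of_le_of_ne hA fun h => by rw [← h] at hAN; simp at hAN
  have hN' : 0 < N := lt_of_le_of_ne hN fun h => by rw [← h] at hAN; simp at hAN
  have h1 : ‖(N ^ r)⁻¹ • q‖ ≤ L * N ^ (-s) := by
    rw [norm_smul, norm_inv, Real.norm_of_nonneg (Real.rpow_nonneg hN r), Real.norm_eq_abs]
    calc (N ^ r)⁻¹ * |q| ≤ (N ^ r)⁻¹ * (L * N) := by gcongr
      _ = L * N ^ (-s) := by
        rw [← Real.rpow_neg hN, show -s = -r + 1 by rw [hr]; ring, Real.rpow_add hN',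
          Real.rpow_one]
        ring
  have h2 : N ^ (-(2 * s)) ≤ A ^ (2 * s) * δ ^ (-(2 * s)) := by
    have h3 : δ / A ≤ N := by rw [div_le_iff₀ hA']; linarith
    refine (Real.rpow_le_rpow_of_nonpos (by positivity) h3 (by linarith)).trans (le_of_eq ?_)
    rw [Real.div_rpow hδ hA, Real.rpow_neg hA]
    field_simp
  rw [ENNReal.ofReal_rpow_of_pos h0, ← ENNReal.ofReal_mul hK.le, ← ofReal_norm,
    ENNReal.ofReal_rpow_of_nonneg (norm_nonneg _) (by norm_num)]
  refine ENNReal.ofReal_le_ofReal ?_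
  rw [Real.rpow_two]
  calc ‖(N ^ r)⁻¹ • q‖ ^ 2 ≤ (L * N ^ (-s)) ^ 2 := by gcongr
    _ = L ^ 2 * N ^ (-(2 * s)) := by
      rw [mul_pow, ← Real.rpow_natCast (N ^ (-s)), ← Real.rpow_mul hN]
      congr 2; push_cast; ring
    _ ≤ L ^ 2 * (A ^ (2 * s) * δ ^ (-(2 * s))) := by gcongr
    _ ≤ (L ^ 2 * A ^ (2 * s) + 1) * δ ^ (-(2 * s)) := by
      have := Real.rpow_nonneg hδ (-(2 * s))
      nlinarith

end Geometry

/-! ### Definiteness of the negative-order inner product on faces -/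

section Geometry

variable (T : Tet)

/-- Replacing the distance by one barycentric coordinate is crude: the kernel of order -2θ is then
integrated in a single variable, which requires 2θ < 1. The order 1/2 - ε satisfies this. -/
theorem lintegral_quotient_lt_top {s : Finset (Fin 4)} {σ : Fin (2 + 1) → Fin 4}
    (hσ : Function.Injective σ) (hs : Finset.univ.image σ = s)
    (μ : Measure (facet T s)) [IsFiniteMeasure μ] (hμ : μ = μHE[2]) {r θ : ℝ} (hr : r = 1 + θ)
    (hθ : 0 < θ) (hθ' : 2 * θ < 1) {Φ : E3 → ℝ} (hΦ : ContDiff ℝ ∞ Φ) :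
    ∫⁻ z : facet T s × facet T s, ‖(‖(z.1 : E3) - (z.2 : E3)‖ ^ r)⁻¹ • (Φ z.1 - Φ z.2)‖ₑ ^ (2 : ℝ)
      ∂(μ.prod μ) < ⊤ := by
  obtain ⟨L, hL, hLip⟩ := exists_lipschitz T hΦ s
  have hc : Continuous fun x => T.coord (σ (Fin.succ 0)) x :=
    AffineMap.continuous_of_finiteDimensional _
  have hle : ∀ z : facet T s × facet T s,
      ‖(‖(z.1 : E3) - (z.2 : E3)‖ ^ r)⁻¹ • (Φ z.1 - Φ z.2)‖ₑ ^ (2 : ℝ) ≤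
      ENNReal.ofReal (L ^ 2 * ‖gradBary T (σ (Fin.succ 0))‖ ^ (2 * θ) + 1) *
        ENNReal.ofReal |T.coord (σ (Fin.succ 0)) z.1 - T.coord (σ (Fin.succ 0)) z.2| ^
          (-(2 * θ)) := by
    intro z
    refine quotient_le hr hθ (norm_nonneg _) (norm_nonneg _) (abs_nonneg _) ?_
      (hLip _ z.1.2 _ z.2.2)
    rw [coord_sub]
    exact abs_real_inner_le_norm _ _
  have hk : Measurable fun z : facet T s × facet T s =>
      ENNReal.ofReal |T.coord (σ (Fin.succ 0)) z.1 - T.coord (σ (Fin.succ 0)) z.2| ^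
        (-(2 * θ)) := by
    have h1 : Continuous fun z : facet T s × facet T s =>
      |T.coord (σ (Fin.succ 0)) z.1 - T.coord (σ (Fin.succ 0)) z.2| := by fun_prop
    exact (ENNReal.measurable_ofReal.comp h1.measurable).pow_const _
  refine lt_of_le_of_lt (lintegral_mono hle) ?_
  rw [lintegral_const_mul _ hk]
  refine ENNReal.mul_lt_top ENNReal.ofReal_lt_top ?_
  rw [lintegral_prod _ hk.aemeasurable]
  have hb : ∀ x : facet T s, ∫⁻ y : facet T s, ENNReal.ofReal
      |T.coord (σ (Fin.succ 0)) x - T.coord (σ (Fin.succ 0)) y| ^ (-(2 * θ)) ∂μ ≤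
      ENNReal.ofReal (paramLin (T ∘ σ)).normDet *
        ∫⁻ t in Set.Icc (-1 : ℝ) 1, ENNReal.ofReal |t| ^ (-(2 * θ)) := by
    intro x
    rw [hμ]
    exact lintegral_kernel_le T hσ 0 _ hs x.2
  refine lt_of_le_of_lt (lintegral_mono hb) ?_
  rw [lintegral_const]
  exact ENNReal.mul_lt_top (ENNReal.mul_lt_top ENNReal.ofReal_lt_top
    (lintegral_abs_rpow_lt_top (by linarith))) (measure_lt_top _ _)

theorem memLp_quotient {s : Finset (Fin 4)} {σ : Fin (2 + 1) → Fin 4}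
    (hσ : Function.Injective σ) (hs : Finset.univ.image σ = s)
    (μ : Measure (facet T s)) [IsFiniteMeasure μ] (hμ : μ = μHE[2]) {r θ : ℝ} (hr : r = 1 + θ)
    (hθ : 0 < θ) (hθ' : 2 * θ < 1) {Φ : E3 → ℝ} (hΦ : ContDiff ℝ ∞ Φ) :
    MemLp (fun z : facet T s × facet T s => (‖(z.1 : E3) - (z.2 : E3)‖ ^ r)⁻¹ •
      (Φ z.1 - Φ z.2)) 2 (μ.prod μ) := by
  have hm : Measurable fun z : facet T s × facet T s =>
      (‖(z.1 : E3) - (z.2 : E3)‖ ^ r)⁻¹ • (Φ z.1 - Φ z.2) := by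
    have h1 : Measurable fun z : facet T s × facet T s => ‖(z.1 : E3) - (z.2 : E3)‖ :=
      Continuous.measurable (by fun_prop)
    have h2 : Measurable fun z : facet T s × facet T s => Φ z.1 - Φ z.2 := by
      have := hΦ.continuous
      exact Continuous.measurable (by fun_prop)
    exact (h1.pow_const r).inv.smul h2
  refine ⟨hm.aestronglyMeasurable, ?_⟩
  rw [eLpNorm_lt_top_iff_lintegral_rpow_enorm_lt_top (by norm_num) (by norm_num)]
  rw [ENNReal.toReal_ofNat]
  exact lintegral_quotient_lt_top T hσ hs μ hμ hr hθ hθ' hΦ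

theorem exists_represents_smooth {s : Finset (Fin 4)} (hs : s.card = 2 + 1) {θ : ℝ}
    (hθ : 0 < θ) (hθ' : 2 * θ < 1) {Φ : E3 → ℝ} (hΦ : ContDiff ℝ ∞ Φ) :
    ∃ g : PairL2 (facet T s) ℝ 2, Represents 2 θ (restrict (facet T s) Φ) g := by
  obtain ⟨σ, hσ, hσs⟩ := exists_enum hs
  have := isFiniteMeasure_facet T hs
  refine exists_represents (smooth_memLp T hs (restrict_mem_smooth _ hΦ) 2) ?_
  exact memLp_quotient T hσ hσs μHE[2] rfl (by norm_num) hθ hθ' hΦ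

theorem integral_mul_eq_zero_of_riesz_eq_zero {s : Finset (Fin 4)} (hs : s.card = 2 + 1) {θ : ℝ}
    (hθ : 0 < θ) (hθ' : 2 * θ < 1) {u : sqInt (facet T s) ℝ 2}
    (h : riesz (facetInt T s) 2 θ u = 0) {Φ : E3 → ℝ} (hΦ : ContDiff ℝ ∞ Φ)
    (htest : IsTest (facetInt T s) (restrict (facet T s) Φ)) :
    ∫ x, u.1 x * restrict (facet T s) Φ x ∂μHE[2] = 0 :=
  (exists_represents_smooth T hs hθ hθ' hΦ).elim fun _ hg => integral_test_eq_zero h htest hg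

theorem exists_bump {s : Finset (Fin 4)} {x : E3} (hpos : ∀ l ∈ s, 0 < T.coord l x) :
    ∃ f : E3 → ℝ, ContDiff ℝ ∞ f ∧ (∀ y, 0 ≤ f y) ∧ f x = 1 ∧ ∃ K : Set E3, IsClosed K ∧
      (∀ y, f y ≠ 0 → y ∈ K) ∧ ∀ y ∈ K, ∀ l ∈ s, 0 < T.coord l y := by
  have hco : ∀ l, Continuous fun x => T.coord l x := fun l =>
    AffineMap.continuous_of_finiteDimensional _
  have ho : IsOpen {y | ∀ l ∈ s, 0 < T.coord l y} := by
    have e : {y | ∀ l ∈ s, 0 < T.coord l y} = ⋂ l ∈ s, {y | 0 < T.coord l y} := by ext; simp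
    rw [e]
    exact isOpen_biInter_finset fun l _ => isOpen_lt continuous_const (hco l)
  obtain ⟨ρ, hρ, hball⟩ := Metric.nhds_basis_closedBall.mem_iff.1 (ho.mem_nhds hpos)
  let f : ContDiffBump x := ⟨ρ / 2, ρ, by linarith, by linarith⟩
  refine ⟨f, f.contDiff, fun y => f.nonneg, f.one_of_mem_closedBall
    (Metric.mem_closedBall_self (by positivity)), _, Metric.isClosed_closedBall,
    fun y hy => ?_, hball⟩
  have h2 : y ∈ Function.support f := hy
  rw [f.support_eq] at h2
  exact Metric.ball_subset_closedBall h2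

theorem isTest_of_closed {s : Finset (Fin 4)} {Φ : E3 → ℝ} (hΦ : ContDiff ℝ ∞ Φ) {K : Set E3}
    (hK : IsClosed K) (h1 : ∀ y, Φ y ≠ 0 → y ∈ K) (h2 : ∀ y ∈ K, ∀ l ∈ s, 0 < T.coord l y) :
    IsTest (facetInt T s) (restrict (facet T s) Φ) := by
  have hcl : IsClosed {y : facet T s | (y : E3) ∈ K} := hK.preimage continuous_subtype_val
  have hsub : tsupport (restrict (facet T s) Φ) ⊆ {y : facet T s | (y : E3) ∈ K} :=
    closure_minimal (fun z hz => h1 z hz) hcl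
  exact ⟨restrict_mem_smooth _ hΦ, fun y hy => h2 _ (hsub hy)⟩

/-- A smooth function on a triangle whose functional on `H_0^s` vanishes is zero in the
interior. -/
theorem eq_zero_of_riesz_eq_zero {s : Finset (Fin 4)} (hs : s.card = 2 + 1) {θ : ℝ}
    (hθ : 0 < θ) (hθ' : 2 * θ < 1) {q : E3 → ℝ} (hq : ContDiff ℝ ∞ q)
    (u : sqInt (facet T s) ℝ 2) (hu : u.1 = restrict (facet T s) q)
    (h : riesz (facetInt T s) 2 θ u = 0) {x : E3} (hx : x ∈ facet T s)
    (hpos : ∀ l ∈ s, 0 < T.coord l x) : q x = 0 := by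
  obtain ⟨f, hf, hf0, hfx, K, hK, hfK, hKs⟩ := exists_bump T hpos
  -- The product of `q` with a bump `f` at `x` is an admissible test function; the integral of q² f
  -- then vanishes, which forces q(x) = 0.
  have hqf : ContDiff ℝ ∞ fun y => q y * f y := hq.mul hf
  have h0 := integral_mul_eq_zero_of_riesz_eq_zero T hs hθ hθ' h hqf
    (isTest_of_closed T hqf hK (fun y hy => hfK y (right_ne_zero_of_mul hy)) hKs)
  rw [hu] at h0
  have h1 := eqOn_zero_of_integral_facet_eq_zero T hs
    (G := fun y => q y * (q y * f y)) (hq.continuous.mul hqf.continuous)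
    (fun y _ => by rw [← mul_assoc]; exact mul_nonneg (mul_self_nonneg _) (hf0 y)) h0 x hx
  simpa [hfx] using h1

theorem exists_mem_facetInt {s : Finset (Fin 4)} (hs : s.card = 2 + 1) :
    ∃ c ∈ facet T s, ∀ l ∈ s, 0 < T.coord l c := by
  obtain ⟨σ, hσ, hσs⟩ := exists_enum hs
  refine ⟨param (T ∘ σ) fun _ => (1 / 3 : ℝ), ?_, fun l hl => ?_⟩
  · rw [← hσs, ← param_image T hσ]
    refine ⟨_, ⟨fun _ => by norm_num, ?_⟩, rfl⟩
    rw [Fin.sum_univ_two]; norm_num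
  · rw [← hσs] at hl
    obtain ⟨k, -, rfl⟩ := Finset.mem_image.1 hl
    rw [coord_param]
    fin_cases k <;> simp [Fin.sum_univ_two, hσ.eq_iff] <;> norm_num

/-- Test functions see only the relative interior. An arbitrary point of the face is the end of a
segment that starts at an interior point and stays inside until its end, so continuity gives the
value there. -/
theorem riesz_face_injective {s : Finset (Fin 4)} (hs : s.card = 2 + 1) {θ : ℝ}
    (hθ : 0 < θ) (hθ' : 2 * θ < 1) (u : sqInt (facet T s) ℝ 2)
    (hu : u.1 ∈ smooth ℝ (facet T s)) (h : riesz (facetInt T s) 2 θ u = 0) : u = 0 := by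
  obtain ⟨q, hq, hqu⟩ := mem_smooth.1 hu
  obtain ⟨c, hcf, hci⟩ := exists_mem_facetInt T hs
  refine Subtype.ext ?_
  rw [← hqu]
  funext x
  have hline : Set.EqOn (fun t : ℝ => q (c + t • ((x : E3) - c))) 0 (Set.Ico 0 1) := by
    intro t ht
    refine eq_zero_of_riesz_eq_zero T hs hθ hθ' hq u hqu.symm h
      (facet_star T hcf x.2 ⟨ht.1, ht.2.le⟩) fun l hl => ?_
    have h1 := coord_sub T l (c + t • ((x : E3) - c)) c
    rw [add_sub_cancel_left, real_inner_smul_right, ← coord_sub, sub_eq_iff_eq_add] at h1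
    rw [h1]
    have h2 := ((mem_facet T).1 x.2).1 l
    have h3 := hci l hl
    nlinarith [ht.1, ht.2]
  have hcont : Continuous fun t : ℝ => q (c + t • ((x : E3) - c)) :=
    hq.continuous.comp (by fun_prop)
  have h1 := hline.closure hcont continuous_const
  rw [closure_Ico zero_ne_one] at h1
  have h2 := h1 (Set.right_mem_Icc.2 zero_le_one)
  simpa using h2

end Geometry

/-! ### Differential operators on polynomial fields -/

theorem Pol_sub_coord (a : E3) (k : Fin 3) : (fun x : E3 => x k - a k) ∈ Pol 1 :=
  sub_mem (Pol_coord k) (Pol_mono zero_le_one (Pol_const (a k)))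

theorem VPol_ggrad {m : ℤ} {f : E3 → ℝ} (hf : f ∈ Pol m) : ggrad f ∈ VPol (m - 1) :=
  mem_VPol.2 fun k => by
    fin_cases k <;> simpa [ggrad] using Pol_fderiv hf _

theorem VPol_fderiv {m : ℤ} {U : E3 → E3} (hU : U ∈ VPol m) (w : E3) :
    (fun x => fderiv ℝ U x w) ∈ VPol (m - 1) :=
  mem_VPol.2 fun k => by
    simp only [← fderiv_component ((VPol_contDiff hU).differentiable (by simp))]
    exact Pol_fderiv (mem_VPol.1 hU k) w

theorem VPol_gcurl {m : ℤ} {U : E3 → E3} (hU : U ∈ VPol m) : gcurl U ∈ VPol (m - 1) :=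
  mem_VPol.2 fun k => by
    have h : ∀ w j w' j', (fun x => fderiv ℝ U x w j - fderiv ℝ U x w' j') ∈ Pol (m - 1) :=
      fun w j w' j' =>
        sub_mem (mem_VPol.1 (VPol_fderiv hU w) j) (mem_VPol.1 (VPol_fderiv hU w') j')
    fin_cases k <;> simpa [gcurl] using h _ _ _ _

theorem Pol_gdiv {m : ℤ} {U : E3 → E3} (hU : U ∈ VPol m) : gdiv U ∈ Pol (m - 1) := by
  have h := fun w k => mem_VPol.1 (VPol_fderiv hU w) k
  exact add_mem (add_mem (h _ _) (h _ _)) (h _ _)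

theorem VPol_smul_sub {m : ℤ} {q : E3 → ℝ} (hq : q ∈ Pol m) (a : E3) :
    (fun x => q x • (x - a)) ∈ VPol (m + 1) :=
  mem_VPol.2 fun k => Pol_mul hq (Pol_sub_coord a k)

theorem VPol_cross_sub {m : ℤ} {Q : E3 → E3} (hQ : Q ∈ VPol m) (a : E3) :
    (fun x => cross (Q x) (x - a)) ∈ VPol (m + 1) :=
  mem_VPol.2 fun k => by
    have h : ∀ j l j' l', (fun x => Q x j * (x l - a l) - Q x j' * (x l' - a l')) ∈ Pol (m + 1) :=
      fun j l j' l' => sub_mem (Pol_mul (mem_VPol.1 hQ j) (Pol_sub_coord a l))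
        (Pol_mul (mem_VPol.1 hQ j') (Pol_sub_coord a l'))
    fin_cases k <;> simpa [cross] using h _ _ _ _

theorem fderiv_eq_sum (A : E3 →L[ℝ] E3) (w : E3) : A w =
    w 0 • A (unitVec 0) + w 1 • A (unitVec 1) + w 2 • A (unitVec 2) := by
  conv_lhs => rw [eq_sum_unitVec w]
  simp only [map_add, map_smul]

theorem VPol_fderiv_sub {m : ℤ} {U : E3 → E3} (hU : U ∈ VPol m) (a : E3) :
    (fun x => fderiv ℝ U x (x - a)) ∈ VPol m := by
  have h : ∀ k : Fin 3, (fun x : E3 => (x k - a k) • fderiv ℝ U x (unitVec k)) ∈ VPol m := fun k =>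
    mem_VPol.2 fun j => by
      have := Pol_mul (Pol_sub_coord a k) (mem_VPol.1 (VPol_fderiv hU (unitVec k)) j)
      rwa [show 1 + (m - 1) = m by ring] at this
  have h2 := add_mem (add_mem (h 0) (h 1)) (h 2)
  convert h2 using 1
  funext x
  rw [fderiv_eq_sum]
  rfl

theorem Pol_fderiv_sub {m : ℤ} {q : E3 → ℝ} (hq : q ∈ Pol m) (a : E3) :
    (fun x => fderiv ℝ q x (x - a)) ∈ Pol m := by
  have h : ∀ k : Fin 3, (fun x : E3 => (x k - a k) * fderiv ℝ q x (unitVec k)) ∈ Pol m := fun k => by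
    have := Pol_mul (Pol_sub_coord a k) (Pol_fderiv hq (unitVec k))
    rwa [show 1 + (m - 1) = m by ring] at this
  have h2 := add_mem (add_mem (h 0) (h 1)) (h 2)
  convert h2 using 1
  funext x
  have := congrArg (fderiv ℝ q x) (eq_sum_unitVec (x - a))
  simp only [map_add, map_smul] at this
  exact this

theorem gdiv_smul_sub {q : E3 → ℝ} (hq : Differentiable ℝ q) (a x : E3) :
    gdiv (fun y => q y • (y - a)) x = 3 * q x + fderiv ℝ q x (x - a) := by
  rw [gdiv_smul_field hq (by fun_prop)]
  have h : gdiv (fun y : E3 => y - a) x = 3 := by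
    have := gdiv_clm (ContinuousLinearMap.id ℝ E3) (-a) x
    simp only [ContinuousLinearMap.id_apply, ← sub_eq_add_neg] at this
    rw [this]
    simp [tr, unitVec]; norm_num
  rw [h]; ring

section Geometry

variable (T : Tet) (p : ℕ)

/-! ### The local polynomial spaces -/

-- Changing the centre from 0 to `a` alters only `P`, because Q × a still has degree at most p. With
-- `a` a vertex, x - a is tangential to the facets through `a`, which lowers the degree of traces.
variable {T p} in
theorem mem_W1 (a : E3) {u : body T → E3} : u ∈ W1 T p ↔ ∃ P ∈ VPol p, ∃ Q ∈ VPol p,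
    u = restrict (body T) fun x => P x + cross (Q x) (x - a) := by
  have hc : ∀ Q ∈ VPol p, (fun x => cross (Q x) a) ∈ VPol p := fun Q hQ =>
    VPol_linear_comp hQ (crossL.flip a)
  constructor
  · rintro ⟨_, hU, rfl⟩
    obtain ⟨P, hP, _, ⟨Q, hQ, rfl⟩, rfl⟩ := Submodule.mem_sup.1 hU
    refine ⟨_, add_mem hP (hc Q hQ), Q, hQ, congrArg _ ?_⟩
    funext x
    simp [crossId, cross_sub_right]
  · rintro ⟨P, hP, Q, hQ, rfl⟩
    refine ⟨_, Submodule.mem_sup.2 ⟨_, sub_mem hP (hc Q hQ), _, ⟨Q, hQ, rfl⟩, rfl⟩, congrArg _ ?_⟩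
    funext x
    simp [crossId, cross_sub_right]
    abel

variable {T p} in
theorem mem_W2 (a : E3) {u : body T → E3} : u ∈ W2 T p ↔ ∃ P ∈ VPol p, ∃ q ∈ Pol p,
    u = restrict (body T) fun x => P x + q x • (x - a) := by
  constructor
  · rintro ⟨_, hU, rfl⟩
    obtain ⟨P, hP, _, ⟨q, hq, rfl⟩, rfl⟩ := Submodule.mem_sup.1 hU
    refine ⟨_, add_mem hP (VPol_smul_const hq a), q, hq, congrArg _ ?_⟩
    funext x
    simp [mulId, smul_sub]
  · rintro ⟨P, hP, q, hq, rfl⟩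
    refine ⟨_, Submodule.mem_sup.2 ⟨_, sub_mem hP (VPol_smul_const hq a), _, ⟨q, hq, rfl⟩, rfl⟩,
      congrArg _ ?_⟩
    funext x
    simp [mulId, smul_sub]
    abel

variable {T p} in
theorem mem_PolOn {F : Set E3} {m : ℤ} {u : F → ℝ} :
    u ∈ PolOn F m ↔ ∃ q ∈ Pol m, restrict F q = u := Submodule.mem_map

variable {T p} in
theorem PolOn_le_smooth {F : Set E3} {m : ℤ} : PolOn F m ≤ smooth ℝ F := by
  rintro _ ⟨q, hq, rfl⟩
  exact restrict_mem_smooth _ (Pol_contDiff hq)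

theorem W1_le_VPolOn : W1 T p ≤ VPolOn (body T) (p + 1) := by
  intro u hu
  obtain ⟨P, hP, Q, hQ, rfl⟩ := (mem_W1 0).1 hu
  exact ⟨_, add_mem (VPol_mono (by lia) hP) (VPol_cross_sub hQ 0), rfl⟩

theorem W2_le_VPolOn : W2 T p ≤ VPolOn (body T) (p + 1) := by
  intro u hu
  obtain ⟨P, hP, q, hq, rfl⟩ := (mem_W2 0).1 hu
  exact ⟨_, add_mem (VPol_mono (by lia) hP) (VPol_smul_sub hq 0), rfl⟩

variable {T p} in
theorem VPolOn_le_smooth {F : Set E3} {m : ℤ} : VPolOn F m ≤ smooth E3 F := by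
  rintro _ ⟨q, hq, rfl⟩
  exact restrict_mem_smooth _ (VPol_contDiff hq)

theorem W1_le_smooth : W1 T p ≤ smooth E3 (body T) := (W1_le_VPolOn T p).trans VPolOn_le_smooth

theorem W2_le_smooth : W2 T p ≤ smooth E3 (body T) := (W2_le_VPolOn T p).trans VPolOn_le_smooth

theorem grad_mem_smooth_of_PolOn {m : ℤ} {q : body T → ℝ} (hq : q ∈ PolOn (body T) m) :
    grad q ∈ smooth E3 (body T) := grad_mem_smooth T (PolOn_le_smooth hq)

-- In 2 Q + DQ x - (div Q) x, given by `gcurl_cross_sub`, only the last term can exceed degree p,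
-- and it has the form q x.
variable {T p} in
theorem curl_mem_W2 {u : body T → E3} (hu : u ∈ W1 T p) : curl u ∈ W2 T p := by
  obtain ⟨P, hP, Q, hQ, rfl⟩ := (mem_W1 0).1 hu
  have hP' := (VPol_contDiff hP).differentiable (by simp)
  have hQ' := (VPol_contDiff hQ).differentiable (by simp)
  have hC := (VPol_contDiff (VPol_cross_sub hQ 0)).differentiable (by simp)
  refine (mem_W2 0).2 ⟨_, add_mem (add_mem (VPol_mono (by lia) (VPol_gcurl hP))
    (Submodule.smul_mem _ (2 : ℝ) hQ)) (VPol_fderiv_sub hQ 0), _,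
    neg_mem (Pol_mono (by lia) (Pol_gdiv hQ)), ?_⟩
  rw [show (fun x => P x + cross (Q x) (x - 0)) = P + fun x => cross (Q x) (x - 0) from rfl,
    curl_restrict T (hP'.add hC), gcurl_add hP' hC]
  refine congrArg _ ?_
  funext x
  rw [Pi.add_apply, gcurl_cross_sub hQ']
  simp only [Pi.add_apply, Pi.smul_apply, Pi.neg_apply]
  module

variable {T p} in
theorem div_mem_PolOn {u : body T → E3} (hu : u ∈ W2 T p) : div u ∈ PolOn (body T) p := by
  obtain ⟨P, hP, q, hq, rfl⟩ := (mem_W2 0).1 hu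
  have hP' := (VPol_contDiff hP).differentiable (by simp)
  have hq' := (Pol_contDiff hq).differentiable (by simp)
  have hC := (VPol_contDiff (VPol_smul_sub hq 0)).differentiable (by simp)
  refine mem_PolOn.2 ⟨_, add_mem (Pol_mono (by lia) (Pol_gdiv hP))
    (add_mem (Submodule.smul_mem _ (3 : ℝ) hq) (Pol_fderiv_sub hq 0)), ?_⟩
  rw [show (fun x => P x + q x • (x - 0)) = P + fun x => q x • (x - 0) from rfl,
    div_restrict T (hP'.add hC), gdiv_add hP' hC]
  refine congrArg _ ?_
  funext x
  simp only [Pi.add_apply, gdiv_smul_sub hq', Pi.smul_apply, smul_eq_mul]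

variable {T p} in
theorem grad_mem_W1 {q : body T → ℝ} (hq : q ∈ PolOn (body T) (p + 1)) : grad q ∈ W1 T p := by
  obtain ⟨Q, hQ, rfl⟩ := mem_PolOn.1 hq
  rw [grad_restrict T ((Pol_contDiff hQ).differentiable (by simp))]
  refine (mem_W1 0).2 ⟨_, by simpa using VPol_ggrad hQ, 0, zero_mem _, congrArg _ ?_⟩
  funext x
  simp [cross_zero_left]

/-- The normal traces of fields in `W^2_p` on a face are polynomials of degree at most `p`. -/
theorem traceNor_mem_PolOn (i : Fin 4) {u : body T → E3} (hu : u ∈ W2 T p) :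
    traceNor T i u ∈ PolOn (face T i) p := by
  -- With a vertex of the face as centre, the term of degree p + 1 has no normal component on the
  -- face.
  obtain ⟨c, hc⟩ := face_nonempty i
  obtain ⟨P, hP, q, hq, rfl⟩ := (mem_W2 (T c)).1 hu
  rw [traceNor_restrict]
  refine mem_PolOn.2 ⟨_, Pol_inner hP (normal T i), restrict_congr fun x hx => ?_⟩
  rw [inner_add_left, real_inner_smul_left, real_inner_comm (normal T i) (x - T c),
    inner_normal_sub_of_mem T hx (vertex_mem_facet T hc), mul_zero, add_zero]

theorem sub_eq_smul (e : Edge) {w : E3} (hw : ∀ l ∉ e.verts, inner ℝ (gradBary T l) w = 0) :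
    w = inner ℝ (gradBary T e.1.2) w • (T e.1.2 - T e.1.1) := by
  have hne : e.1.1 ≠ e.1.2 := e.2.ne
  have h1 := sum_inner_gradBary T w
  have h2 := eq_sum_inner_gradBary T w
  rw [← Finset.sum_subset (Finset.subset_univ e.verts) fun l _ hl => hw l hl, Edge.verts,
    Finset.sum_pair hne] at h1
  rw [← Finset.sum_subset (Finset.subset_univ e.verts) fun l _ hl => by rw [hw l hl, zero_smul],
    Edge.verts, Finset.sum_pair hne, eq_neg_of_add_eq_zero_left h1] at h2
  rw [smul_sub, sub_eq_neg_add, ← neg_smul]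
  exact h2

theorem sub_eq_smul_tangent (e : Edge) {x : E3} (hx : x ∈ edge T e) :
    x - T e.1.1 = (T.coord e.1.2 x * ‖T e.1.2 - T e.1.1‖) • tangent T e := by
  have hne : e.1.1 ≠ e.1.2 := e.2.ne
  have h0 : T e.1.1 ∈ edge T e := vertex_mem_facet T (by simp [Edge.verts])
  have h1 := sub_eq_smul T e fun l hl => inner_gradBary_sub_of_mem T hx h0 hl
  have h2 : ‖T e.1.2 - T e.1.1‖ ≠ 0 := norm_ne_zero_iff.2
    (sub_ne_zero.2 fun h => hne (T.ind.injective h).symm)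
  rw [← coord_sub, coord_vertex, if_neg hne.symm, sub_zero] at h1
  rw [h1, tangent, smul_smul, mul_assoc, mul_inv_cancel₀ h2, mul_one]

/-- The tangential traces of fields in `W^1_p` on an edge are polynomials of degree at most
`p`. -/
theorem traceEdge_mem_PolOn (e : Edge) {u : body T → E3} (hu : u ∈ W1 T p) :
    traceEdge T e u ∈ PolOn (edge T e) p := by
  obtain ⟨P, hP, Q, hQ, rfl⟩ := (mem_W1 (T e.1.1)).1 hu
  rw [traceEdge_restrict]
  refine mem_PolOn.2 ⟨_, Pol_inner hP (tangent T e), restrict_congr fun x hx => ?_⟩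
  rw [inner_add_left, inner_cross_left, sub_eq_smul_tangent T e hx, cross_smul, cross_self,
    smul_zero, inner_zero_right, add_zero]

end Geometry

/-! ### The projections -/

instance VPol_finiteDimensional (m : ℤ) : FiniteDimensional ℝ (VPol m) := by
  let f : VPol m →ₗ[ℝ] (Fin 3 → Pol m) := LinearMap.pi fun k =>
    ((component k).comp (VPol m).subtype).codRestrict (Pol m) fun P => mem_VPol.1 P.2 k
  refine Module.Finite.of_injective f fun P Q h => Subtype.ext (funext fun x => ?_)
  ext k
  exact congrFun (congrArg Subtype.val (congrFun h k)) x

instance PolOn_finiteDimensional (F : Set E3) (m : ℤ) : FiniteDimensional ℝ (PolOn F m) := by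
  unfold PolOn; infer_instance

instance VPolOn_finiteDimensional (F : Set E3) (m : ℤ) : FiniteDimensional ℝ (VPolOn F m) := by
  unfold VPolOn; infer_instance

section Geometry

variable (T : Tet) (p : ℕ)

theorem smooth_le_sqInt {d : ℕ} {s : Finset (Fin 4)} (hs : s.card = d + 1) {V : Type*}
    [NormedAddCommGroup V] [InnerProductSpace ℝ V] : smooth V (facet T s) ≤ sqInt (facet T s) V d :=
  fun _ hu => smooth_memLp T hs hu 2

/-- The space `W2Z_face` as a submodule. -/
noncomputable def W2ZfaceSub (i : Fin 4) : Submodule ℝ (face T i → ℝ) where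
  carrier := W2Z_face T p i
  add_mem' {u v} hu hv := ⟨add_mem hu.1 hv.1, by
    have h : ∀ w ∈ W2Z_face T p i, Integrable w (μHE[2] : Measure (face T i)) := by
      rintro _ ⟨⟨w, hw, rfl⟩, -⟩
      exact smooth_integrable T (card_face i) (traceNor_mem_smooth T i (W2_le_smooth T p hw))
    have := integral_add (h u hu) (h v hv)
    rw [hu.2, hv.2, add_zero] at this
    exact this⟩
  zero_mem' := ⟨zero_mem _, by simp⟩
  smul_mem' c u hu := ⟨Submodule.smul_mem _ c hu.1, by
    have := integral_const_mul c u (μ := (μHE[2] : Measure (face T i)))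
    rw [hu.2, mul_zero] at this
    exact this⟩

theorem W2ZfaceSub_le_PolOn (i : Fin 4) : W2ZfaceSub T p i ≤ PolOn (face T i) p := by
  rintro _ ⟨⟨w, hw, rfl⟩, -⟩
  exact traceNor_mem_PolOn T p i hw

instance (i : Fin 4) : FiniteDimensional ℝ (W2ZfaceSub T p i) :=
  Submodule.finiteDimensional_of_le (W2ZfaceSub_le_PolOn T p i)

/-- The divergence free fields in `W2Z` as a submodule. -/
noncomputable def W2ZdivSub : Submodule ℝ (body T → E3) where
  carrier := {v | v ∈ W2Z T p ∧ div v = 0}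
  add_mem' {u v} hu hv := ⟨⟨add_mem hu.1.1 hv.1.1, fun i => by
    rw [map_add, hu.1.2, hv.1.2, add_zero]⟩, by
    have := div_linear T 1 (W2_le_smooth T p hu.1.1) (W2_le_smooth T p hv.1.1)
    rw [hu.2, hv.2, one_smul] at this
    rw [this]; simp⟩
  zero_mem' := ⟨⟨zero_mem _, fun i => map_zero _⟩, by
    have := div_sub T (zero_mem (smooth E3 (body T))) (zero_mem _)
    simpa using this⟩
  smul_mem' c u hu := ⟨⟨Submodule.smul_mem _ c hu.1.1, fun i => by
    rw [map_smul, hu.1.2, smul_zero]⟩, by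
    have := div_linear T c (W2_le_smooth T p hu.1.1) (zero_mem _)
    have h0 := div_sub T (zero_mem (smooth E3 (body T))) (zero_mem _)
    rw [sub_self, sub_self] at h0
    rw [h0, hu.2, add_zero, smul_zero, add_zero] at this
    exact this⟩

instance : FiniteDimensional ℝ (W2ZdivSub T p) :=
  Submodule.finiteDimensional_of_le (S₂ := VPolOn (body T) (p + 1))
    fun _ hv => W2_le_VPolOn T p hv.1.1

/-- The polynomials with vanishing integral as a submodule. -/
noncomputable def PolZSub : Submodule ℝ (body T → ℝ) where
  carrier := {v | v ∈ PolOn (body T) p ∧ ∫ x, v x ∂μHE[3] = 0}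
  add_mem' {u v} hu hv := ⟨add_mem hu.1 hv.1, by
    have := integral_add (smooth_integrable T card_body (PolOn_le_smooth hu.1))
      (smooth_integrable T card_body (PolOn_le_smooth hv.1))
    rw [hu.2, hv.2, add_zero] at this
    exact this⟩
  zero_mem' := ⟨zero_mem _, by simp⟩
  smul_mem' c u hu := ⟨Submodule.smul_mem _ c hu.1, by
    have := integral_const_mul c u (μ := (μHE[3] : Measure (body T)))
    rw [hu.2, mul_zero] at this
    exact this⟩

instance : FiniteDimensional ℝ (PolZSub T p) :=
  Submodule.finiteDimensional_of_le (S₂ := PolOn (body T) p) fun _ hv => hv.1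

variable {T p}

theorem P2_face_mem (ε : ℝ) (i : Fin 4) (u : face T i → ℝ) :
    P2_face T p ε i u ∈ W2Z_face T p i := orthProj_mem _ (W2ZfaceSub T p i) u

theorem W2ZfaceSub_le_smooth (i : Fin 4) : W2ZfaceSub T p i ≤ smooth ℝ (face T i) :=
  (W2ZfaceSub_le_PolOn T p i).trans PolOn_le_smooth

/-- The order 1/2 - ε lies in (0, 1/2), where `riesz_face_injective` applies. -/
theorem P2_face_linear {ε : ℝ} (hε : 0 < ε) (hε' : ε < 1 / 2) (i : Fin 4) {u v : face T i → ℝ}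
    (hu : u ∈ smooth ℝ (face T i)) (hv : v ∈ smooth ℝ (face T i)) (c : ℝ) :
    P2_face T p ε i (c • u + v) = c • P2_face T p ε i u + P2_face T p ε i v :=
  orthProj_linear (X := W2ZfaceSub T p i) (Y := sqInt (face T i) ℝ 2)
    ((W2ZfaceSub_le_smooth i).trans (smooth_le_sqInt T (card_face i)))
    (riesz (facetInt T {i}ᶜ) 2 (1 / 2 - ε)) (innerNeg_eq _ _ _)
    (fun x hx => riesz_face_injective T (card_face i) (by linarith) (by linarith) x
      (W2ZfaceSub_le_smooth i hx))
    (smooth_le_sqInt T (card_face i) hu) (smooth_le_sqInt T (card_face i) hv) c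

theorem P2_face_self {ε : ℝ} (hε : 0 < ε) (hε' : ε < 1 / 2) (i : Fin 4) {u : face T i → ℝ}
    (hu : u ∈ W2Z_face T p i) : P2_face T p ε i u = u :=
  orthProj_self (X := W2ZfaceSub T p i) (Y := sqInt (face T i) ℝ 2)
    ((W2ZfaceSub_le_smooth i).trans (smooth_le_sqInt T (card_face i)))
    (riesz (facetInt T {i}ᶜ) 2 (1 / 2 - ε)) (innerNeg_eq _ _ _)
    (fun x hx => riesz_face_injective T (card_face i) (by linarith) (by linarith) x
      (W2ZfaceSub_le_smooth i hx)) hu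

theorem P2_T_mem (u : body T → E3) : P2_T T p u ∈ W2Z T p ∧ div (P2_T T p u) = 0 :=
  orthProj_mem _ (W2ZdivSub T p) u

theorem W2ZdivSub_le_smooth : W2ZdivSub T p ≤ smooth E3 (body T) :=
  fun _ hv => W2_le_smooth T p hv.1.1

theorem P2_T_linear {u v : body T → E3} (hu : u ∈ smooth E3 (body T))
    (hv : v ∈ smooth E3 (body T)) (c : ℝ) :
    P2_T T p (c • u + v) = c • P2_T T p u + P2_T T p v :=
  orthProj_linear (X := W2ZdivSub T p) (Y := sqInt (body T) E3 3)
    (W2ZdivSub_le_smooth.trans (smooth_le_sqInt T card_body)) (sqIntToLp (body T) E3 3)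
    (innerL2_eq 3) (fun x hx => sqIntToLp_injective T x (W2ZdivSub_le_smooth hx))
    (smooth_le_sqInt T card_body hu) (smooth_le_sqInt T card_body hv) c

theorem P2_T_self {u : body T → E3} (hu : u ∈ W2Z T p) (hd : div u = 0) : P2_T T p u = u :=
  orthProj_self (X := W2ZdivSub T p) (Y := sqInt (body T) E3 3)
    (W2ZdivSub_le_smooth.trans (smooth_le_sqInt T card_body)) (sqIntToLp (body T) E3 3)
    (innerL2_eq 3) (fun x hx => sqIntToLp_injective T x (W2ZdivSub_le_smooth hx)) ⟨hu, hd⟩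

theorem P3_T_mem (u : body T → ℝ) :
    P3_T T p u ∈ PolOn (body T) p ∧ ∫ x, P3_T T p u x ∂μHE[3] = 0 :=
  orthProj_mem _ (PolZSub T p) u

theorem PolZSub_le_smooth : PolZSub T p ≤ smooth ℝ (body T) := fun _ hv => PolOn_le_smooth hv.1

theorem P3_T_linear {u v : body T → ℝ} (hu : u ∈ smooth ℝ (body T))
    (hv : v ∈ smooth ℝ (body T)) (c : ℝ) :
    P3_T T p (c • u + v) = c • P3_T T p u + P3_T T p v :=
  orthProj_linear (X := PolZSub T p) (Y := sqInt (body T) ℝ 3)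
    (PolZSub_le_smooth.trans (smooth_le_sqInt T card_body)) (sqIntToLp (body T) ℝ 3)
    (innerL2_eq 3) (fun x hx => sqIntToLp_injective T x (PolZSub_le_smooth hx))
    (smooth_le_sqInt T card_body hu) (smooth_le_sqInt T card_body hv) c

theorem P3_T_self {u : body T → ℝ} (hu : u ∈ PolOn (body T) p) (h0 : ∫ x, u x ∂μHE[3] = 0) :
    P3_T T p u = u :=
  orthProj_self (X := PolZSub T p) (Y := sqInt (body T) ℝ 3)
    (PolZSub_le_smooth.trans (smooth_le_sqInt T card_body)) (sqIntToLp (body T) ℝ 3)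
    (innerL2_eq 3) (fun x hx => sqIntToLp_injective T x (PolZSub_le_smooth hx)) ⟨hu, h0⟩

end Geometry

section Geometry

variable (T : Tet) (p : ℕ)

/-! ### Liftings on edges -/

theorem eq_vertex_of_coord_eq_zero (e : Edge) {x : E3} (hx : x ∈ edge T e)
    (h : ∃ l ∈ e.verts, T.coord l x = 0) : x = T e.1.1 ∨ x = T e.1.2 := by
  have hne : e.1.1 ≠ e.1.2 := e.2.ne
  have h0 : T e.1.1 ∈ edge T e := vertex_mem_facet T (by simp [Edge.verts])
  have h1 := sub_eq_smul T e fun l hl => inner_gradBary_sub_of_mem T hx h0 hl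
  rw [← coord_sub, coord_vertex, if_neg hne.symm, sub_zero] at h1
  obtain ⟨l, hl, hl0⟩ := h
  rcases (by simpa [Edge.verts] using hl : l = e.1.1 ∨ l = e.1.2) with rfl | rfl
  · right
    have h2 := T.sum_coord_apply_eq_one x
    rw [← Finset.sum_subset (Finset.subset_univ e.verts)
      fun l _ hl => ((mem_facet T).1 hx).2 l hl, Edge.verts, Finset.sum_pair hne, hl0, zero_add] at h2
    rw [h2, one_smul] at h1
    simpa using h1
  · left
    rw [hl0, zero_smul, sub_eq_zero] at h1
    exact h1

theorem mean_singleton (l : Fin 4) (G : E3 → ℝ) : mean T {l} G = G (T l) := by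
  rw [← mean_const T (Finset.singleton_nonempty l) (G (T l))]
  refine mean_congr T fun x hx => congrArg G ?_
  have h1 := eq_sum_inner_gradBary T (x - T l)
  have h2 := sum_inner_gradBary T (x - T l)
  have h3 : ∀ m, m ≠ l → inner ℝ (gradBary T m) (x - T l) = 0 := fun m hm =>
    inner_gradBary_sub_of_mem T hx (vertex_mem_facet T (Finset.mem_singleton_self l)) (by simpa)
  rw [Fintype.sum_eq_single l h3] at h2
  rw [Fintype.sum_eq_single l fun m hm => by rw [h3 m hm, zero_smul], h2, zero_smul] at h1
  exact sub_eq_zero.1 h1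

/-- Let A and B be the ends of the edge. The product of the barycentric coordinate of B with the
radial integral of `G` from A has derivative `G` along B - A and vanishes at A. It vanishes at B
because `G` has mean zero. Division by μ accounts for τ = μ (B - A). -/
theorem exists_antiderivative (e : Edge) {τ : E3} (hτ : τ ≠ 0)
    (ht : ∀ l ∉ e.verts, inner ℝ (gradBary T l) τ = 0) {G : E3 → ℝ} (hG : G ∈ Pol p)
    (h0 : mean T e.verts G = 0) :
    ∃ q ∈ Pol0 T e.verts ((p : ℤ) + 1), ∀ x, deriv q x τ = restrict (edge T e) G x := by
  have hne : e.1.1 ≠ e.1.2 := e.2.ne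
  have hA : T e.1.1 ∈ edge T e := vertex_mem_facet T (by simp [Edge.verts])
  set μ := inner ℝ (gradBary T e.1.2) τ
  have hτμ : τ = μ • (T e.1.2 - T e.1.1) := sub_eq_smul T e ht
  have hμ : μ ≠ 0 := fun h => hτ (by rw [hτμ, h, zero_smul])
  have hGc := Pol_contDiff hG
  set r := radial 0 (T e.1.1) G
  have hr : r ∈ Pol p := radial_mem_Pol hG 0 _
  have hrd := (Pol_contDiff hr).differentiable (by simp)
  set Q : E3 → ℝ := fun x => T.coord e.1.2 x * r x
  have hQ : Q ∈ Pol (p + 1) := by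
    have := Pol_mul (Pol_barycentric T e.1.2) hr
    rwa [add_comm] at this
  have hQd : ∀ x ∈ edge T e, fderiv ℝ Q x (T e.1.2 - T e.1.1) = G x := by
    intro x hx
    have h1 := ((hasFDerivAt_coord T e.1.2 x).mul (hrd x).hasFDerivAt).fderiv
    have h2 := radial_euler hGc 0 (T e.1.1) x
    have h3 := sub_eq_smul T e fun l hl => inner_gradBary_sub_of_mem T hx hA hl
    rw [← coord_sub, coord_vertex, if_neg hne.symm, sub_zero] at h3
    have h4 : (T.coord e.1.2).linear (T e.1.2 - T e.1.1) = 1 := by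
      rw [← inner_gradBary, inner_gradBary_sub]; simp [hne.symm]
    rw [h3, map_smul] at h2
    rw [show Q = (fun x => T.coord e.1.2 x) * r from rfl, h1]
    simp only [_root_.add_apply, _root_.smul_apply,
      LinearMap.coe_toContinuousLinearMap', smul_eq_mul, h4]
    simp only [smul_eq_mul, Nat.cast_zero, zero_add, one_mul] at h2
    change _ + r x * 1 = _
    rw [← h2]; ring
  have hQA : Q (T e.1.1) = 0 := by simp [Q, hne.symm]
  have hQB : Q (T e.1.2) = 0 := by
    have h1 := mean_fderiv T (card_verts e : e.verts.card = 0 + 2) (j := e.1.1) (k := e.1.2)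
      (by simp [Edge.verts]) (by simp [Edge.verts]) hne (Pol_contDiff hQ)
    rw [mean_congr T hQd, h0, show e.verts.erase e.1.1 = {e.1.2} by simp [Edge.verts, hne],
      show e.verts.erase e.1.2 = {e.1.1} by simp [Edge.verts, Finset.pair_comm e.1.1, hne.symm],
      mean_singleton, mean_singleton, hQA, sub_zero, volume_refS_zero, volume_refS_one] at h1
    linarith
  refine ⟨μ⁻¹ • restrict (edge T e) Q, Submodule.smul_mem _ _ ⟨⟨Q, hQ, rfl⟩, fun x hx => ?_⟩,
    fun x => ?_⟩
  · rcases eq_vertex_of_coord_eq_zero T e x.2 hx with h | h <;> rw [restrict_apply, h]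
    exacts [hQA, hQB]
  · rw [← map_smul, deriv_facet T x ((((Pol_contDiff hQ).differentiable (by simp)) x).const_smul _) ht,
      fderiv_const_smul (((Pol_contDiff hQ).differentiable (by simp)) x), restrict_apply,
      _root_.smul_apply, hτμ, map_smul, hQd x x.2, smul_eq_mul, smul_eq_mul,
      inv_mul_cancel_left₀ hμ]

theorem eq_of_fderiv_eq_zero {s : Finset (Fin 4)} {Φ : E3 → ℝ} (hΦ : ContDiff ℝ ∞ Φ) {a x : E3}
    (ha : a ∈ facet T s) (hx : x ∈ facet T s)
    (h : ∀ y ∈ facet T s, fderiv ℝ Φ y (x - a) = 0) : Φ x = Φ a := by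
  have h1 : ∀ t ∈ Set.uIcc (0 : ℝ) 1, HasDerivAt (fun t : ℝ => Φ (a + t • (x - a))) 0 t := by
    intro t ht
    rw [Set.uIcc_of_le zero_le_one] at ht
    have h2 : HasDerivAt (fun t : ℝ => a + t • (x - a)) (x - a) t := by
      simpa using ((hasDerivAt_id t).smul_const (x - a)).const_add a
    have h3 := ((hΦ.differentiable (by simp)) (a + t • (x - a))).hasFDerivAt.comp_hasDerivAt t h2
    rwa [h _ (facet_star T ha hx ht)] at h3
  have h2 := intervalIntegral.integral_eq_sub_of_hasDerivAt h1 (by simp)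
  simp at h2
  linarith

theorem Pol0_edge_eq (e : Edge) {τ : E3} (hτ : τ ≠ 0)
    (ht : ∀ l ∉ e.verts, inner ℝ (gradBary T l) τ = 0) {m : ℤ} {q q' : edge T e → ℝ}
    (hq : q ∈ Pol0 T e.verts m) (hq' : q' ∈ Pol0 T e.verts m)
    (h : ∀ x, deriv q x τ = deriv q' x τ) : q = q' := by
  obtain ⟨⟨Q, hQ, rfl⟩, hQ0⟩ := hq
  obtain ⟨⟨Q', hQ', rfl⟩, hQ0'⟩ := hq'
  have hne : e.1.1 ≠ e.1.2 := e.2.ne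
  have hA : T e.1.1 ∈ edge T e := vertex_mem_facet T (by simp [Edge.verts])
  have hA0 : ∃ l ∈ e.verts, T.coord l (T e.1.1) = 0 :=
    ⟨e.1.2, by simp [Edge.verts], by rw [coord_vertex, if_neg hne.symm]⟩
  have hτμ := sub_eq_smul T e ht
  have hμ : inner ℝ (gradBary T e.1.2) τ ≠ 0 := fun h => hτ (by rw [hτμ, h, zero_smul])
  have hd := (Pol_contDiff hQ).differentiable (by simp)
  have hd' := (Pol_contDiff hQ').differentiable (by simp)
  funext x
  have h1 := eq_of_fderiv_eq_zero T (Pol_contDiff (sub_mem hQ hQ')) hA x.2 fun y hy => by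
    have h2 := h ⟨y, hy⟩
    rw [deriv_facet T ⟨y, hy⟩ (hd y) ht, deriv_facet T ⟨y, hy⟩ (hd' y) ht, hτμ, map_smul,
      map_smul] at h2
    have h3 := smul_right_injective ℝ hμ h2
    rw [sub_eq_smul T e fun l hl => inner_gradBary_sub_of_mem T x.2 hA hl, map_smul,
      fderiv_sub (hd y) (hd' y), _root_.sub_apply]
    dsimp only at h3 ⊢
    rw [h3, sub_self, smul_zero]
  have e1 := hQ0 ⟨_, hA⟩ hA0
  have e2 := hQ0' ⟨_, hA⟩ hA0
  simp only [restrict_apply, Pi.sub_apply] at h1 e1 e2 ⊢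
  linarith

variable {T p}

/-- The default value 0 belongs to the space as well, so this and the two analogues below hold for
every `u`. For the stages of `Pi1` that are gradients nothing else is needed: the potential is
polynomial, and its gradient has no curl. -/
theorem L1_edge_mem (e : Edge) (τ : E3) (u : edge T e → ℝ) :
    L1_edge T p e τ u ∈ Pol0 T e.verts ((p : ℤ) + 1) := by
  unfold L1_edge
  split_ifs with h
  · exact h.choose_spec.1
  · exact zero_mem _

theorem L1_face_mem (i : Fin 4) (u : face T i → E3) :
    L1_face T p i u ∈ Pol0 T {i}ᶜ ((p : ℤ) + 1) := by
  unfold L1_face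
  split_ifs with h
  · exact h.choose_spec.1
  · exact zero_mem _

theorem L1_T_mem (u : body T → E3) : L1_T T p u ∈ Pol0 T Finset.univ ((p : ℤ) + 1) := by
  unfold L1_T
  split_ifs with h
  · exact h.choose_spec.1
  · exact zero_mem _

theorem L1_edge_eq (e : Edge) {τ : E3} (hτ : τ ≠ 0)
    (ht : ∀ l ∉ e.verts, inner ℝ (gradBary T l) τ = 0) {u q : edge T e → ℝ}
    (hq : q ∈ Pol0 T e.verts ((p : ℤ) + 1)) (h : ∀ x, deriv q x τ = u x) :
    L1_edge T p e τ u = q := by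
  have hex : ∃ q ∈ Pol0 T e.verts ((p : ℤ) + 1), ∀ x, deriv q x τ = u x := ⟨q, hq, h⟩
  rw [L1_edge, dif_pos hex]
  refine Pol0_edge_eq T e hτ ht hex.choose_spec.1 hq fun x => ?_
  rw [hex.choose_spec.2, h]

theorem L1_edge_spec (e : Edge) {τ : E3} (hτ : τ ≠ 0)
    (ht : ∀ l ∉ e.verts, inner ℝ (gradBary T l) τ = 0) {G : E3 → ℝ} (hG : G ∈ Pol p)
    (h0 : mean T e.verts G = 0) (x : edge T e) :
    deriv (L1_edge T p e τ (restrict (edge T e) G)) x τ = G x := by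
  obtain ⟨q, hq, h⟩ := exists_antiderivative T p e hτ ht hG h0
  rw [L1_edge_eq e hτ ht hq h, h, restrict_apply]

theorem L1_edge_linear (e : Edge) {τ : E3} (hτ : τ ≠ 0)
    (ht : ∀ l ∉ e.verts, inner ℝ (gradBary T l) τ = 0) {G H : E3 → ℝ} (hG : G ∈ Pol p)
    (hG0 : mean T e.verts G = 0) (hH : H ∈ Pol p) (hH0 : mean T e.verts H = 0) (c : ℝ) :
    L1_edge T p e τ (restrict (edge T e) (c • G + H)) =
      c • L1_edge T p e τ (restrict (edge T e) G) + L1_edge T p e τ (restrict (edge T e) H) := by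
  refine L1_edge_eq e hτ ht (add_mem (Submodule.smul_mem _ c (L1_edge_mem e τ _))
    (L1_edge_mem e τ _)) fun x => ?_
  have h1 := L1_edge_spec e hτ ht hG hG0 x
  have h2 := L1_edge_spec e hτ ht hH hH0 x
  obtain ⟨⟨Q, hQ, hQ'⟩, -⟩ := L1_edge_mem (T := T) (p := p) e τ (restrict (edge T e) G)
  obtain ⟨⟨Q₂, hQ₂, hQ₂'⟩, -⟩ := L1_edge_mem (T := T) (p := p) e τ (restrict (edge T e) H)
  rw [← hQ'] at h1 ⊢
  rw [← hQ₂'] at h2 ⊢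
  have d1 := (Pol_contDiff hQ).differentiable (by simp) x
  have d2 := (Pol_contDiff hQ₂).differentiable (by simp) x
  rw [deriv_facet T x d1 ht] at h1
  rw [deriv_facet T x d2 ht] at h2
  rw [← map_smul, ← map_add, deriv_facet T x ((d1.const_smul c).add d2) ht,
    fderiv_add (d1.const_smul c) d2, fderiv_const_smul d1]
  simp only [_root_.add_apply, _root_.smul_apply, h1, h2]
  rfl

end Geometry

theorem edge_eq_of_verts : ∀ e e' : Edge, e.verts = e'.verts → e = e' := by decide

theorem exists_edge : ∀ i l : Fin 4, l ≠ i → ∃ e : Edge, e.verts = {i, l}ᶜ := by decide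

section Geometry

variable (T : Tet)

/-! ### Edges of a face -/

/-- The projection of the gradient of a barycentric coordinate function to the plane of a face. -/
noncomputable def gradIn (i l : Fin 4) : E3 :=
  gradBary T l - inner ℝ (gradBary T l) (normal T i) • normal T i

theorem inplaneNormal_eq (i l : Fin 4) :
    inplaneNormal T i l = (-‖gradIn T i l‖⁻¹) • gradIn T i l := rfl

theorem inner_gradIn {i l : Fin 4} {w : E3} (hw : inner ℝ (normal T i) w = 0) :
    inner ℝ (gradIn T i l) w = inner ℝ (gradBary T l) w := by
  rw [gradIn, inner_sub_left, real_inner_smul_left, hw, mul_zero, sub_zero]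

theorem inner_normal_gradIn (i l : Fin 4) : inner ℝ (normal T i) (gradIn T i l) = 0 := by
  rw [gradIn, inner_sub_right, real_inner_smul_right, inner_normal_self, mul_one, real_inner_comm,
    sub_self]

theorem inner_normal_vertex_sub {i j k : Fin 4} (hj : j ≠ i) (hk : k ≠ i) :
    inner ℝ (normal T i) (T j - T k) = 0 :=
  inner_normal_sub_of_mem T (vertex_mem_facet T (by simpa)) (vertex_mem_facet T (by simpa))

theorem gradIn_ne_zero {i l : Fin 4} (hl : l ≠ i) : gradIn T i l ≠ 0 := by
  obtain ⟨k, hki, hkl⟩ : ∃ k : Fin 4, k ≠ i ∧ k ≠ l := by decide +revert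
  intro h
  have h1 := inner_gradIn T (l := l) (inner_normal_vertex_sub T hl hki)
  rw [h, inner_zero_left, inner_gradBary_sub, if_pos rfl, if_neg hkl.symm] at h1
  norm_num at h1

/-- The tangent vector `n_f × n_{e,f}`. -/
noncomputable def edgeDir (i l : Fin 4) : E3 := cross (normal T i) (inplaneNormal T i l)

theorem edgeDir_ne_zero {i l : Fin 4} (hl : l ≠ i) : edgeDir T i l ≠ 0 := by
  intro h
  have h1 := inner_cross_cross (normal T i) (inplaneNormal T i l) (normal T i)
    (inplaneNormal T i l)
  have h2 : inner ℝ (normal T i) (inplaneNormal T i l) = 0 := by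
    rw [inplaneNormal_eq, real_inner_smul_right, inner_normal_gradIn, mul_zero]
  rw [edgeDir] at h
  rw [h, h2, inner_zero_left, inner_normal_self, zero_mul, sub_zero, one_mul, eq_comm,
    inner_self_eq_zero, inplaneNormal_eq, smul_eq_zero] at h1
  simp [gradIn_ne_zero T hl] at h1

theorem edgeDir_tangential {i l : Fin 4} {e : Edge} (he : e.verts = {i, l}ᶜ) :
    ∀ m ∉ e.verts, inner ℝ (gradBary T m) (edgeDir T i l) = 0 := by
  intro m hm
  have h1 : inner ℝ (normal T i) (edgeDir T i l) = 0 := by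
    rw [real_inner_comm]; exact inner_cross_self_left _ _
  rw [he] at hm
  rcases (by simp at hm; tauto : m = i ∨ m = l) with rfl | rfl
  · exact (inner_gradBary_eq_zero_iff T m _).2 h1
  · rw [← inner_gradIn T h1, edgeDir, inplaneNormal_eq, cross_smul_right, real_inner_smul_right,
      real_inner_comm, inner_cross_self_right, mul_zero]

theorem edge_subset_face {i l : Fin 4} {e : Edge} (he : e.verts = {i, l}ᶜ) :
    edge T e ⊆ face T i := facet_mono T (by rw [he]; intro m; simp; tauto)

theorem mem_edge {i l : Fin 4} {e : Edge} (he : e.verts = {i, l}ᶜ) {x : E3} (hx : x ∈ face T i)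
    (h0 : T.coord l x = 0) : x ∈ edge T e := by
  rw [mem_facet] at hx ⊢
  refine ⟨hx.1, fun m hm => ?_⟩
  rw [he] at hm
  rcases (by simp at hm; tauto : m = i ∨ m = l) with rfl | rfl
  · exact hx.2 m (by simp)
  · exact h0

theorem inner_inplaneNormal {i l : Fin 4} {w : E3} (hw : inner ℝ (normal T i) w = 0) :
    inner ℝ w (inplaneNormal T i l) = -‖gradIn T i l‖⁻¹ * inner ℝ (gradBary T l) w := by
  rw [inplaneNormal_eq, real_inner_smul_right, real_inner_comm, inner_gradIn T hw]

theorem traceTan_grad (i : Fin 4) {ψ : body T → ℝ} (hψ : ψ ∈ smooth ℝ (body T)) :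
    traceTan T i (grad ψ) = bcurl T i (res (face T i) ψ) := by
  obtain ⟨Φ, hΦ, rfl⟩ := mem_smooth.1 hψ
  have hd := hΦ.differentiable (by simp)
  rw [grad_restrict T hd, traceTan_restrict, res_restrict (facet_subset_body T _), bcurl_restrict T hd]

/-- On an edge, the in-plane normal component of a surface rotation is the derivative along the
edge. -/
theorem inner_bcurl {i l : Fin 4} {e : Edge} (he : e.verts = {i, l}ᶜ) {ψ : body T → ℝ}
    (hψ : ψ ∈ smooth ℝ (body T)) {x : E3} (hx : x ∈ edge T e) :
    inner ℝ (bcurl T i (res (face T i) ψ) ⟨x, edge_subset_face T he hx⟩) (inplaneNormal T i l) =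
      deriv (res (edge T e) ψ) ⟨x, hx⟩ (edgeDir T i l) := by
  obtain ⟨Φ, hΦ, rfl⟩ := mem_smooth.1 hψ
  have hd := hΦ.differentiable (by simp)
  rw [res_restrict (facet_subset_body T _), res_restrict (facet_subset_body T _),
    bcurl_restrict T hd, restrict_apply, deriv_facet T ⟨x, hx⟩ (hd x) (edgeDir_tangential T he),
    inner_cross_left, inner_ggrad]
  rfl

/-! ### The lifting on a face -/

variable (p : ℕ)

theorem R2D_restrict {i c : Fin 4} (hc : c ≠ i) (q : E3 → ℝ) :
    R2D T i (T c) (restrict (face T i) q) =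
      restrict (face T i) fun x => radial 1 (T c) q x • (x - T c) := by
  funext x
  rw [R2D, restrict_apply, radial]
  congr 1
  refine intervalIntegral.integral_congr fun t ht => ?_
  rw [Set.uIcc_of_le zero_le_one] at ht
  rw [ext0_restrict _ (facet_star T (vertex_mem_facet T (by simpa)) x.2 ht), pow_one, smul_eq_mul]

/-- The field whose tangential trace is `R2D`. -/
noncomputable def liftField (i c : Fin 4) (q : E3 → ℝ) : E3 → E3 := fun x =>
  cross (radial 1 (T c) q x • normal T i) (x - T c)

variable {T p}

theorem liftField_mem_W1 (i c : Fin 4) {q : E3 → ℝ} (hq : q ∈ Pol p) :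
    restrict (body T) (liftField T i c q) ∈ W1 T p := by
  refine (mem_W1 (T c)).2 ⟨0, zero_mem _, _, VPol_smul_const (radial_mem_Pol hq 1 (T c)) (normal T i),
    congrArg _ ?_⟩
  funext x
  simp [liftField]

/-- On the face x - a is orthogonal to n, so (r n × (x - a)) × n = r (x - a). The lifting on the
face thus becomes the trace of a field in W^1_p(T), whose curl is available. -/
theorem traceTan_liftField {i c : Fin 4} (hc : c ≠ i) (q : E3 → ℝ) :
    traceTan T i (restrict (body T) (liftField T i c q)) =
      R2D T i (T c) (restrict (face T i) q) := by
  rw [R2D_restrict T hc, traceTan_restrict]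
  refine restrict_congr fun x hx => ?_
  have h := inner_normal_sub_of_mem T hx (vertex_mem_facet T (by simpa : c ∈ ({i}ᶜ : Finset (Fin 4))))
  rw [liftField, cross_smul, cross_smul, cross_cross, inner_normal_self, real_inner_comm, h, one_smul,
    zero_smul, sub_zero]

/-- In the normal component of `gcurl_cross_sub` the term along x - a drops out. What remains is 2 r
+ Dr (x - a), which is `q` by `radial_euler` with k = 1. -/
theorem traceNor_curl_liftField {i c : Fin 4} (hc : c ≠ i) {q : E3 → ℝ} (hq : q ∈ Pol p) :
    traceNor T i (curl (restrict (body T) (liftField T i c q))) = restrict (face T i) q := by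
  have hr := radial_mem_Pol hq 1 (T c)
  have hrd := (Pol_contDiff hr).differentiable (by simp)
  have hQ := VPol_contDiff (VPol_smul_const hr (normal T i))
  have hL := VPol_contDiff (VPol_cross_sub (VPol_smul_const hr (normal T i)) (T c))
  rw [show liftField T i c q = fun y => cross (radial 1 (T c) q y • normal T i) (y - T c) from rfl,
    curl_restrict T (hL.differentiable (by simp)), traceNor_restrict]
  refine restrict_congr fun x hx => ?_
  have h := inner_normal_sub_of_mem T hx (vertex_mem_facet T (by simpa : c ∈ ({i}ᶜ : Finset (Fin 4))))
  have h2 := radial_euler (Pol_contDiff hq) 1 (T c) x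
  have h3 := fderiv_smul_apply hrd (differentiable_const (normal T i)) x (x - T c)
  have h4 := gcurl_cross_sub (hQ.differentiable (by simp)) (T c) x
  rw [h4, h3, inner_sub_left, inner_add_left, inner_add_left, real_inner_smul_left,
    real_inner_smul_left, real_inner_smul_left, real_inner_smul_left, real_inner_smul_left,
    inner_normal_self, real_inner_comm (normal T i) (x - T c), h, ← h2]
  simp
  norm_num

end Geometry

/-! ### Compatibility, boundary conditions and linearity of the lifting on a face -/

section Geometry

variable (T : Tet)

/-- The projection to the plane of a face. -/
noncomputable def tangentialPart (i : Fin 4) (w : E3) : E3 :=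
  w - inner ℝ (normal T i) w • normal T i

theorem inner_normal_tangentialPart (i : Fin 4) (w : E3) :
    inner ℝ (normal T i) (tangentialPart T i w) = 0 := by
  rw [tangentialPart, inner_sub_right, real_inner_smul_right, inner_normal_self, mul_one, sub_self]

theorem gdiv_tangentialPart (i : Fin 4) (a x : E3) :
    gdiv (fun x => tangentialPart T i (x - a)) x = 2 := by
  let A : E3 →L[ℝ] E3 :=
    ContinuousLinearMap.id ℝ E3 - (innerSL ℝ (normal T i)).smulRight (normal T i)
  have hA : ∀ w, A w = tangentialPart T i w := fun w => by simp [A, tangentialPart]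
  have h1 : (fun x => tangentialPart T i (x - a)) = fun x => A x + -A a := by
    funext x; rw [← hA, map_sub, sub_eq_add_neg]
  have h2 := inner_normal_self T i
  rw [inner_E3] at h2
  rw [h1, gdiv_clm, tr, hA, hA, hA]
  simp only [tangentialPart, inner_unitVec_right, PiLp.sub_apply, PiLp.smul_apply, smul_eq_mul]
  simp [unitVec]
  linarith

/-- The field r (x - a), with a the vertex `c` and r the radial integral, has surface divergence `q`
and is tangential to the two edges through a. On the edge opposite to a, the gradient of the
coordinate of a has product -1 with x - a, so there the flux is a multiple of the mean of r. This is
the condition under which the edge correction in `L2_face` has an antiderivative. -/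
theorem mean_radial_eq_zero {p : ℕ} {i c : Fin 4} (hc : c ≠ i) {q : E3 → ℝ} (hq : q ∈ Pol p)
    (h0 : mean T {i}ᶜ q = 0) : mean T {i, c}ᶜ (radial 1 (T c) q) = 0 := by
  have hr := Pol_contDiff (radial_mem_Pol hq 1 (T c))
  have hrd := hr.differentiable (by simp)
  set r := radial 1 (T c) q
  -- The projection to the plane makes the field tangential on all of space, as `mean_gdiv`
  -- requires; on the face it changes nothing.
  set V : E3 → E3 := fun x => r x • tangentialPart T i (x - T c)
  have hcf : T c ∈ face T i := vertex_mem_facet T (by simpa)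
  have hWd : ContDiff ℝ ∞ fun x => tangentialPart T i (x - T c) := by
    unfold tangentialPart
    have h : ContDiff ℝ ∞ fun x : E3 => x - T c := contDiff_id.sub contDiff_const
    exact h.sub ((contDiff_const.inner ℝ h).smul contDiff_const)
  have hV : ContDiff ℝ ∞ V := hr.smul hWd
  have hface : ∀ x ∈ face T i, tangentialPart T i (x - T c) = x - T c := fun x hx => by
    rw [tangentialPart, inner_normal_sub_of_mem T hx hcf, zero_smul, sub_zero]
  have hVn : ∀ x, inner ℝ (normal T i) (V x) = 0 := fun x => by
    simp only [V]
    rw [real_inner_smul_right, inner_normal_tangentialPart, mul_zero]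
  have hdiv : ∀ x ∈ face T i, gdiv V x = q x := by
    intro x hx
    have h1 := radial_euler (Pol_contDiff hq) 1 (T c) x
    have h2 := gdiv_smul_field hrd (hWd.differentiable (by simp)) x
    have h3 : gdiv (fun x => tangentialPart T i (x - T c)) x = 2 :=
      gdiv_tangentialPart T i (T c) x
    rw [h2, hface x hx, h3, ← h1]
    simp; norm_num; ring
  have h1 := mean_gdiv T (card_face i : ({i}ᶜ : Finset (Fin 4)).card = 1 + 2) hV fun l hl x => by
    rw [show l = i by simpa using hl]
    exact (inner_gradBary_eq_zero_iff T i _).2 (hVn x)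
  rw [mean_congr T hdiv, h0] at h1
  rw [Finset.sum_eq_single_of_mem c (by simpa)] at h1
  · have h2 : mean T (({i}ᶜ : Finset (Fin 4)).erase c) (fun x => inner ℝ (gradBary T c) (V x)) =
        mean T {i, c}ᶜ fun x => (-1) * r x := by
      rw [show ({i}ᶜ : Finset (Fin 4)).erase c = {i, c}ᶜ by ext m; simp; tauto]
      refine mean_congr T fun x hx => ?_
      have hxf : x ∈ face T i := facet_mono T (by intro m; simp; tauto) hx
      have hx0 : T.coord c x = 0 := ((mem_facet T).1 hx).2 c (by simp)
      simp only [V]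
      rw [hface x hxf, real_inner_smul_right, ← coord_sub, hx0, coord_vertex, if_pos rfl]
      ring
    rw [h2, mean_const_mul] at h1
    have h3 := refS_volume_pos 1
    have h4 := refS_volume_pos 2
    have h5 : volume.real (refS 1) / volume.real (refS (1 + 1)) ≠ 0 := by positivity
    have h6 : volume.real (refS 1) / volume.real (refS (1 + 1)) * mean T {i, c}ᶜ r = 0 := by
      linarith
    exact (mul_eq_zero.1 h6).resolve_left h5
  · intro l hl hlc
    have hne : (({i}ᶜ : Finset (Fin 4)).erase l).Nonempty := ⟨c, by simp [hc, Ne.symm hlc]⟩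
    rw [← mean_const T hne 0]
    refine mean_congr T fun x hx => ?_
    have hxf : x ∈ face T i := facet_mono T (Finset.erase_subset _ _) hx
    have hx0 : T.coord l x = 0 := ((mem_facet T).1 hx).2 l (by simp)
    simp only [V]
    rw [hface x hxf, real_inner_smul_right, ← coord_sub, hx0, coord_vertex, if_neg hlc]
    ring

variable {T} {p : ℕ} (E : Extensions T p) (b : BasePoints)

/-- The edge function that is corrected in the definition of `L2_face`. -/
theorem inner_R2D_edge (i : Fin 4) (q : E3 → ℝ) (x : edge T (b.baseE i)) :
    inner ℝ (res (edge T (b.baseE i)) (R2D T i (T (b.apexF i)) (restrict (face T i) q)) x)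
      (inplaneNormal T i (b.apexF i)) =
    ‖gradIn T i (b.apexF i)‖⁻¹ * radial 1 (T (b.apexF i)) q x := by
  have hc := b.apexF_ne i
  have hsub := edge_subset_face T (b.baseE_eq i)
  have hcf : T (b.apexF i) ∈ face T i := vertex_mem_facet T (by simpa)
  rw [R2D_restrict T hc, res_restrict hsub, restrict_apply, real_inner_smul_left,
    inner_inplaneNormal T (inner_normal_sub_of_mem T (hsub x.2) hcf), ← coord_sub,
    ((mem_facet T).1 x.2).2 _ (by rw [b.baseE_eq]; simp), coord_vertex, if_pos rfl]
  ring

/-- The polynomial whose gradient corrects the lifting on a face. -/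
noncomputable def corrector (i : Fin 4) (q : E3 → ℝ) : body T → ℝ :=
  E.E0_edge (b.baseE i) (L1_edge T p (b.baseE i) (edgeDir T i (b.apexF i))
    (restrict (edge T (b.baseE i))
      (‖gradIn T i (b.apexF i)‖⁻¹ • radial 1 (T (b.apexF i)) q)))

theorem L2_face_restrict (i : Fin 4) (q : E3 → ℝ) :
    L2_face T p E b i (restrict (face T i) q) =
      R2D T i (T (b.apexF i)) (restrict (face T i) q) -
        bcurl T i (res (face T i) (corrector E b i q)) := by
  rw [L2_face, corrector]
  simp only [inner_R2D_edge]
  rfl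

theorem corrector_mem (i : Fin 4) (q : E3 → ℝ) : corrector E b i q ∈ PolOn (body T) (p + 1) :=
  E.E0_edge_mem _ _ (L1_edge_mem _ _ _)

theorem corrector_mem_smooth (i : Fin 4) (q : E3 → ℝ) :
    corrector E b i q ∈ smooth ℝ (body T) := PolOn_le_smooth (corrector_mem E b i q)

/-- Membership in the trace space, the surface divergence and linearity are all read off from this
one field on the tetrahedron. -/
theorem L2_face_eq_traceTan (i : Fin 4) (q : E3 → ℝ) :
    L2_face T p E b i (restrict (face T i) q) =
      traceTan T i (restrict (body T) (liftField T i (b.apexF i) q) - grad (corrector E b i q)) := by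
  rw [L2_face_restrict, map_sub, traceTan_liftField (b.apexF_ne i),
    traceTan_grad T i (corrector_mem_smooth E b i q)]

theorem exists_of_mem_W2Z_face {i : Fin 4} {u : face T i → ℝ} (hu : u ∈ W2Z_face T p i) :
    ∃ q ∈ Pol p, mean T {i}ᶜ q = 0 ∧ u = restrict (face T i) q := by
  obtain ⟨q, hq, rfl⟩ := mem_PolOn.1 (W2ZfaceSub_le_PolOn T p i hu)
  refine ⟨q, hq, ?_, rfl⟩
  have h1 := integral_facet_eq_mean T (card_face i) q
  have h2 : ∫ x, restrict (face T i) q x ∂μHE[2] = 0 := hu.2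
  have h3 : ∫ x : face T i, q x ∂μHE[2] = 0 := h2
  rw [h3] at h1
  exact (mul_eq_zero.1 h1.symm).resolve_left (measure_facet_pos T (card_face i)).ne'

theorem bdiv_L2_face {i : Fin 4} {u : face T i → ℝ} (hu : u ∈ W2Z_face T p i) :
    bdiv T i (L2_face T p E b i u) = u := by
  obtain ⟨q, hq, -, rfl⟩ := exists_of_mem_W2Z_face hu
  have h1 := W1_le_smooth T p (liftField_mem_W1 i (b.apexF i) hq)
  have h2 := corrector_mem_smooth E b i q
  rw [L2_face_eq_traceTan, bdiv_traceTan T i (sub_mem h1 (grad_mem_smooth T h2)),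
    curl_sub T h1 (grad_mem_smooth T h2), curl_grad T h2, sub_zero,
    traceNor_curl_liftField (b.apexF_ne i) hq]

theorem deriv_zero {A : Set E3} (x : A) (w : E3) : deriv (0 : A → ℝ) x w = 0 := by
  have h : ext0 (0 : A → ℝ) = fun _ => 0 := by
    funext y
    by_cases hy : y ∈ A
    · rw [ext0_of_mem _ hy]; rfl
    · rw [ext0_of_not_mem _ hy]
  rw [deriv, h]
  simp

/-- On the base edge the surface rotation of the corrector equals the normal component of the
Poincaré lifting, by the choice of the antiderivative. On the edges through the base point the
lifting is tangential to the edge, and the corrector vanishes there. -/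
theorem L2_face_mem {i : Fin 4} {u : face T i → ℝ} (hu : u ∈ W2Z_face T p i) :
    L2_face T p E b i u ∈ W1Z_face T p i := by
  obtain ⟨q, hq, h0, rfl⟩ := exists_of_mem_W2Z_face hu
  refine ⟨⟨_, sub_mem (liftField_mem_W1 i (b.apexF i) hq) (grad_mem_W1 (corrector_mem E b i q)),
    (L2_face_eq_traceTan E b i q).symm⟩, fun l hl x hx => ?_⟩
  have hc := b.apexF_ne i
  have hr := radial_mem_Pol hq 1 (T (b.apexF i))
  have hcf : T (b.apexF i) ∈ face T i := vertex_mem_facet T (by simpa)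
  obtain ⟨e, he⟩ := exists_edge i l hl
  have hxe := mem_edge T he x.2 hx
  have hd := inner_bcurl T he (corrector_mem_smooth E b i q) hxe
  rw [L2_face_restrict, Pi.sub_apply, inner_sub_left, sub_eq_zero]
  refine Eq.trans ?_ hd.symm
  by_cases hlc : l = b.apexF i
  · subst hlc
    obtain rfl := edge_eq_of_verts e (b.baseE i) (by rw [he, b.baseE_eq])
    rw [corrector, E.E0_edge_res _ _ (L1_edge_mem _ _ _),
      L1_edge_spec _ (edgeDir_ne_zero T hc) (edgeDir_tangential T he)
        (Submodule.smul_mem _ _ hr) ?_]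
    · have h1 := inner_R2D_edge b i q ⟨x, hxe⟩
      rw [res_apply (edge_subset_face T he)] at h1
      exact h1
    · have h1 := mean_const_mul (s := (b.baseE i).verts) T ‖gradIn T i (b.apexF i)‖⁻¹
        (radial 1 (T (b.apexF i)) q)
      rw [he, mean_radial_eq_zero T hc hq h0, mul_zero] at h1
      rw [he]
      exact h1
  · have hne : e ≠ b.baseE i := by
      rintro rfl
      have h1 := he.symm.trans (b.baseE_eq i)
      have h2 := compl_injective h1
      have h3 : l ∈ ({i, b.apexF i} : Finset (Fin 4)) := h2 ▸ by simp
      simp [hl, hlc] at h3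
    rw [corrector, E.E0_edge_zero _ _ (L1_edge_mem _ _ _) e hne, deriv_zero, R2D_restrict T hc,
      restrict_apply, real_inner_smul_left,
      inner_inplaneNormal T (inner_normal_sub_of_mem T x.2 hcf), ← coord_sub, hx, coord_vertex,
      if_neg hlc]
    ring

theorem grad_linear (c : ℝ) {φ ψ : body T → ℝ} (hφ : φ ∈ smooth ℝ (body T))
    (hψ : ψ ∈ smooth ℝ (body T)) : grad (c • φ + ψ) = c • grad φ + grad ψ := by
  obtain ⟨F, hF, rfl⟩ := mem_smooth.1 hφ
  obtain ⟨G, hG, rfl⟩ := mem_smooth.1 hψ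
  have hF' := hF.differentiable (by simp)
  have hG' := hG.differentiable (by simp)
  rw [← map_smul, ← map_add, grad_restrict T ((hF'.const_smul c).add hG'), grad_restrict T hF',
    grad_restrict T hG', ← map_smul, ← map_add]
  congr 1
  funext x
  refine ext_inner_right ℝ fun w => ?_
  rw [Pi.add_apply, Pi.smul_apply, inner_add_left, real_inner_smul_left, inner_ggrad, inner_ggrad,
    inner_ggrad, fderiv_add ((hF' x).const_smul c) (hG' x), fderiv_const_smul (hF' x)]
  rfl

theorem L2_face_linear {i : Fin 4} {u v : face T i → ℝ} (hu : u ∈ W2Z_face T p i)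
    (hv : v ∈ W2Z_face T p i) (c : ℝ) :
    L2_face T p E b i (c • u + v) = c • L2_face T p E b i u + L2_face T p E b i v := by
  obtain ⟨q, hq, hq0, rfl⟩ := exists_of_mem_W2Z_face hu
  obtain ⟨r, hr, hr0, rfl⟩ := exists_of_mem_W2Z_face hv
  have hc := b.apexF_ne i
  have hrad : radial 1 (T (b.apexF i)) (c • q + r) =
      c • radial 1 (T (b.apexF i)) q + radial 1 (T (b.apexF i)) r := by
    rw [radial_add ((Pol_contDiff hq).continuous.const_smul c) (Pol_contDiff hr).continuous,
      radial_smul]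
  -- The operator `L1_edge` is defined by a choice with default 0; its linearity is available only
  -- for mean-zero data.
  have hm : ∀ q ∈ Pol p, mean T {i}ᶜ q = 0 → mean T (b.baseE i).verts
      (‖gradIn T i (b.apexF i)‖⁻¹ • radial 1 (T (b.apexF i)) q) = 0 := fun q hq h0 => by
    have h1 := mean_const_mul (s := (b.baseE i).verts) T ‖gradIn T i (b.apexF i)‖⁻¹
      (radial 1 (T (b.apexF i)) q)
    rw [b.baseE_eq, mean_radial_eq_zero T hc hq h0, mul_zero] at h1
    rw [b.baseE_eq]
    exact h1
  have hcor : corrector E b i (c • q + r) = c • corrector E b i q + corrector E b i r := by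
    rw [corrector, hrad, smul_add, smul_comm _ c, L1_edge_linear _ (edgeDir_ne_zero T hc)
      (edgeDir_tangential T (b.baseE_eq i)) (Submodule.smul_mem _ _ (radial_mem_Pol hq 1 _))
      (hm q hq hq0) (Submodule.smul_mem _ _ (radial_mem_Pol hr 1 _)) (hm r hr hr0), map_add, map_smul]
    rfl
  have hlift : liftField T i (b.apexF i) (c • q + r) =
      c • liftField T i (b.apexF i) q + liftField T i (b.apexF i) r := by
    funext x
    simp only [liftField, hrad, Pi.add_apply, Pi.smul_apply, add_smul, smul_assoc, cross_add,
      cross_smul]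
  rw [← map_smul, ← map_add, L2_face_eq_traceTan, L2_face_eq_traceTan, L2_face_eq_traceTan, hcor,
    hlift, grad_linear c (corrector_mem_smooth E b i q) (corrector_mem_smooth E b i r), ← map_smul,
    ← map_add]
  congr 1
  rw [map_add, map_smul]
  module

end Geometry

/-- The function t² q(a + t (x - a)) has derivative t G(a + t (x - a)). This converse of
`radial_euler` uses the equation only on one segment, so it applies to equations valid on a face. -/
theorem radial_eq_of_euler {q G : E3 → ℝ} (hq : ContDiff ℝ ∞ q) (hG : Continuous G) {a x : E3}
    (h : ∀ t ∈ Set.Icc (0 : ℝ) 1, 2 * q (a + t • (x - a)) +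
      fderiv ℝ q (a + t • (x - a)) (t • (x - a)) = G (a + t • (x - a))) :
    radial 1 a G x = q x := by
  have h1 : ∀ t ∈ Set.uIcc (0 : ℝ) 1, HasDerivAt (fun t : ℝ => t ^ 2 * q (a + t • (x - a)))
      (t ^ 1 • G (a + t • (x - a))) t := by
    intro t ht
    rw [Set.uIcc_of_le zero_le_one] at ht
    have h2 : HasDerivAt (fun t : ℝ => a + t • (x - a)) (x - a) t := by
      simpa using ((hasDerivAt_id t).smul_const (x - a)).const_add a
    have h3 := ((hq.differentiable (by simp)) (a + t • (x - a))).hasFDerivAt.comp_hasDerivAt t h2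
    refine ((hasDerivAt_pow 2 t).mul h3).congr_deriv ?_
    rw [← h t ht, map_smul]
    simp; ring
  rw [radial, intervalIntegral.integral_eq_sub_of_hasDerivAt h1
    ((radial_continuous_integrand hG 1 a x).intervalIntegrable _ _)]
  simp

section Geometry

variable {T : Tet} {p : ℕ}

/-! ### Unisolvence on faces -/

/-- The trace has degree at most p, so it is itself an admissible weight and its square has zero
integral. -/
theorem traceEdge_eq_zero {i : Fin 4} {v : body T → E3} (hv : v ∈ Y1_face T p i) (e : Edge) :
    traceEdge T e v = 0 := by
  obtain ⟨q, hq, hqv⟩ := mem_PolOn.1 (traceEdge_mem_PolOn T p e hv.1)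
  have h1 := hv.2.1 e _ (traceEdge_mem_PolOn T p e hv.1)
  rw [← hqv] at h1 ⊢
  have h2 := eqOn_zero_of_integral_facet_eq_zero T (card_verts e) (G := fun x => q x * q x)
    ((Pol_contDiff hq).continuous.mul (Pol_contDiff hq).continuous)
    (fun x _ => mul_self_nonneg _) h1
  funext x
  exact mul_self_eq_zero.1 (h2 x x.2)

/-- With g the gradient of the coordinate `l`, this component equals V · (n × g), and n × g is
parallel to the edge of the face opposite to `l`. -/
theorem inner_gradBary_cross_normal {V : E3 → E3}
    (hV : ∀ e, ∀ x ∈ edge T e, inner ℝ (V x) (tangent T e) = 0) {j l : Fin 4} (hl : l ≠ j) {x : E3}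
    (hx : x ∈ face T j) (h0 : T.coord l x = 0) :
    inner ℝ (gradBary T l) (cross (V x) (normal T j)) = 0 := by
  obtain ⟨e, he⟩ := exists_edge j l hl
  have hxe := mem_edge T he hx h0
  set τ := cross (normal T j) (gradBary T l)
  have hτ : ∀ m ∉ e.verts, inner ℝ (gradBary T m) τ = 0 := by
    intro m hm
    rw [he] at hm
    rcases (by simp at hm; tauto : m = j ∨ m = l) with rfl | rfl
    · rw [inner_gradBary_eq_zero_iff, real_inner_comm]
      exact inner_cross_self_left _ _
    · rw [real_inner_comm]
      exact inner_cross_self_right _ _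
  rw [real_inner_comm, inner_cross_left]
  change inner ℝ (V x) τ = 0
  have h1 := hV e x hxe
  rw [tangent, real_inner_smul_right] at h1
  have h2 : inner ℝ (V x) (T e.1.2 - T e.1.1) = 0 :=
    (mul_eq_zero.1 h1).resolve_left (inv_ne_zero (norm_ne_zero_iff.2
      (sub_ne_zero.2 fun h => e.2.ne (T.ind.injective h).symm)))
  rw [sub_eq_smul T e hτ, real_inner_smul_right, h2, mul_zero]

/-- Integration by parts on a face for fields without tangential component on the edges. -/
theorem mean_mul_inner_gcurl {V : E3 → E3} (hVc : ContDiff ℝ ∞ V)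
    (hV : ∀ e, ∀ x ∈ edge T e, inner ℝ (V x) (tangent T e) = 0) (j : Fin 4) {φ : E3 → ℝ}
    (hφ : ContDiff ℝ ∞ φ) :
    mean T {j}ᶜ (fun x => φ x * inner ℝ (gcurl V x) (normal T j)) +
      mean T {j}ᶜ (fun x => inner ℝ (ggrad φ x) (cross (V x) (normal T j))) = 0 := by
  have hZ : ContDiff ℝ ∞ fun x => cross (V x) (normal T j) := contDiff_cross hVc contDiff_const
  have hZn : ∀ x, inner ℝ (gradBary T j) (φ x • cross (V x) (normal T j)) = 0 := fun x => by
    rw [real_inner_smul_right, (inner_gradBary_eq_zero_iff T j _).2 (inner_normal_cross T j _),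
      mul_zero]
  have h1 := mean_gdiv T (card_face j : ({j}ᶜ : Finset (Fin 4)).card = 1 + 2) (hφ.smul hZ)
    fun l hl x => by
      rw [show l = j by simpa using hl]
      exact hZn x
  rw [Finset.sum_eq_zero, mul_zero, neg_zero] at h1
  · rw [← mean_add T (face_nonempty j), ← h1]
    · congr 1
      funext x
      change _ = gdiv (fun y => φ y • cross (V y) (normal T j)) x
      rw [gdiv_smul_field (hφ.differentiable (by simp)) (hZ.differentiable (by simp)),
        gdiv_cross_const (hVc.differentiable (by simp)), inner_ggrad]
    · exact hφ.continuous.mul ((contDiff_gcurl hVc).continuous.inner continuous_const)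
    · exact (contDiff_ggrad hφ).continuous.inner hZ.continuous
  · intro l hl
    have hlj : l ≠ j := by simpa using hl
    obtain ⟨c, hc⟩ := (show ∀ j l : Fin 4, (({j}ᶜ : Finset (Fin 4)).erase l).Nonempty by decide) j l
    rw [← mean_const T ⟨c, hc⟩ 0]
    refine mean_congr T fun x hx => ?_
    have hxf : x ∈ face T j := facet_mono T (Finset.erase_subset _ _) hx
    have hx0 : T.coord l x = 0 := ((mem_facet T).1 hx).2 l (by simp)
    change inner ℝ (gradBary T l) (φ x • cross (V x) (normal T j)) = 0
    rw [real_inner_smul_right, inner_gradBary_cross_normal hV hlj hxf hx0, mul_zero]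

theorem tangential_expansion {j l₀ l₁ l₂ : Fin 4} (h : ({j}ᶜ : Finset (Fin 4)) = {l₀, l₁, l₂})
    (h01 : l₀ ≠ l₁) (h02 : l₀ ≠ l₂) (h12 : l₁ ≠ l₂) {w : E3}
    (hw : inner ℝ (normal T j) w = 0) : w = inner ℝ (gradBary T l₁) w • (T l₁ - T l₀) +
      inner ℝ (gradBary T l₂) w • (T l₂ - T l₀) := by
  have hj := (inner_gradBary_eq_zero_iff T j w).2 hw
  have h1 := sum_inner_gradBary T w
  have h2 := eq_sum_inner_gradBary T w
  have hz : ∀ m ∉ ({l₀, l₁, l₂} : Finset (Fin 4)), inner ℝ (gradBary T m) w = 0 := fun m hm => by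
    rw [← h] at hm
    rw [show m = j by simpa using hm, hj]
  have hn0 : l₀ ∉ ({l₁, l₂} : Finset (Fin 4)) := by simp [h01, h02]
  rw [← Finset.sum_subset (Finset.subset_univ {l₀, l₁, l₂}) fun m _ hm => hz m hm,
    Finset.sum_insert hn0, Finset.sum_pair h12] at h1
  rw [← Finset.sum_subset (Finset.subset_univ {l₀, l₁, l₂}) fun m _ hm => by
    rw [hz m hm, zero_smul], Finset.sum_insert hn0, Finset.sum_pair h12,
    eq_neg_of_add_eq_zero_left h1] at h2
  rw [smul_sub, smul_sub]
  conv_lhs => rw [h2]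
  module

theorem exists_face_vertices : ∀ j : Fin 4, ∃ l₀ l₁ l₂ : Fin 4,
    ({j}ᶜ : Finset (Fin 4)) = {l₀, l₁, l₂} ∧ l₀ ≠ l₁ ∧ l₀ ≠ l₂ ∧ l₁ ≠ l₂ := by decide

/-- The displacement transfers the whole weight of vertex `l` to vertex `l₀`. It supplies the zeros
from which `exists_mul_of_eq_zero` deduces divisibility by the coordinate `l`. -/
theorem sub_smul_mem_face {j l₀ l : Fin 4} (h0 : l₀ ≠ j) (hl : l ≠ j) (h : l₀ ≠ l) {x : E3}
    (hx : x ∈ face T j) : x - T.coord l x • (T l - T l₀) ∈ face T j ∧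
      T.coord l (x - T.coord l x • (T l - T l₀)) = 0 := by
  have hc : ∀ m, T.coord m (x - T.coord l x • (T l - T l₀)) =
      T.coord m x - T.coord l x * ((if m = l then 1 else 0) - (if m = l₀ then 1 else 0)) := by
    intro m
    have h1 := coord_sub T m (x - T.coord l x • (T l - T l₀)) x
    rw [sub_sub_cancel_left, inner_neg_right, real_inner_smul_right, inner_gradBary_sub] at h1
    linarith
  have hx' := (mem_facet T).1 hx
  refine ⟨(mem_facet T).2 ⟨fun m => ?_, fun m hm => ?_⟩, ?_⟩
  · rw [hc]
    have h1 := hx'.1 m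
    have h2 := hx'.1 l
    split_ifs with h3 h4 h4
    · exact absurd (h4.symm.trans h3) h
    · subst h3; linarith
    · linarith
    · linarith
  · have : m = j := by simpa using hm
    subst this
    rw [hc, hx'.2 m hm, if_neg hl.symm, if_neg h0.symm]
    ring
  · rw [hc, if_pos rfl, if_neg h.symm]
    ring

/-- A field of the form `P + q (x - a)` on a face, `a` a vertex, with vanishing normal component on
the edges, vanishing divergence and vanishing moments, is zero. -/
theorem cross_normal_eq_zero {V : E3 → E3}
    (hV : ∀ e, ∀ x ∈ edge T e, inner ℝ (V x) (tangent T e) = 0) {j l₀ l₁ l₂ : Fin 4}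
    (h : ({j}ᶜ : Finset (Fin 4)) = {l₀, l₁, l₂}) (h01 : l₀ ≠ l₁) (h02 : l₀ ≠ l₂) (h12 : l₁ ≠ l₂)
    {H : Fin 4 → E3 → ℝ} (hH : ∀ l, H l ∈ Pol p)
    (hHV : ∀ l, ∀ x ∈ face T j, inner ℝ (gradBary T l) (cross (V x) (normal T j)) = H l x)
    (hm : ∀ q ∈ VPol ((p : ℤ) - 1), (∀ x, inner ℝ (q x) (normal T j) = 0) →
      mean T {j}ᶜ (fun x => inner ℝ (q x) (cross (V x) (normal T j))) = 0) {x : E3}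
    (hx : x ∈ face T j) : cross (V x) (normal T j) = 0 := by
  have hmem : ∀ l, l ∈ ({j}ᶜ : Finset (Fin 4)) ↔ l ≠ j := fun l => by simp
  have hl0 : l₀ ≠ j := (hmem _).1 (by rw [h]; simp)
  have hl1 : l₁ ≠ j := (hmem _).1 (by rw [h]; simp)
  have hl2 : l₂ ≠ j := (hmem _).1 (by rw [h]; simp)
  -- The component along the gradient of the coordinate `l` vanishes on the edge where that
  -- coordinate is zero, so it contains the coordinate as a factor and the quotient has degree at
  -- most p - 1.
  have hdiv : ∀ l, l ≠ j → l₀ ≠ l → ∃ q ∈ Pol ((p : ℤ) - 1), ∀ x ∈ face T j,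
      H l x = T.coord l x * q x := by
    intro l hlj hl
    obtain ⟨q, hq, h1⟩ := exists_mul_of_eq_zero (hH l) (Pol_barycentric T l) (T l - T l₀)
    refine ⟨q, hq, fun x hx => h1 x ?_⟩
    obtain ⟨h2, h3⟩ := sub_smul_mem_face hl0 hlj hl hx
    rw [← hHV l _ h2]
    exact inner_gradBary_cross_normal hV hlj h2 h3
  obtain ⟨q₁, hq₁, h1⟩ := hdiv l₁ hl1 h01
  obtain ⟨q₂, hq₂, h2⟩ := hdiv l₂ hl2 h02
  -- The moment is taken against the quotients times the in-plane gradients. On the face the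
  -- integrand becomes λ₁ q₁² + λ₂ q₂², which is nonnegative.
  have h3 := hm _ (add_mem (VPol_smul_const hq₁ (gradIn T j l₁)) (VPol_smul_const hq₂ (gradIn T j l₂)))
    fun x => by
      simp only [Pi.add_apply]
      rw [inner_add_left, real_inner_smul_left, real_inner_smul_left, real_inner_comm,
        inner_normal_gradIn, real_inner_comm, inner_normal_gradIn]
      ring
  have hint : ∀ x ∈ face T j, inner ℝ (((fun x => q₁ x • gradIn T j l₁) +
      fun x => q₂ x • gradIn T j l₂) x) (cross (V x) (normal T j)) =
      T.coord l₁ x * (q₁ x * q₁ x) + T.coord l₂ x * (q₂ x * q₂ x) := by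
    intro x hx
    have hn := inner_normal_cross T j (V x)
    rw [Pi.add_apply, inner_add_left, real_inner_smul_left, real_inner_smul_left, inner_gradIn T hn,
      inner_gradIn T hn, hHV _ _ hx, hHV _ _ hx, h1 _ hx, h2 _ hx]
    ring
  rw [mean_congr T hint] at h3
  have hc : ∀ l, Continuous fun x => T.coord l x := fun l =>
    AffineMap.continuous_of_finiteDimensional _
  have c1 := (Pol_contDiff hq₁).continuous
  have c2 := (Pol_contDiff hq₂).continuous
  have h4 := eqOn_zero_of_integral_facet_eq_zero T (card_face j)
    (G := fun x => T.coord l₁ x * (q₁ x * q₁ x) + T.coord l₂ x * (q₂ x * q₂ x))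
    (((hc l₁).mul (c1.mul c1)).add ((hc l₂).mul (c2.mul c2)))
    (fun y hy => by
      have := ((mem_facet T).1 hy).1
      have h5 := mul_nonneg (this l₁) (mul_self_nonneg (q₁ y))
      have h6 := mul_nonneg (this l₂) (mul_self_nonneg (q₂ y))
      linarith)
    ((integral_facet_eq_mean T (card_face j) _).trans (by rw [h3, mul_zero])) x hx
  have hpos := ((mem_facet T).1 hx).1
  have h5 := mul_nonneg (hpos l₁) (mul_self_nonneg (q₁ x))
  have h6 := mul_nonneg (hpos l₂) (mul_self_nonneg (q₂ x))
  have h7 : H l₁ x = 0 := by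
    rw [h1 x hx]
    rcases mul_eq_zero.1 (le_antisymm (by linarith) h5) with h | h
    · rw [h, zero_mul]
    · rw [mul_self_eq_zero.1 h, mul_zero]
  have h8 : H l₂ x = 0 := by
    rw [h2 x hx]
    rcases mul_eq_zero.1 (le_antisymm (by linarith) h6) with h | h
    · rw [h, zero_mul]
    · rw [mul_self_eq_zero.1 h, mul_zero]
  rw [tangential_expansion h h01 h02 h12 (inner_normal_cross T j (V x)), hHV _ _ hx, hHV _ _ hx, h7,
    h8, zero_smul, zero_smul, add_zero]

/-- The normal component φ of the curl is a polynomial of degree at most p on the face, so its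
surface gradient is an admissible weight of degree p - 1. Integration by parts turns the vanishing
moment into ∫ φ² = 0. -/
theorem inner_gcurl_eq_zero {i j : Fin 4} {V : E3 → E3}
    (hv : restrict (body T) V ∈ Y1_face T p i) {m : ℤ} (hVp : V ∈ VPol m)
    (hV : ∀ e, ∀ x ∈ edge T e, inner ℝ (V x) (tangent T e) = 0)
    (hm : ∀ q ∈ VPol ((p : ℤ) - 1), (∀ x, inner ℝ (q x) (normal T j) = 0) →
      mean T {j}ᶜ (fun x => inner ℝ (q x) (cross (V x) (normal T j))) = 0) {x : E3}
    (hx : x ∈ face T j) : inner ℝ (gcurl V x) (normal T j) = 0 := by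
  have hVc := VPol_contDiff hVp
  have h1 := traceNor_mem_PolOn T p j (curl_mem_W2 hv.1)
  rw [curl_restrict T (hVc.differentiable (by simp)), traceNor_restrict] at h1
  obtain ⟨φ, hφ, hφe⟩ := mem_PolOn.1 h1
  have hφe' : ∀ x ∈ face T j, φ x = inner ℝ (gcurl V x) (normal T j) := fun x hx =>
    congrFun hφe ⟨x, hx⟩
  have h2 := mean_mul_inner_gcurl hVc hV j (Pol_contDiff hφ)
  have hg := VPol_ggrad hφ
  -- Weights must be tangential everywhere; the normal part of the gradient does not contribute to
  -- the moment.
  have htest := hm (fun x => tangentialPart T j (ggrad φ x))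
    (sub_mem hg (VPol_linear_comp hg ((innerSL ℝ (normal T j)).smulRight (normal T j))))
    fun x => by rw [real_inner_comm]; exact inner_normal_tangentialPart T j _
  rw [mean_congr T (H := fun x => inner ℝ (ggrad φ x) (cross (V x) (normal T j)))] at htest
  swap
  · intro x hx
    rw [tangentialPart, inner_sub_left, real_inner_smul_left, inner_normal_cross, mul_zero, sub_zero]
  rw [htest, add_zero, mean_congr T (H := fun x => φ x * φ x) fun x hx => by rw [hφe' x hx]] at h2
  have h3 := eqOn_zero_of_integral_facet_eq_zero T (card_face j) (G := fun x => φ x * φ x)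
    ((Pol_contDiff hφ).continuous.mul (Pol_contDiff hφ).continuous)
    (fun x _ => mul_self_nonneg _)
    ((integral_facet_eq_mean T (card_face j) fun x => φ x * φ x).trans (by rw [h2, mul_zero])) x hx
  rw [← hφe' x hx]
  exact mul_self_eq_zero.1 h3

/-- The extensions `E^1_f` have vanishing tangential traces on the other faces. -/
theorem traceTan_eq_zero {i j : Fin 4} (hji : j ≠ i) {v : body T → E3} (hv : v ∈ Y1_face T p i) :
    traceTan T j v = 0 := by
  obtain ⟨l₀, l₁, l₂, h, h01, h02, h12⟩ := exists_face_vertices j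
  have hl0 : T l₀ ∈ face T j := vertex_mem_facet T (by rw [h]; simp)
  obtain ⟨P, hP, Q, hQ, rfl⟩ := (mem_W1 (T l₀)).1 hv.1
  set V : E3 → E3 := fun x => P x + cross (Q x) (x - T l₀)
  have hVp : V ∈ VPol (p + 1) := add_mem (VPol_mono (by lia) hP) (VPol_cross_sub hQ _)
  have hVc := VPol_contDiff hVp
  have hV : ∀ e, ∀ x ∈ edge T e, inner ℝ (V x) (tangent T e) = 0 := fun e x hx => by
    have h1 := traceEdge_eq_zero hv e
    rw [traceEdge_restrict] at h1
    exact congrFun h1 ⟨x, hx⟩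
  have hm : ∀ q ∈ VPol ((p : ℤ) - 1), (∀ x, inner ℝ (q x) (normal T j) = 0) →
      mean T {j}ᶜ (fun x => inner ℝ (q x) (cross (V x) (normal T j))) = 0 := by
    intro q hq hqn
    have h1 := hv.2.2.1 j hji _ ⟨q, hq, rfl⟩ fun x => hqn x
    rw [traceTan_restrict] at h1
    have h2 := integral_facet_eq_mean T (card_face j)
      fun x => inner ℝ (q x) (cross (V x) (normal T j))
    rw [show ∫ x : face T j, inner ℝ (q x) (cross (V x) (normal T j)) ∂μHE[2] = 0 from h1] at h2
    exact (mul_eq_zero.1 h2.symm).resolve_left (measure_facet_pos T (card_face j)).ne'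
  have hcurl := fun x hx => inner_gcurl_eq_zero hv hVp hV hm (x := x) hx
  have hPc := VPol_contDiff hP
  have hQc := VPol_contDiff hQ
  -- The vanishing normal component of the curl is an Euler equation on the face for the normal
  -- component of `Q`, with right-hand side `G` of degree p - 1.
  set G : E3 → ℝ := fun x => -inner ℝ (gcurl P x) (normal T j)
  have hG : G ∈ Pol ((p : ℤ) - 1) := neg_mem (Pol_inner (VPol_gcurl hP) (normal T j))
  set q : E3 → ℝ := fun x => inner ℝ (Q x) (normal T j)
  have hqc : ContDiff ℝ ∞ q := hQc.inner ℝ contDiff_const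
  have hqd : ∀ x w, fderiv ℝ q x w = inner ℝ (fderiv ℝ Q x w) (normal T j) := fun x w => by
    have := fderiv_inner_apply ℝ ((hQc.differentiable (by simp)) x)
      (differentiableAt_const (normal T j)) w
    simpa using this
  have heuler : ∀ x ∈ face T j, 2 * q x + fderiv ℝ q x (x - T l₀) = G x := by
    intro x hx
    have h1 := hcurl x hx
    have h2 := congrFun (gcurl_add (hPc.differentiable (by simp))
      ((VPol_contDiff (VPol_cross_sub hQ (T l₀))).differentiable (by simp))) x
    rw [show V = P + fun x => cross (Q x) (x - T l₀) from rfl, h2, Pi.add_apply,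
      gcurl_cross_sub (hQc.differentiable (by simp)), inner_add_left, inner_sub_left, inner_add_left,
      real_inner_smul_left, real_inner_smul_left, real_inner_comm (normal T j) (x - T l₀),
      inner_normal_sub_of_mem T hx hl0] at h1
    rw [hqd]
    simp only [q, G]
    linarith
  -- Hence on the face Q · n is a radial integral of degree at most p - 1, one less than expected.
  -- This lowers the degree of V × n from p + 1 to p, as `cross_normal_eq_zero` requires.
  have hrad : ∀ x ∈ face T j, radial 1 (T l₀) G x = q x := fun x hx =>
    radial_eq_of_euler hqc (Pol_contDiff hG).continuous fun t ht => by
      have := heuler _ (facet_star T hl0 hx ht)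
      rwa [add_sub_cancel_left] at this
  have hZ : ∀ x ∈ face T j, cross (V x) (normal T j) =
      cross (P x) (normal T j) + radial 1 (T l₀) G x • (x - T l₀) := by
    intro x hx
    rw [hrad x hx, cross_add, cross_cross, real_inner_comm (normal T j) (x - T l₀),
      inner_normal_sub_of_mem T hx hl0, zero_smul, sub_zero]
  rw [traceTan_restrict]
  funext x
  refine cross_normal_eq_zero (p := p) hV h h01 h02 h12
    (H := fun l x => inner ℝ (cross (P x) (normal T j)) (gradBary T l) +
      radial 1 (T l₀) G x * (T.coord l x - T.coord l (T l₀))) (fun l => ?_) (fun l y hy => ?_) hm x.2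
  · refine add_mem (Pol_inner (VPol_linear_comp hP (crossL.flip (normal T j))) _) ?_
    have := Pol_mul (radial_mem_Pol hG 1 (T l₀)) (sub_mem (Pol_barycentric T l)
      (Pol_mono zero_le_one (Pol_const (T.coord l (T l₀)))))
    rwa [sub_add_cancel] at this
  · rw [hZ y hy, inner_add_right, real_inner_smul_right, ← coord_sub, real_inner_comm]

end Geometry

theorem gdiv_radial {U : E3 → E3} (hU : ContDiff ℝ ∞ U) (k : ℕ) (a x : E3) :
    gdiv (radial k a U) x = radial (k + 1) a (gdiv U) x := by
  have hc : ∀ w j, Continuous fun y => fderiv ℝ U y w j := fun w j =>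
    (contDiff_fderiv_component hU w j).continuous
  have h1 : ∀ w j, fderiv ℝ (radial k a U) x w j =
      radial (k + 1) a (fun y => fderiv ℝ U y w j) x := fun w j => by
    rw [fderiv_radial hU, radial_component (contDiff_fderiv_apply hU w).continuous]
  have h2 : gdiv U = (fun y => fderiv ℝ U y (unitVec 0) 0) +
      (fun y => fderiv ℝ U y (unitVec 1) 1) + fun y => fderiv ℝ U y (unitVec 2) 2 := rfl
  rw [h2, radial_add ((hc _ _).add (hc _ _)) (hc _ _), radial_add (hc _ _) (hc _ _)]
  simp only [Pi.add_apply, ← h1]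
  rfl

theorem sum_inner_smul_cross (a b c w : E3) : (inner ℝ a w : ℝ) • cross b c +
    (inner ℝ b w : ℝ) • cross c a + (inner ℝ c w : ℝ) • cross a b =
      (inner ℝ a (cross b c) : ℝ) • w := by
  ext k
  fin_cases k <;> simp [inner_E3, cross] <;> ring

section Geometry

variable {T : Tet} {p : ℕ}

/-! ### Poincaré liftings on the tetrahedron -/

theorem R_restrict (c : Fin 4) (U : E3 → E3) : R T (T c) (restrict (body T) U) =
    restrict (body T) fun x => cross (radial 1 (T c) U x) (x - T c) := by
  funext x
  rw [R, restrict_apply, radial]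
  congr 1
  refine intervalIntegral.integral_congr fun t ht => ?_
  rw [Set.uIcc_of_le zero_le_one] at ht
  simp only [ext0_restrict U (facet_star T (vertex_mem_facet T (Finset.mem_univ c)) x.2 ht), pow_one]

theorem D_restrict (c : Fin 4) (q : E3 → ℝ) : D T (T c) (restrict (body T) q) =
    restrict (body T) fun x => radial 2 (T c) q x • (x - T c) := by
  funext x
  rw [D, restrict_apply, radial]
  congr 1
  refine intervalIntegral.integral_congr fun t ht => ?_
  rw [Set.uIcc_of_le zero_le_one] at ht
  simp only [ext0_restrict q (facet_star T (vertex_mem_facet T (Finset.mem_univ c)) x.2 ht),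
    smul_eq_mul]

theorem R_mem_smooth (c : Fin 4) {u : body T → E3} (hu : u ∈ W2 T p) :
    R T (T c) u ∈ smooth E3 (body T) := by
  obtain ⟨U, hU, rfl⟩ := W2_le_VPolOn T p hu
  rw [R_restrict]
  exact restrict_mem_smooth _ (VPol_contDiff (VPol_cross_sub (radial_mem_VPol hU 1 _) _))

/-- By `gcurl_cross_sub` and `radial_euler` with k = 1, the curl is u minus a multiple of x - a. The
factor is the radial integral of div u, which only sees segments inside the tetrahedron and
therefore vanishes. -/
theorem curl_R (c : Fin 4) {u : body T → E3} (hu : u ∈ W2 T p) (hd : div u = 0) :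
    curl (R T (T c) u) = u := by
  obtain ⟨U, hU, rfl⟩ := W2_le_VPolOn T p hu
  have hUc := VPol_contDiff hU
  have hr := radial_mem_VPol hU 1 (T c)
  rw [div_restrict T (hUc.differentiable (by simp))] at hd
  rw [R_restrict, curl_restrict T ((VPol_contDiff (VPol_cross_sub hr _)).differentiable (by simp))]
  refine restrict_congr fun x hx => ?_
  have h1 : radial 2 (T c) (gdiv U) x = 0 := by
    refine (intervalIntegral.integral_congr (g := fun _ => (0 : ℝ)) fun t ht => ?_).trans (by simp)
    rw [Set.uIcc_of_le zero_le_one] at ht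
    have h2 := congrFun hd ⟨_, facet_star T (vertex_mem_facet T (Finset.mem_univ c)) hx ht⟩
    rw [restrict_apply] at h2
    simp only [h2]
    simp
  have h3 := radial_euler hUc 1 (T c) x
  rw [gcurl_cross_sub ((VPol_contDiff hr).differentiable (by simp)), gdiv_radial hUc, h1, zero_smul,
    sub_zero, ← h3]
  norm_num

variable (E : Extensions T p) (b : BasePoints)

theorem grad_E0_face_mem (i : Fin 4) (u : face T i → E3) :
    E.E0_face i (L1_face T p i u) ∈ smooth ℝ (body T) :=
  PolOn_le_smooth (E.E0_face_mem i _ (L1_face_mem i u))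

theorem L2_T_mem_smooth {u : body T → E3} (hu : u ∈ W2 T p) :
    L2_T T p E b u ∈ smooth E3 (body T) :=
  sub_mem (R_mem_smooth b.apex2 hu) (grad_mem_smooth T (grad_E0_face_mem E _ _))

/-- The subtracted gradient affects boundary values only; for the curl it suffices that its
potential is smooth. -/
theorem curl_L2_T {u : body T → E3} (hu : u ∈ W2 T p) (hd : div u = 0) :
    curl (L2_T T p E b u) = u := by
  rw [L2_T, curl_sub T (R_mem_smooth b.apex2 hu) (grad_mem_smooth T (grad_E0_face_mem E _ _)),
    curl_grad T (grad_E0_face_mem E _ _), sub_zero, curl_R _ hu hd]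

/-! ### Curls of the face extensions -/

/-- The field `curl E^1_f L^2_f u`. -/
noncomputable def faceField (i : Fin 4) (u : face T i → ℝ) : body T → E3 :=
  curl (E.E1_face i (L2_face T p E b i u))

theorem E1_L2_face_mem {i : Fin 4} {u : face T i → ℝ} (hu : u ∈ W2Z_face T p i) :
    E.E1_face i (L2_face T p E b i u) ∈ Y1_face T p i :=
  E.E1_face_mem i _ (L2_face_mem E b hu)

theorem faceField_mem {i : Fin 4} {u : face T i → ℝ} (hu : u ∈ W2Z_face T p i) :
    faceField E b i u ∈ W2 T p := curl_mem_W2 (E1_L2_face_mem E b hu).1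

theorem faceField_linear {i : Fin 4} {u v : face T i → ℝ} (hu : u ∈ W2Z_face T p i)
    (hv : v ∈ W2Z_face T p i) (c : ℝ) :
    faceField E b i (c • u + v) = c • faceField E b i u + faceField E b i v := by
  rw [faceField, L2_face_linear E b hu hv, map_add, map_smul,
    curl_linear T c (W1_le_smooth T p (E1_L2_face_mem E b hu).1)
      (W1_le_smooth T p (E1_L2_face_mem E b hv).1)]
  rfl

/-- The normal trace of a curl is the surface divergence of the tangential trace. The extension
restores that trace, and `bdiv_L2_face` recovers `u`. -/
theorem traceNor_faceField {i : Fin 4} {u : face T i → ℝ} (hu : u ∈ W2Z_face T p i) :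
    traceNor T i (faceField E b i u) = u := by
  rw [faceField, ← bdiv_traceTan T i (W1_le_smooth T p (E1_L2_face_mem E b hu).1),
    E.E1_face_trace i _ (L2_face_mem E b hu), bdiv_L2_face E b hu]

/-- Here the tangential trace itself vanishes, by unisolvence on the face `j`. -/
theorem traceNor_faceField_of_ne {i j : Fin 4} (h : j ≠ i) {u : face T i → ℝ}
    (hu : u ∈ W2Z_face T p i) : traceNor T j (faceField E b i u) = 0 := by
  have h0 := bdiv_traceTan T j (zero_mem (smooth E3 (body T)))
  rw [curl_zero, map_zero, map_zero] at h0
  rw [faceField, ← bdiv_traceTan T j (W1_le_smooth T p (E1_L2_face_mem E b hu).1),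
    traceTan_eq_zero h (E1_L2_face_mem E b hu), h0]

theorem div_faceField {i : Fin 4} {u : face T i → ℝ} (hu : u ∈ W2Z_face T p i) :
    div (faceField E b i u) = 0 := div_curl T (W1_le_smooth T p (E1_L2_face_mem E b hu).1)

/-! ### The divergence theorem on the tetrahedron -/

theorem univ_erase (l : Fin 4) : (Finset.univ : Finset (Fin 4)).erase l = {l}ᶜ := by
  ext m; simp

theorem mean_gdiv_body {U : E3 → E3} (hU : ContDiff ℝ ∞ U) : mean T Finset.univ (gdiv U) =
    -(volume.real (refS 2) / volume.real (refS 3) *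
      ∑ l, mean T {l}ᶜ fun x => inner ℝ (gradBary T l) (U x)) := by
  have h := mean_gdiv T (d := 2) (s := Finset.univ) (by simp) hU (by simp)
  simpa only [univ_erase] using h

theorem integral_body_eq_zero_iff (q : E3 → ℝ) :
    ∫ x, restrict (body T) q x ∂μHE[3] = 0 ↔ mean T Finset.univ q = 0 := by
  have h1 : ∫ x, restrict (body T) q x ∂μHE[3] = _ := integral_facet_eq_mean T card_body q
  rw [h1, mul_eq_zero, or_iff_right (measure_facet_pos T card_body).ne']

theorem integral_face_eq_zero_iff (i : Fin 4) (q : E3 → ℝ) :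
    ∫ x, restrict (face T i) q x ∂μHE[2] = 0 ↔ mean T {i}ᶜ q = 0 := by
  have h1 : ∫ x, restrict (face T i) q x ∂μHE[2] = _ := integral_facet_eq_mean T (card_face i) q
  rw [h1, mul_eq_zero, or_iff_right (measure_facet_pos T (card_face i)).ne']

/-- This makes the divergence of the remainder an element of the target space of `P3_T` once the
normal traces have been removed. -/
theorem integral_div_eq_zero {u : body T → E3} (hu : u ∈ smooth E3 (body T))
    (h : ∀ i, traceNor T i u = 0) : ∫ x, div u x ∂μHE[3] = 0 := by
  obtain ⟨U, hU, rfl⟩ := mem_smooth.1 hu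
  rw [div_restrict T (hU.differentiable (by simp)), integral_body_eq_zero_iff, mean_gdiv_body hU,
    Finset.sum_eq_zero, mul_zero, neg_zero]
  intro l _
  rw [← mean_const T (face_nonempty l) 0]
  refine mean_congr T fun x hx => ?_
  have h1 := h l
  rw [traceNor_restrict] at h1
  have h2 : inner ℝ (U x) (normal T l) = 0 := congrFun h1 ⟨x, hx⟩
  rw [inner_gradBary_eq_zero_iff, real_inner_comm, h2]

theorem D_mem_W2 (c : Fin 4) {u : body T → ℝ} (hu : u ∈ PolOn (body T) p) :
    D T (T c) u ∈ W2 T p := by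
  obtain ⟨q, hq, rfl⟩ := mem_PolOn.1 hu
  rw [D_restrict]
  exact (mem_W2 (T c)).2 ⟨0, zero_mem _, _, radial_mem_Pol hq 2 (T c), by simp⟩

/-- The divergence is 3 r + Dr (x - a), which is the Euler equation with k = 2; hence the weight t²
in `D`. -/
theorem gdiv_radial_smul {q : E3 → ℝ} (hq : q ∈ Pol p) (a : E3) :
    gdiv (fun x => radial 2 a q x • (x - a)) = q := by
  funext x
  have h1 := radial_euler (Pol_contDiff hq) 2 a x
  rw [gdiv_smul_sub ((Pol_contDiff (radial_mem_Pol hq 2 a)).differentiable (by simp)), ← h1]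
  norm_num

theorem div_D (c : Fin 4) {u : body T → ℝ} (hu : u ∈ PolOn (body T) p) : div (D T (T c) u) = u := by
  obtain ⟨q, hq, rfl⟩ := mem_PolOn.1 hu
  rw [D_restrict, div_restrict T ((VPol_contDiff (VPol_smul_sub (radial_mem_Pol hq 2 _)
    (T c))).differentiable (by simp)), gdiv_radial_smul hq]

theorem D_linear (c : Fin 4) {u v : body T → ℝ} (hu : u ∈ PolOn (body T) p)
    (hv : v ∈ PolOn (body T) p) (r : ℝ) :
    D T (T c) (r • u + v) = r • D T (T c) u + D T (T c) v := by
  obtain ⟨q, hq, rfl⟩ := mem_PolOn.1 hu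
  obtain ⟨q', hq', rfl⟩ := mem_PolOn.1 hv
  rw [← map_smul, ← map_add, D_restrict, D_restrict, D_restrict,
    radial_add ((Pol_contDiff hq).continuous.const_smul r) (Pol_contDiff hq').continuous,
    radial_smul, ← map_smul, ← map_add]
  congr 1
  funext x
  simp only [Pi.add_apply, Pi.smul_apply, add_smul, smul_assoc]

theorem traceNor_D_of_ne {c j : Fin 4} (h : j ≠ c) {u : body T → ℝ} (hu : u ∈ PolOn (body T) p) :
    traceNor T j (D T (T c) u) = 0 := by
  obtain ⟨q, hq, rfl⟩ := mem_PolOn.1 hu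
  rw [D_restrict, traceNor_restrict, ← map_zero (restrict (face T j))]
  refine restrict_congr fun x hx => ?_
  have h1 := inner_normal_sub_of_mem T hx (vertex_mem_facet T (by simpa using h.symm : c ∈ _))
  rw [real_inner_smul_left, real_inner_comm, h1, mul_zero]
  rfl

/-- The total flux is the integral of the divergence `u`, which is zero, and the faces through the
base point contribute nothing. The flux through the opposite face therefore vanishes. -/
theorem traceNor_D_mem (c : Fin 4) {u : body T → ℝ} (hu : u ∈ PolOn (body T) p)
    (h0 : ∫ x, u x ∂μHE[3] = 0) : traceNor T c (D T (T c) u) ∈ W2Z_face T p c := by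
  refine ⟨⟨_, D_mem_W2 c hu, rfl⟩, ?_⟩
  have hne := fun j (hj : j ≠ c) => traceNor_D_of_ne hj hu
  obtain ⟨q, hq, rfl⟩ := mem_PolOn.1 hu
  rw [integral_body_eq_zero_iff] at h0
  have hF := VPol_contDiff (VPol_smul_sub (radial_mem_Pol hq 2 (T c)) (T c))
  rw [D_restrict] at hne ⊢
  simp only [traceNor_restrict] at hne ⊢
  rw [integral_face_eq_zero_iff]
  have h1 := mean_gdiv_body (T := T) hF
  rw [gdiv_radial_smul hq, h0, Finset.sum_eq_single_of_mem c (Finset.mem_univ c)] at h1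
  · have h2 : mean T {c}ᶜ (fun x => inner ℝ (gradBary T c) (radial 2 (T c) q x • (x - T c))) =
        -‖gradBary T c‖ * mean T {c}ᶜ fun x =>
          inner ℝ (radial 2 (T c) q x • (x - T c)) (normal T c) := by
      rw [← mean_const_mul]
      congr 1
      funext x
      conv_lhs => rw [gradBary_eq T c, real_inner_smul_left, real_inner_comm]
    have h3 := refS_volume_pos 2
    have h4 := refS_volume_pos 3
    have h5 : volume.real (refS 2) / volume.real (refS 3) ≠ 0 := by positivity
    have h6 := (mul_eq_zero.1 (neg_eq_zero.1 h1.symm)).resolve_left h5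
    rw [h2] at h6
    exact (mul_eq_zero.1 h6).resolve_left
      (neg_ne_zero.2 (norm_ne_zero_iff.2 (gradBary_ne_zero T c)))
  · intro l _ hl
    rw [← mean_const T (face_nonempty l) 0]
    refine mean_congr T fun x hx => ?_
    have h2 := congrFun (hne l hl) ⟨x, hx⟩
    rw [restrict_apply] at h2
    rw [inner_gradBary_eq_zero_iff, real_inner_comm, h2]
    rfl

theorem L3_T_eq (u : body T → ℝ) : L3_T T p E b u = D T (T b.apex3) u -
    faceField E b b.apex3 (traceNor T b.apex3 (D T (T b.apex3) u)) := rfl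

theorem L3_T_mem {u : body T → ℝ} (hu : u ∈ PolOn (body T) p) (h0 : ∫ x, u x ∂μHE[3] = 0) :
    L3_T T p E b u ∈ W2 T p :=
  sub_mem (D_mem_W2 _ hu) (faceField_mem E b (traceNor_D_mem _ hu h0))

theorem div_L3_T {u : body T → ℝ} (hu : u ∈ PolOn (body T) p) (h0 : ∫ x, u x ∂μHE[3] = 0) :
    div (L3_T T p E b u) = u := by
  have h := traceNor_D_mem b.apex3 hu h0
  rw [L3_T_eq, div_sub T (W2_le_smooth T p (D_mem_W2 _ hu))
    (W2_le_smooth T p (faceField_mem E b h)), div_D _ hu, div_faceField E b h, sub_zero]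

theorem traceNor_L3_T {u : body T → ℝ} (hu : u ∈ PolOn (body T) p) (h0 : ∫ x, u x ∂μHE[3] = 0)
    (i : Fin 4) : traceNor T i (L3_T T p E b u) = 0 := by
  have h := traceNor_D_mem b.apex3 hu h0
  rw [L3_T_eq, map_sub]
  by_cases hi : i = b.apex3
  · rw [hi, traceNor_faceField E b h, sub_self]
  · rw [traceNor_D_of_ne hi hu, traceNor_faceField_of_ne E b hi h, sub_zero]

theorem L3_T_linear {u v : body T → ℝ} (hu : u ∈ PolOn (body T) p) (hu0 : ∫ x, u x ∂μHE[3] = 0)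
    (hv : v ∈ PolOn (body T) p) (hv0 : ∫ x, v x ∂μHE[3] = 0) (c : ℝ) :
    L3_T T p E b (c • u + v) = c • L3_T T p E b u + L3_T T p E b v := by
  rw [L3_T_eq, L3_T_eq, L3_T_eq, D_linear _ hu hv, map_add, map_smul,
    faceField_linear E b (traceNor_D_mem _ hu hu0) (traceNor_D_mem _ hv hv0)]
  module

/-- By `sum_inner_smul_cross` the linear part is a scalar triple product times x, so the field has
the form constant plus constant times x. -/
theorem whitney2_mem (i : Fin 4) : whitney2 T i ∈ W2 T p := by
  have h : ∀ m x, T.coord m x = T.coord m 0 + inner ℝ (gradBary T m) x := fun m x => by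
    have := coord_sub T m x 0
    rw [sub_zero] at this
    linarith
  set g := gradBary T
  refine (mem_W2 0).2 ⟨fun _ => gwhitney2 T i 0, mem_VPol.2 fun k =>
    Pol_mono (by lia) (Pol_const _), fun _ => 2 * orient T i *
      inner ℝ (g (i.succAbove 0)) (cross (g (i.succAbove 1)) (g (i.succAbove 2))),
    Pol_mono (by lia) (Pol_const _), ?_⟩
  rw [whitney2_eq]
  refine congrArg _ (funext fun x => ?_)
  rw [sub_zero, mul_smul, ← sum_inner_smul_cross _ _ _ x]
  simp only [gwhitney2, h _ x]
  module

end Geometry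

section Geometry

variable {T : Tet} {p : ℕ}

/-! ### The stages of the interpolation operator -/

variable (T) in
/-- The lowest order interpolant. -/
noncomputable def fluxPart (u : body T → E3) : body T → E3 :=
  ∑ i : Fin 4, (∫ x, traceNor T i u x ∂μHE[2]) • whitney2 T i

/-- The contribution of the faces. -/
noncomputable def facePart (ε : ℝ) (E : Extensions T p) (b : BasePoints) (u : body T → E3) :
    body T → E3 := ∑ i : Fin 4, faceField E b i (P2_face T p ε i (traceNor T i u))

/-- The contribution of the divergence. -/
noncomputable def divPart (E : Extensions T p) (b : BasePoints) (u : body T → E3) : body T → E3 :=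
  L3_T T p E b (P3_T T p (div u))

variable (ε : ℝ) (E : Extensions T p) (b : BasePoints)

/-- The final curl and lifting cancel on the range of `P2_T`. The stages enter as equations so that
other expressions for them can be substituted, such as linear combinations or curls. -/
theorem Pi2_eq (u : body T → E3) {u₀ u₁ u₂ : body T → E3} (h₀ : u₀ = u - fluxPart T u)
    (h₁ : u₁ = u₀ - facePart ε E b u₀) (h₂ : u₂ = u₁ - divPart E b u₁) :
    Pi2 T p ε E b u = P2_T T p u₂ + fluxPart T u + facePart ε E b u₀ + divPart E b u₁ := by
  subst h₀ h₁ h₂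
  rw [← curl_L2_T E b (P2_T_mem _).1.1 (P2_T_mem _).2]
  rfl

theorem fluxPart_mem (u : body T → E3) : fluxPart T u ∈ W2 T p :=
  sum_mem fun i _ => Submodule.smul_mem _ _ (whitney2_mem i)

theorem facePart_mem (u : body T → E3) : facePart ε E b u ∈ W2 T p :=
  sum_mem fun i _ => faceField_mem E b (P2_face_mem ε i _)

theorem divPart_mem (u : body T → E3) : divPart E b u ∈ W2 T p :=
  L3_T_mem E b (P3_T_mem _).1 (P3_T_mem _).2

theorem fluxPart_linear {u v : body T → E3} (hu : u ∈ smooth E3 (body T))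
    (hv : v ∈ smooth E3 (body T)) (c : ℝ) :
    fluxPart T (c • u + v) = c • fluxPart T u + fluxPart T v := by
  rw [fluxPart, fluxPart, fluxPart, Finset.smul_sum, ← Finset.sum_add_distrib]
  refine Finset.sum_congr rfl fun i _ => ?_
  have hu' := smooth_integrable T (card_face i) (traceNor_mem_smooth T i hu)
  have hv' := smooth_integrable T (card_face i) (traceNor_mem_smooth T i hv)
  have h1 := integral_add (hu'.const_mul c) hv'
  rw [integral_const_mul] at h1
  rw [smul_smul, ← add_smul, ← h1, map_add, map_smul]
  rfl

theorem facePart_linear {ε : ℝ} (hε : 0 < ε) (hε' : ε < 1 / 2) {u v : body T → E3}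
    (hu : u ∈ smooth E3 (body T)) (hv : v ∈ smooth E3 (body T)) (c : ℝ) :
    facePart ε E b (c • u + v) = c • facePart ε E b u + facePart ε E b v := by
  rw [facePart, facePart, facePart, Finset.smul_sum, ← Finset.sum_add_distrib]
  refine Finset.sum_congr rfl fun i _ => ?_
  rw [map_add, map_smul, P2_face_linear hε hε' i (traceNor_mem_smooth T i hu)
    (traceNor_mem_smooth T i hv), faceField_linear E b (P2_face_mem ε i _) (P2_face_mem ε i _)]

theorem divPart_linear {u v : body T → E3} (hu : u ∈ smooth E3 (body T))
    (hv : v ∈ smooth E3 (body T)) (c : ℝ) :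
    divPart E b (c • u + v) = c • divPart E b u + divPart E b v := by
  rw [divPart, div_linear T c hu hv, P3_T_linear (div_mem_smooth T hu) (div_mem_smooth T hv),
    L3_T_linear E b (P3_T_mem _).1 (P3_T_mem _).2 (P3_T_mem _).1 (P3_T_mem _).2]
  rfl

theorem Pi2_mem (u : body T → E3) : Pi2 T p ε E b u ∈ W2 T p := by
  rw [Pi2_eq ε E b u rfl rfl rfl]
  exact add_mem (add_mem (add_mem (P2_T_mem _).1.1 (fluxPart_mem _)) (facePart_mem ε E b _))
    (divPart_mem E b _)

theorem Pi2_linear {ε : ℝ} (hε : 0 < ε) (hε' : ε < 1 / 2) {u v : body T → E3}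
    (hu : u ∈ smooth E3 (body T)) (hv : v ∈ smooth E3 (body T)) (c : ℝ) :
    Pi2 T p ε E b (c • u + v) = c • Pi2 T p ε E b u + Pi2 T p ε E b v := by
  have hW := W2_le_smooth T p
  obtain ⟨u₀, hu₀⟩ : ∃ w, w = u - fluxPart T u := ⟨_, rfl⟩
  obtain ⟨v₀, hv₀⟩ : ∃ w, w = v - fluxPart T v := ⟨_, rfl⟩
  obtain ⟨u₁, hu₁⟩ : ∃ w, w = u₀ - facePart ε E b u₀ := ⟨_, rfl⟩
  obtain ⟨v₁, hv₁⟩ : ∃ w, w = v₀ - facePart ε E b v₀ := ⟨_, rfl⟩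
  obtain ⟨u₂, hu₂⟩ : ∃ w, w = u₁ - divPart E b u₁ := ⟨_, rfl⟩
  obtain ⟨v₂, hv₂⟩ : ∃ w, w = v₁ - divPart E b v₁ := ⟨_, rfl⟩
  have su₀ : u₀ ∈ smooth E3 (body T) := hu₀ ▸ sub_mem hu (hW (fluxPart_mem u))
  have sv₀ : v₀ ∈ smooth E3 (body T) := hv₀ ▸ sub_mem hv (hW (fluxPart_mem v))
  have su₁ : u₁ ∈ smooth E3 (body T) := hu₁ ▸ sub_mem su₀ (hW (facePart_mem ε E b u₀))
  have sv₁ : v₁ ∈ smooth E3 (body T) := hv₁ ▸ sub_mem sv₀ (hW (facePart_mem ε E b v₀))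
  have su₂ : u₂ ∈ smooth E3 (body T) := hu₂ ▸ sub_mem su₁ (hW (divPart_mem E b u₁))
  have sv₂ : v₂ ∈ smooth E3 (body T) := hv₂ ▸ sub_mem sv₁ (hW (divPart_mem E b v₁))
  have l₀ := fluxPart_linear hu hv c
  have l₁ := facePart_linear E b hε hε' su₀ sv₀ c
  have l₂ := divPart_linear E b su₁ sv₁ c
  -- The remainders for c u + v are the corresponding combinations of the remainders for u and v.
  rw [Pi2_eq ε E b u hu₀ hu₁ hu₂, Pi2_eq ε E b v hv₀ hv₁ hv₂,
    Pi2_eq (u₀ := c • u₀ + v₀) (u₁ := c • u₁ + v₁) (u₂ := c • u₂ + v₂) ε E b (c • u + v)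
      (by rw [l₀, hu₀, hv₀]; module) (by rw [l₁, hu₁, hv₁]; module)
      (by rw [l₂, hu₂, hv₂]; module), l₀, l₁, l₂, P2_T_linear su₂ sv₂]
  module

/-- By `flux_whitney2` the Whitney part reproduces all fluxes, so the remainder has none. -/
theorem traceNor_sub_fluxPart_mem {u : body T → E3} (hu : u ∈ W2 T p) (i : Fin 4) :
    traceNor T i (u - fluxPart T u) ∈ W2Z_face T p i := by
  refine ⟨⟨_, sub_mem hu (fluxPart_mem u), rfl⟩, ?_⟩
  have hint : ∀ w ∈ W2 T p, Integrable (traceNor T i w) (μHE[2] : Measure (face T i)) := fun w hw =>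
    smooth_integrable T (card_face i) (traceNor_mem_smooth T i (W2_le_smooth T p hw))
  have h1 : ∫ x, traceNor T i (fluxPart T u) x ∂μHE[2] = ∫ x, traceNor T i u x ∂μHE[2] := by
    rw [fluxPart, map_sum]
    simp only [Finset.sum_apply, map_smul, Pi.smul_apply, smul_eq_mul]
    rw [integral_finsetSum _ fun j _ => (hint _ (whitney2_mem j)).const_mul _]
    simp only [integral_const_mul, flux_whitney2]
    simp
  have h2 := integral_sub (hint u hu) (hint _ (fluxPart_mem u))
  rw [h1, sub_self] at h2
  rw [map_sub]
  exact h2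

/-- Each projection meets an element of its own target space. After the flux stage the normal traces
have mean zero and the face stage reproduces them. Without normal traces the divergence has mean
zero, so the divergence stage removes it and adds no trace. What is left is divergence free without
normal trace and is fixed by `P2_T`. -/
theorem Pi2_self {ε : ℝ} (hε : 0 < ε) (hε' : ε < 1 / 2) {u : body T → E3} (hu : u ∈ W2 T p) :
    Pi2 T p ε E b u = u := by
  have hW := W2_le_smooth T p
  obtain ⟨u₀, hu₀⟩ : ∃ w, w = u - fluxPart T u := ⟨_, rfl⟩
  obtain ⟨u₁, hu₁⟩ : ∃ w, w = u₀ - facePart ε E b u₀ := ⟨_, rfl⟩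
  obtain ⟨u₂, hu₂⟩ : ∃ w, w = u₁ - divPart E b u₁ := ⟨_, rfl⟩
  have s₀ : u₀ ∈ W2 T p := hu₀ ▸ sub_mem hu (fluxPart_mem u)
  have s₁ : u₁ ∈ W2 T p := hu₁ ▸ sub_mem s₀ (facePart_mem ε E b u₀)
  have s₂ : u₂ ∈ W2 T p := hu₂ ▸ sub_mem s₁ (divPart_mem E b u₁)
  have z₀ : ∀ i, traceNor T i u₀ ∈ W2Z_face T p i := hu₀ ▸ traceNor_sub_fluxPart_mem hu
  have z₁ : ∀ i, traceNor T i u₁ = 0 := by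
    intro i
    rw [hu₁, map_sub, facePart, map_sum, Finset.sum_eq_single_of_mem i (Finset.mem_univ i),
      traceNor_faceField E b (P2_face_mem ε i _), P2_face_self hε hε' i (z₀ i), sub_self]
    exact fun j _ hj => traceNor_faceField_of_ne E b hj.symm (P2_face_mem ε j _)
  have d₁ := div_mem_PolOn s₁
  have i₁ := integral_div_eq_zero (hW s₁) z₁
  have hdiv : divPart E b u₁ = L3_T T p E b (div u₁) := by rw [divPart, P3_T_self d₁ i₁]
  have z₂ : u₂ ∈ W2Z T p := ⟨s₂, fun i => by
    rw [hu₂, map_sub, z₁, hdiv, traceNor_L3_T E b d₁ i₁, sub_zero]⟩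
  have d₂ : div u₂ = 0 := by
    rw [hu₂, div_sub T (hW s₁) (hW (divPart_mem E b u₁)), hdiv, div_L3_T E b d₁ i₁, sub_self]
  rw [Pi2_eq ε E b u hu₀ hu₁ hu₂, P2_T_self z₂ d₂, hu₂, hu₁, hu₀]
  abel

/-! ### The commuting diagram property -/

theorem whitney1_sum_mem_smooth (a : Edge → ℝ) :
    ∑ e, a e • whitney1 T e ∈ smooth E3 (body T) :=
  sum_mem fun e _ => Submodule.smul_mem _ _ (restrict_mem_smooth _ (VPol_contDiff (gwhitney1_mem T e)))

theorem curl_whitney1_sum (a : Edge → ℝ) : curl (∑ e, a e • whitney1 T e) =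
    restrict (body T) fun x => ∑ e, a e • gcurl (gwhitney1 T e) x := by
  have hs : ∀ e, whitney1 T e ∈ smooth E3 (body T) := fun e =>
    restrict_mem_smooth _ (VPol_contDiff (gwhitney1_mem T e))
  rw [curl_sum T _ fun e _ => Submodule.smul_mem _ _ (hs e)]
  have h : ∀ e, curl (a e • whitney1 T e) = a e • restrict (body T) (gcurl (gwhitney1 T e)) := by
    intro e
    have := curl_linear T (a e) (hs e) (zero_mem _)
    rw [curl_zero, add_zero, add_zero] at this
    rw [this, whitney1_eq, curl_restrict T ((VPol_contDiff (gwhitney1_mem T e)).differentiable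
      (by simp))]
  simp only [h]
  funext x
  simp only [Finset.sum_apply, Pi.smul_apply, restrict_apply]

theorem fluxPart_curl {u : body T → E3} (hu : u ∈ smooth E3 (body T)) : fluxPart T (curl u) =
    curl (∑ e : Edge, (∫ x, traceEdge T e u x ∂μHE[1]) • whitney1 T e) := by
  obtain ⟨U, hU, rfl⟩ := mem_smooth.1 hu
  rw [curl_whitney1_sum, curl_restrict T (hU.differentiable (by simp))]
  funext x
  rw [restrict_apply, ← whitney_commute T hU x, fluxPart]
  simp only [Finset.sum_apply, Pi.smul_apply, whitney2_eq, restrict_apply]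

/-- The curls of successive remainders of `Pi1` are the remainders of `Pi2` applied to curl u: the
gradient stages do not change the curl, the Whitney stages match by Stokes' theorem, and the face
stages are fed the same function because of `bdiv_traceTan`. Both procedures then apply `P2_T` to
the same field. -/
theorem Pi2_curl {ε : ℝ} {u : body T → E3} (hu : u ∈ smooth E3 (body T)) :
    Pi2 T p ε E b (curl u) = curl (Pi1 T p ε E b u) := by
  have hW1 := W1_le_smooth T p
  have hgrad : ∀ {q : body T → ℝ}, q ∈ PolOn (body T) ((p : ℤ) + 1) →
      grad q ∈ smooth E3 (body T) ∧ curl (grad q) = 0 := fun hq =>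
    ⟨grad_mem_smooth_of_PolOn T hq, curl_grad T (PolOn_le_smooth hq)⟩
  have hsum : ∀ {ι : Type} [Fintype ι] {q : ι → body T → ℝ},
      (∀ j, q j ∈ PolOn (body T) ((p : ℤ) + 1)) →
      ∑ j, grad (q j) ∈ smooth E3 (body T) ∧ curl (∑ j, grad (q j)) = 0 := by
    intro ι _ q hq
    refine ⟨sum_mem fun j _ => (hgrad (hq j)).1, ?_⟩
    rw [curl_sum T _ fun j _ => (hgrad (hq j)).1, Finset.sum_eq_zero fun j _ => (hgrad (hq j)).2]
  obtain ⟨w₀, hw₀⟩ : ∃ w, w = ∑ e : Edge, (∫ x, traceEdge T e u x ∂μHE[1]) • whitney1 T e :=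
    ⟨_, rfl⟩
  obtain ⟨u₀, hu₀⟩ : ∃ w, w = u - w₀ := ⟨_, rfl⟩
  obtain ⟨w₁, hw₁⟩ : ∃ w, w = ∑ e : Edge, grad (E.E0_edge e
    (L1_edge T p e (tangent T e) (P1_edge T p ε e (traceEdge T e u₀)))) := ⟨_, rfl⟩
  obtain ⟨u₁, hu₁⟩ : ∃ w, w = u₀ - w₁ := ⟨_, rfl⟩
  obtain ⟨w₂, hw₂⟩ : ∃ w, w = ∑ i : Fin 4, E.E1_face i
    (L2_face T p E b i (P2_face T p ε i (bdiv T i (traceTan T i u₁)))) := ⟨_, rfl⟩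
  obtain ⟨u₂, hu₂⟩ : ∃ w, w = u₁ - w₂ := ⟨_, rfl⟩
  obtain ⟨w₃, hw₃⟩ : ∃ w, w = ∑ i : Fin 4, grad (E.E0_face i
    (L1_face T p i (P1_face T p ε i (traceTan T i u₂)))) := ⟨_, rfl⟩
  obtain ⟨u₃, hu₃⟩ : ∃ w, w = u₂ - w₃ := ⟨_, rfl⟩
  obtain ⟨w₄, hw₄⟩ : ∃ w, w = L2_T T p E b (P2_T T p (curl u₃)) := ⟨_, rfl⟩
  have hPi : Pi1 T p ε E b u =
      grad (L1_T T p (P1_T T p (u₃ - w₄))) + w₄ + w₃ + w₂ + w₁ + w₀ := by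
    simp only [Pi1, ← hw₀, ← hu₀, ← hw₁, ← hu₁, ← hw₂, ← hu₂, ← hw₃, ← hu₃, ← hw₄]
  have s₀ : w₀ ∈ smooth E3 (body T) := hw₀ ▸ whitney1_sum_mem_smooth _
  have su₀ : u₀ ∈ smooth E3 (body T) := hu₀ ▸ sub_mem hu s₀
  obtain ⟨s₁, c₁⟩ : w₁ ∈ smooth E3 (body T) ∧ curl w₁ = 0 :=
    hw₁ ▸ hsum fun e => E.E0_edge_mem e _ (L1_edge_mem e _ _)
  have su₁ : u₁ ∈ smooth E3 (body T) := hu₁ ▸ sub_mem su₀ s₁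
  have m₂ : ∀ i, E.E1_face i (L2_face T p E b i (P2_face T p ε i (bdiv T i (traceTan T i u₁)))) ∈
      smooth E3 (body T) := fun i => hW1 (E1_L2_face_mem E b (P2_face_mem ε i _)).1
  have s₂ : w₂ ∈ smooth E3 (body T) := hw₂ ▸ sum_mem fun i _ => m₂ i
  have su₂ : u₂ ∈ smooth E3 (body T) := hu₂ ▸ sub_mem su₁ s₂
  obtain ⟨s₃, c₃⟩ : w₃ ∈ smooth E3 (body T) ∧ curl w₃ = 0 :=
    hw₃ ▸ hsum fun i => E.E0_face_mem i _ (L1_face_mem i _)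
  have su₃ : u₃ ∈ smooth E3 (body T) := hu₃ ▸ sub_mem su₂ s₃
  have s₄ : w₄ ∈ smooth E3 (body T) := hw₄ ▸ L2_T_mem_smooth E b (P2_T_mem _).1.1
  obtain ⟨s₅, c₅⟩ := hgrad (L1_T_mem (T := T) (p := p) (P1_T T p (u₃ - w₄))).1
  have c₀ : curl w₀ = fluxPart T (curl u) := by rw [hw₀, fluxPart_curl hu]
  have d₁ : curl u₁ = curl u - fluxPart T (curl u) := by
    rw [hu₁, curl_sub T su₀ s₁, c₁, sub_zero, hu₀, curl_sub T hu s₀, c₀]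
  have c₂ : curl w₂ = facePart ε E b (curl u₁) := by
    rw [hw₂, curl_sum T _ fun i _ => m₂ i, facePart]
    refine Finset.sum_congr rfl fun i _ => ?_
    rw [bdiv_traceTan T i su₁]
    rfl
  have d₃ : curl u₃ = curl u₁ - facePart ε E b (curl u₁) := by
    rw [hu₃, curl_sub T su₂ s₃, c₃, sub_zero, hu₂, curl_sub T su₁ s₂, c₂]
  -- The remainder is a curl, so `P3_T` receives 0; linearity of `L3_T` shows that it maps 0 to 0.
  have hz : divPart E b (curl u₃) = 0 := by
    have h0 := L3_T_linear E b (zero_mem (PolOn (body T) p)) (by simp)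
      (zero_mem (PolOn (body T) p)) (by simp) (-1)
    rw [divPart, div_curl T su₃, P3_T_self (zero_mem _) (by simp)]
    simpa using h0
  rw [hPi, curl_add T (add_mem (add_mem (add_mem (add_mem s₅ s₄) s₃) s₂) s₁) s₀,
    curl_add T (add_mem (add_mem (add_mem s₅ s₄) s₃) s₂) s₁,
    curl_add T (add_mem (add_mem s₅ s₄) s₃) s₂, curl_add T (add_mem s₅ s₄) s₃, curl_add T s₅ s₄,
    c₀, c₁, c₂, c₃, c₅, hw₄, curl_L2_T E b (P2_T_mem _).1.1 (P2_T_mem _).2,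
    Pi2_eq (u₂ := curl u₃) ε E b (curl u) d₁ d₃ (by rw [hz, sub_zero]), hz]
  abel

end Geometry

end PBI

theorem lemma4p3 (T : PBI.Tet) (p : ℕ) (ε : ℝ) (hε : 0 < ε) (hε' : ε < 1 / 2)
    (E : PBI.Extensions T p) (b : PBI.BasePoints) :
    (∀ u ∈ PBI.smooth PBI.E3 (PBI.body T), ∀ v ∈ PBI.smooth PBI.E3 (PBI.body T), ∀ c : ℝ,
      PBI.Pi2 T p ε E b (c • u + v) = c • PBI.Pi2 T p ε E b u + PBI.Pi2 T p ε E b v) ∧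
    PBI.W2 T p ≤ PBI.smooth PBI.E3 (PBI.body T) ∧
    (∀ u ∈ PBI.smooth PBI.E3 (PBI.body T), PBI.Pi2 T p ε E b u ∈ PBI.W2 T p) ∧
    (∀ u ∈ PBI.W2 T p, PBI.Pi2 T p ε E b u = u) ∧
    (∀ u ∈ PBI.smooth PBI.E3 (PBI.body T),
      PBI.Pi2 T p ε E b (PBI.curl u) = PBI.curl (PBI.Pi1 T p ε E b u)) :=
  ⟨fun _ hu _ hv c => PBI.Pi2_linear E b hε hε' hu hv c, PBI.W2_le_smooth T p,
    fun u _ => PBI.Pi2_mem ε E b u, fun _ hu => PBI.Pi2_self E b hε hε' hu,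
    fun _ hu => PBI.Pi2_curl E b hu⟩
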